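/- Let $\delta,\ell,b,P>0$ and write $\Omega=(-\delta,\ell)$. Let $\mathcal M(\Omega)$ be the space of finite signed Radon measures on $\Omega$; $\mu_n\stackrel{*}{\rightharpoonup}\mu$ in $\mathcal M(\Omega)$ means $\int\psi\,d\mu_n\to\int\psi\,d\mu$ for all $\psi\in C_c(\Omega)$. Let $C_0=[0,\ell]$, $C_n=\tfrac13 C_{n-1}\cup\tfrac13(C_{n-1}+2\ell)$ for $n\ge 1$, and let $C=\bigcap_n C_n$ be the middle-third Cantor set on $[0,\ell]$. Put $s=\ln 2/\ln 3$, let $\mathcal H^s$ be the $s$-dimensional Hausdorff measure and $\mathcal L$ the Lebesgue measure. Derivatives are taken in the sense of distributions on $\Omega$, and $u(\ell)$ is the value at $\ell$ of the representative of $u\in W^{1,1}(\Omega)$ that is continuous on $[-\delta,\ell]$. Let $b_n=(2/3)^n b$ on $C_n$ and $b_n=+\infty$ on $\Omega\setminus C_n$ (with $\infty\cdot 0=0$), let $\mathcal W=\{u\in W^{2,2}(\Omega): u=0 \text{ on }(-\delta,0]\}$, and $$E_n(u)=\begin{cases}\tfrac12\int_0^\ell b_n|u''|^2\,d\mathcal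 L-P\,u(\ell)&\text{if }u\in\mathcal W,\\ +\infty&\text{otherwise.}\end{cases}$$ Let $V=\{u\in W^{1,1}(\Omega): u''\in\mathcal M(\Omega)\}$ (which contains $W^{2,2}(\Omega)$), let $\mathcal W_\infty=\{u\in V: u''\ll\mathcal H^s\llcorner C,\ u=0\text{ on }(-\delta,0]\}$, and for $u\in V$ let $$E_\infty(u)=\begin{cases}\displaystyle\int_C\frac{b\,\mathcal H^s(C)}{2\ell}\Big(\frac{du''}{d(\mathcal H^s\llcorner C)}\Big)^2d\mathcal H^s-P\,u(\ell)&\text{if }u\in\mathcal W_\infty,\\ +\infty&\text{if }u\in V\setminus\mathcal W_\infty,\end{cases}$$ where the value $+\infty$ of the integral is allowed. Then $E_n$ $\Gamma$-converges to $E_\infty$ in the following sense. (i) For every $u\in V$ and every sequence $(u_n)$ in $W^{2,2}(\Omega)$ such that $u_n\to u$ in $W^{1,1}(\Omega)$ and $u_n''\mathcal L\stackrel{*}{\rightharpoonup}u''$ in $\mathcal M(\Omega)$, $$\liminf_{n\to\infty}E_n(u_n)\ge E_\infty(u).$$ (ii) For every $u\in V$ there is a sequence $(u_n)$ in $W^{2,2}(\Omega)$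 such that $u_n\to u$ in $W^{1,1}(\Omega)$, $u_n''\mathcal L\stackrel{*}{\rightharpoonup}u''$ in $\mathcal M(\Omega)$, and $$\limsup_{n\to\infty}E_n(u_n)\le E_\infty(u).$$ -/

import Mathlib

open MeasureTheory Filter Topology Set
open scoped ENNReal ContDiff

noncomputable section

namespace CantorBeam

/-! Functions on an open set `Ω ⊆ ℝ` are represented by functions `ℝ → ℝ`, of which only the
values on `Ω`, up to null sets, matter in the definitions below. -/

/-- `φ` belongs to `C_c^∞(Ω)`. -/
def IsTestFunction (Ω : Set ℝ) (φ : ℝ → ℝ) : Prop :=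
  ContDiff ℝ ∞ φ ∧ HasCompactSupport φ ∧ tsupport φ ⊆ Ω

/-- `v` is a weak derivative of `u` on `Ω`. -/
def HasWeakDeriv (Ω : Set ℝ) (u v : ℝ → ℝ) : Prop :=
  LocallyIntegrableOn u Ω ∧ LocallyIntegrableOn v Ω ∧
    ∀ φ : ℝ → ℝ, IsTestFunction Ω φ →
      ∫ x in Ω, u x * deriv φ x = -∫ x in Ω, v x * φ x

open Classical in
/-- The weak derivative `u'` of `u` on `Ω` (unique up to null sets for open `Ω`), `0` if there is
none. -/
def weakDeriv (Ω : Set ℝ) (u : ℝ → ℝ) : ℝ → ℝ :=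
  if h : ∃ v, HasWeakDeriv Ω u v then h.choose else 0

/-- `u` belongs to the Sobolev space `W^{m,p}(Ω)`. -/
def MemSobolev : ℕ → ℝ≥0∞ → Set ℝ → (ℝ → ℝ) → Prop
  | 0, p, Ω, u => MemLp u p (volume.restrict Ω)
  | m + 1, p, Ω, u => MemLp u p (volume.restrict Ω) ∧
      ∃ v, HasWeakDeriv Ω u v ∧ MemSobolev m p Ω v

/-- The finite signed (Radon) measure `μ`, concentrated on `Ω`, is the distributional derivative
of `v` on `Ω`. -/
def HasWeakDerivMeasure (Ω : Set ℝ) (v : ℝ → ℝ) (μ : SignedMeasure ℝ) : Prop :=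
  LocallyIntegrableOn v Ω ∧ μ.restrict Ω = μ ∧
    ∀ φ : ℝ → ℝ, IsTestFunction Ω φ →
      ∫ x in Ω, v x * deriv φ x = -∫ᵛ x, φ x ∂<•μ

/-- `u ∈ W^{1,1}(Ω)` and `u'' ∈ M(Ω)`. -/
def MemW11MeasureSecondDeriv (Ω : Set ℝ) (u : ℝ → ℝ) : Prop :=
  MemSobolev 1 1 Ω u ∧ ∃ μ : SignedMeasure ℝ, HasWeakDerivMeasure Ω (weakDeriv Ω u) μ

open Classical in
/-- The measure `u''` on `Ω` (unique for open `Ω`), `0` if `u''` is not a finite measure. -/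
def secondDerivMeasure (Ω : Set ℝ) (u : ℝ → ℝ) : SignedMeasure ℝ :=
  if h : ∃ μ : SignedMeasure ℝ, HasWeakDerivMeasure Ω (weakDeriv Ω u) μ then h.choose else 0

/-- Weak* convergence in `M(Ω)`, tested against `C_c(Ω)`. -/
def WeakStarTendsto (Ω : Set ℝ) (μs : ℕ → SignedMeasure ℝ) (μ : SignedMeasure ℝ) : Prop :=
  ∀ ψ : ℝ → ℝ, Continuous ψ → HasCompactSupport ψ → tsupport ψ ⊆ Ω →
    Tendsto (fun n => ∫ᵛ x, ψ x ∂<•(μs n)) atTop (𝓝 (∫ᵛ x, ψ x ∂<•μ))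

/-- Convergence `us n → u` in the norm of `W^{1,1}(Ω)`. -/
def TendstoW11 (Ω : Set ℝ) (us : ℕ → ℝ → ℝ) (u : ℝ → ℝ) : Prop :=
  Tendsto (fun n => eLpNorm (us n - u) 1 (volume.restrict Ω) +
    eLpNorm (weakDeriv Ω (us n) - weakDeriv Ω u) 1 (volume.restrict Ω)) atTop (𝓝 0)

/-- The open interval `(-δ, ℓ)` occupied by the beam. -/
def beam (δ ℓ : ℝ) : Set ℝ := Ioo (-δ) ℓ

/-- The second weak derivative `u''` of `u ∈ W^{2,2}(-δ,ℓ)`. -/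
def secondDeriv (δ ℓ : ℝ) (u : ℝ → ℝ) : ℝ → ℝ := weakDeriv (beam δ ℓ) (weakDeriv (beam δ ℓ) u)

open Classical in
/-- The value `u(ℓ)` at the end point: the value at `ℓ` of the representative of `u` that is
continuous on `[-δ, ℓ]` (it exists and is unique for `u ∈ W^{1,1}(-δ,ℓ)`). -/
def endValue (δ ℓ : ℝ) (u : ℝ → ℝ) : ℝ :=
  if h : ∃ w : ℝ → ℝ, ContinuousOn w (Icc (-δ) ℓ) ∧ w =ᵐ[volume.restrict (beam δ ℓ)] u
  then h.choose ℓ else 0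

/-- The `n`-th step in the construction of the middle third Cantor set on `[0, ℓ]`. -/
def cantorStep (ℓ : ℝ) : ℕ → Set ℝ
  | 0 => Icc 0 ℓ
  | n + 1 => (fun x => x / 3) '' cantorStep ℓ n ∪ (fun x => (x + 2 * ℓ) / 3) '' cantorStep ℓ n

/-- The middle third Cantor set on `[0, ℓ]`. -/
def cantor (ℓ : ℝ) : Set ℝ := ⋂ n, cantorStep ℓ n

/-- The exponent `s = ln 2 / ln 3`. -/
def dimS : ℝ := Real.log 2 / Real.log 3

/-- The measure `H^s ⌞ C`. -/
def cantorMeasure (ℓ : ℝ) : Measure ℝ := (Measure.hausdorffMeasure dimS).restrict (cantor ℓ)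

open Classical in
/-- The bending stiffness: `(2/3)^n b` on the `n`-th Cantor step and `+∞` off it. -/
def stiffness (ℓ b : ℝ) (n : ℕ) (x : ℝ) : ℝ≥0∞ :=
  if x ∈ cantorStep ℓ n then ENNReal.ofReal ((2 / 3) ^ n * b) else ⊤

/-- `u = 0` on `(-δ, 0]`, as an equality of classes of functions. -/
def ClampedAtWall (δ : ℝ) (u : ℝ → ℝ) : Prop :=
  ∀ᵐ x ∂(volume.restrict (Ioc (-δ) 0)), u x = 0

/-- The space `𝒲` of the `u ∈ W^{2,2}(-δ,ℓ)` with `u = 0` on `(-δ, 0]`. -/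
def MemW (δ ℓ : ℝ) (u : ℝ → ℝ) : Prop :=
  MemSobolev 2 2 (beam δ ℓ) u ∧ ClampedAtWall δ u

/-- The space `𝒲_∞` of the `u ∈ W^{1,1}(-δ,ℓ)` with `u'' ∈ M(-δ,ℓ)`, `u'' ≪ H^s ⌞ C` and `u = 0`
on `(-δ, 0]`. -/
def MemWInf (δ ℓ : ℝ) (u : ℝ → ℝ) : Prop :=
  MemW11MeasureSecondDeriv (beam δ ℓ) u ∧
    VectorMeasure.AbsolutelyContinuous (secondDerivMeasure (beam δ ℓ) u)
      (cantorMeasure ℓ).toENNRealVectorMeasure ∧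
    ClampedAtWall δ u

open Classical in
/-- The energy `E_n`. -/
def energy (δ ℓ b P : ℝ) (n : ℕ) (u : ℝ → ℝ) : EReal :=
  if MemW δ ℓ u then
    (((1 / 2 : ℝ≥0∞) * ∫⁻ x in Ioo 0 ℓ,
        stiffness ℓ b n x * ENNReal.ofReal (secondDeriv δ ℓ u x ^ 2) : ℝ≥0∞) : EReal)
      - ((P * endValue δ ℓ u : ℝ) : EReal)
  else ⊤

open Classical in
/-- The energy `E_∞`. -/
def energyInf (δ ℓ b P : ℝ) (u : ℝ → ℝ) : EReal :=
  if MemWInf δ ℓ u then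
    ((∫⁻ x, ENNReal.ofReal b * Measure.hausdorffMeasure dimS (cantor ℓ)
          / (2 * ENNReal.ofReal ℓ)
        * ENNReal.ofReal
            ((secondDerivMeasure (beam δ ℓ) u).rnDeriv (cantorMeasure ℓ) x ^ 2)
        ∂(cantorMeasure ℓ) : ℝ≥0∞) : EReal)
      - ((P * endValue δ ℓ u : ℝ) : EReal)
  else ⊤

/-- The convergence underlying the Γ-limit: `us n → u` in `W^{1,1}(-δ,ℓ)` and
`(us n)'' L ⇀* u''` in `M(-δ,ℓ)`. -/
def BeamTendsto (δ ℓ : ℝ) (us : ℕ → ℝ → ℝ) (u : ℝ → ℝ) : Prop :=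
  TendstoW11 (beam δ ℓ) us u ∧
    WeakStarTendsto (beam δ ℓ)
      (fun n => (volume.restrict (beam δ ℓ)).withDensityᵥ (secondDeriv δ ℓ (us n)))
      (secondDerivMeasure (beam δ ℓ) u)

end CantorBeam

end

/-! All measures are parametrized by the unit interval. `code ℓ n` turns the first n binary digits
of y into ternary digits 0 and 2 and is affine below that scale. It carries Lebesgue measure on
[0,1) to ((3/2)^n/ℓ) 𝓛⌞C_n, whose factor (3/2)^n is the inverse of the factor in the stiffness
(`map_code`). These maps converge uniformly to `codeLim`, whose image of Lebesgue measure is a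
probability on C. That probability and ℋ^s⌞C are both fixed by averaging over the two contractions,
the latter because 3^s = 2. A finite measure on [0,ℓ] with this property is determined by its mass,
and 0 < ℋ^s(C) < ∞; hence ℋ^s⌞C = ℋ^s(C) · `cantorProb` (`cantorMeasure_eq_smul`).

Lower bound. If E_n(u_n) < a, the infinite stiffness forces u_n'' = 0 off C_n, and Cauchy–Schwarz on
C_n gives (∫ψ u_n'')² ≤ (2ℓ/b)(a + P u_n(ℓ)) ∫ ψ(`code ℓ n` y)² dy, the powers of 2/3 and 3/2 having
cancelled (`sq_integral_le_of_energy_bound`). End values converge under W^{1,1} convergence, so this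
passes to the limit along infinitely many n and bounds (∫ψ du'')² by a multiple of ∫ψ² dℋ^s⌞C. By
duality, u'' then has a density in L²(ℋ^s⌞C), and the constant in the bound yields E_∞(u) ≤ a
(`density_of_sq_signedIntegral_le`, `energyInf_le_of_frequently`).

Upper bound. Write u'' as the image under a map G of a measure h m; up to an affine function u is
then the superposition of the ramps (x - G s)⁺ with weights h m. Replacing G by maps G_n converging
uniformly to it gives W^{1,1} and weak* convergence (`exists_recovery`). For finite E_∞(u) take
Lebesgue measure on [0,1), G = `codeLim` and G_n = `code ℓ n`: taking images does not increase the
L² norm of a density, so the elastic energies stay below the limit one. For infinite E_∞(u) only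
convergence is needed, and u'' is mollified by random shifts of its mass. -/

namespace CantorBeam

section

/-! ### Integrals against signed measures -/

section SignedMeasure

variable {X : Type*} [MeasurableSpace X]

instance isFiniteMeasure_variation (μ : SignedMeasure X) :
    IsFiniteMeasure μ.variation := by
  rw [← SignedMeasure.totalVariation_eq_variation, SignedMeasure.totalVariation]
  infer_instance

theorem signedIntegral_withDensity {m : Measure X} {h : X → ℝ} (hh : Integrable h m)
    {ψ : X → ℝ} (hψ : Integrable ψ (m.withDensity fun x => ‖h x‖ₑ)) :
    ∫ᵛ x, ψ x ∂<•(m.withDensityᵥ h) = ∫ x, ψ x * h x ∂m := by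
  have h1 := isFiniteMeasure_withDensity_ofReal hh.2
  have h2 := isFiniteMeasure_withDensity_ofReal hh.neg.2
  have i1 : Integrable ψ (m.withDensity fun x => ENNReal.ofReal (h x)) :=
    hψ.mono_measure (withDensity_mono (Eventually.of_forall fun x => Real.ofReal_le_enorm _))
  have i2 : Integrable ψ (m.withDensity fun x => ENNReal.ofReal (-h x)) :=
    hψ.mono_measure (withDensity_mono (Eventually.of_forall fun x => by
      simpa using Real.ofReal_le_enorm (-h x)))
  have j1 : Integrable (fun x => (ENNReal.ofReal (h x)).toReal • ψ x) m :=
    (integrable_withDensity_iff_integrable_smul₀' hh.1.aemeasurable.ennreal_ofReal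
      (Eventually.of_forall fun _ => ENNReal.ofReal_lt_top)).1 i1
  have j2 : Integrable (fun x => (ENNReal.ofReal (-h x)).toReal • ψ x) m :=
    (integrable_withDensity_iff_integrable_smul₀' hh.1.aemeasurable.neg.ennreal_ofReal
      (Eventually.of_forall fun _ => ENNReal.ofReal_lt_top)).1 i2
  rw [withDensityᵥ_eq_withDensity_pos_part_sub_withDensity_neg_part hh,
    VectorMeasure.integral_sub_vectorMeasure,
    VectorMeasure.integral_toSignedMeasure, VectorMeasure.integral_toSignedMeasure,
    integral_withDensity_eq_integral_toReal_smul₀ hh.1.aemeasurable.ennreal_ofReal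
      (Eventually.of_forall fun _ => ENNReal.ofReal_lt_top),
    integral_withDensity_eq_integral_toReal_smul₀ (f := fun x => ENNReal.ofReal (-h x))
      hh.1.aemeasurable.neg.ennreal_ofReal
      (Eventually.of_forall fun _ => ENNReal.ofReal_lt_top),
    ← integral_sub j1 j2]
  · refine integral_congr_ae (Eventually.of_forall fun x => ?_)
    simp only [smul_eq_mul, ENNReal.toReal_ofReal']
    rcases le_total 0 (h x) with h0 | h0
    · rw [max_eq_left h0, max_eq_right (by linarith)]; ring
    · rw [max_eq_right h0, max_eq_left (by linarith)]; ring
  · simpa [VectorMeasure.Integrable] using i1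
  · simpa [VectorMeasure.Integrable] using i2

theorem signedIntegral_withDensity_of_bound {m : Measure X} {h : X → ℝ} (hh : Integrable h m)
    {ψ : X → ℝ} (hψ : Measurable ψ) {M : ℝ} (hM : ∀ x, |ψ x| ≤ M) :
    ∫ᵛ x, ψ x ∂<•(m.withDensityᵥ h) = ∫ x, ψ x * h x ∂m := by
  have : IsFiniteMeasure (m.withDensity fun x => ‖h x‖ₑ) := isFiniteMeasure_withDensity hh.2.ne
  exact signedIntegral_withDensity hh
    (Integrable.of_bound hψ.aestronglyMeasurable M (Eventually.of_forall hM))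

theorem signedIntegrable_of_bound (μ : SignedMeasure X)
    {ψ : X → ℝ} (hψ : Measurable ψ) {M : ℝ} (hM : ∀ x, |ψ x| ≤ M) : μ.Integrable ψ :=
  Integrable.of_bound hψ.aestronglyMeasurable M (Eventually.of_forall hM)

/-- Polar decomposition. It puts an arbitrary u'' into the form h m from which deflections are
built. -/
theorem exists_eq_variation_withDensity (μ : SignedMeasure X) :
    ∃ h : X → ℝ, Measurable h ∧ Integrable h μ.variation ∧
      μ = μ.variation.withDensityᵥ h :=
  ⟨μ.rnDeriv μ.variation, SignedMeasure.measurable_rnDeriv _ _,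
    SignedMeasure.integrable_rnDeriv _ _,
    (SignedMeasure.withDensityᵥ_rnDeriv_eq μ μ.variation μ.absolutelyContinuous).symm⟩

theorem abs_signedIntegral_le (μ : SignedMeasure X) (ψ : X → ℝ) :
    |∫ᵛ x, ψ x ∂<•μ| ≤ ∫ x, |ψ x| ∂μ.variation := by
  refine (VectorMeasure.norm_integral_le_integral_norm (μ := μ) (f := ψ)
    (B := (ContinuousLinearMap.lsmul ℝ ℝ).flip)).trans ?_
  refine mul_le_of_le_one_left (integral_nonneg fun _ => norm_nonneg _) ?_
  rw [ContinuousLinearMap.opNorm_flip]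
  exact ContinuousLinearMap.opNorm_lsmul_le

theorem variation_compl_eq_zero {μ : SignedMeasure X} {Ω : Set X} (hΩ : MeasurableSet Ω)
    (h : μ.restrict Ω = μ) : μ.variation Ωᶜ = 0 := by
  rw [← h, VectorMeasure.variation_restrict hΩ, Measure.restrict_apply hΩ.compl]
  simp

theorem signedIntegral_map {Y : Type*} [MeasurableSpace Y] {m : Measure X} {h : X → ℝ}
    (hh : Integrable h m) {G : X → Y} (hG : Measurable G) {ψ : Y → ℝ} (hψ : Measurable ψ) {M : ℝ}
    (hM : ∀ x, |ψ x| ≤ M) :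
    ∫ᵛ y, ψ y ∂<•((m.withDensityᵥ h).map G) = ∫ x, ψ (G x) * h x ∂m := by
  rw [VectorMeasure.integral_map hG hψ.aestronglyMeasurable
    (signedIntegrable_of_bound _ (hψ.comp hG) fun x => hM (G x))]
  exact signedIntegral_withDensity_of_bound hh (hψ.comp hG) fun x => hM (G x)

/-- A signed measure that is bounded on bounded functions by their `L²(ν)` norm has a density in
`L²(ν)`. -/
theorem density_of_sq_signedIntegral_le (σ : SignedMeasure X) (ν : Measure X) [IsFiniteMeasure ν]
    {K : ℝ} (hK : ∀ ψ : X → ℝ, Measurable ψ → (∃ M, ∀ x, |ψ x| ≤ M) →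
      (∫ᵛ x, ψ x ∂<•σ) ^ 2 ≤ K * ∫ x, ψ x ^ 2 ∂ν) :
    ν.withDensityᵥ (σ.rnDeriv ν) = σ ∧
      ∫⁻ x, ENNReal.ofReal (σ.rnDeriv ν x ^ 2) ∂ν ≤ ENNReal.ofReal K := by
  have hac : VectorMeasure.AbsolutelyContinuous σ ν.toENNRealVectorMeasure := by
    intro s hs
    by_cases hsm : MeasurableSet s
    swap
    · exact σ.not_measurable hsm
    rw [Measure.toENNRealVectorMeasure_apply_measurable hsm] at hs
    -- Testing with the indicator of a ν-null set gives σ(s)² ≤ 0, which is absolute continuity.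
    have h1 := hK (s.indicator fun _ => 1) (measurable_const.indicator hsm)
      ⟨1, fun x => by by_cases hx : x ∈ s <;> simp [hx]⟩
    have h2 : ∫ x, (s.indicator (fun _ => (1 : ℝ)) x) ^ 2 ∂ν = 0 := by
      refine integral_eq_zero_of_ae ?_
      filter_upwards [measure_eq_zero_iff_ae_notMem.1 hs] with x hx
      simp [hx]
    have h3 : ∫ᵛ x, s.indicator (fun _ => (1 : ℝ)) x ∂<•σ = σ s := by
      rw [VectorMeasure.integral_indicator hsm, VectorMeasure.integral_const]
      simp [VectorMeasure.restrict_apply _ hsm]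
    rw [h2, h3, mul_zero] at h1
    exact pow_eq_zero_iff (two_ne_zero) |>.1 (le_antisymm h1 (sq_nonneg _))
  have hden := SignedMeasure.withDensityᵥ_rnDeriv_eq σ ν hac
  refine ⟨hden, ?_⟩
  set f := σ.rnDeriv ν with hf
  have hfm : Measurable f := SignedMeasure.measurable_rnDeriv _ _
  have hfi : Integrable f ν := SignedMeasure.integrable_rnDeriv _ _
  have key : ∀ n : ℕ, ∫⁻ x, ENNReal.ofReal (({x | |f x| ≤ n}.indicator f x) ^ 2) ∂ν ≤
      ENNReal.ofReal K := by
    intro n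
    have hs : MeasurableSet {x | |f x| ≤ n} := measurableSet_le hfm.abs measurable_const
    -- The truncated density is itself an admissible test function. It gives (∫ψ²)² ≤ K ∫ψ², so ∫ψ²
    -- ≤ K for every n, and Fatou's lemma removes the truncation.
    set ψ := {x | |f x| ≤ n}.indicator f with hψ
    have hψm : Measurable ψ := hfm.indicator hs
    have hψb : ∀ x, |ψ x| ≤ n := by
      intro x
      by_cases hx : |f x| ≤ n
      · simp [hψ, hx]
      · simp [hψ, hx]
    have h1 := hK ψ hψm ⟨n, hψb⟩
    rw [← hden, signedIntegral_withDensity_of_bound hfi hψm hψb] at h1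
    have h2 : ∫ x, ψ x * f x ∂ν = ∫ x, ψ x ^ 2 ∂ν := by
      refine integral_congr_ae (Eventually.of_forall fun x => ?_)
      by_cases hx : |f x| ≤ n
      · simp [hψ, hx, sq]
      · simp [hψ, hx]
    rw [h2] at h1
    have hi : Integrable (fun x => ψ x ^ 2) ν := by
      refine Integrable.of_bound (hψm.pow_const 2).aestronglyMeasurable ((n : ℝ) ^ 2)
        (Eventually.of_forall fun x => ?_)
      rw [Real.norm_eq_abs, abs_pow]
      exact pow_le_pow_left₀ (abs_nonneg _) (hψb x) 2
    rw [← ofReal_integral_eq_lintegral_ofReal hi (Eventually.of_forall fun x => sq_nonneg _)]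
    have h0 : 0 ≤ ∫ x, ψ x ^ 2 ∂ν := integral_nonneg fun x => sq_nonneg _
    rcases h0.eq_or_lt with h0 | h0
    · rw [← h0]; simp
    · exact ENNReal.ofReal_le_ofReal (by nlinarith)
  have hlim : ∀ x, ENNReal.ofReal (f x ^ 2) =
      liminf (fun n : ℕ => ENNReal.ofReal (({x | |f x| ≤ n}.indicator f x) ^ 2)) atTop := by
    intro x
    refine (Tendsto.liminf_eq ?_).symm
    refine tendsto_const_nhds.congr' ?_
    filter_upwards [eventually_ge_atTop ⌈|f x|⌉₊] with n hn
    have : |f x| ≤ n := (Nat.le_ceil _).trans (by exact_mod_cast hn)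
    simp [this]
  calc ∫⁻ x, ENNReal.ofReal (f x ^ 2) ∂ν
      = ∫⁻ x, liminf (fun n : ℕ =>
          ENNReal.ofReal (({x | |f x| ≤ n}.indicator f x) ^ 2)) atTop ∂ν :=
        lintegral_congr hlim
    _ ≤ liminf (fun n : ℕ =>
          ∫⁻ x, ENNReal.ofReal (({x | |f x| ≤ n}.indicator f x) ^ 2) ∂ν) atTop := by
        refine lintegral_liminf_le fun n => ?_
        exact ((hfm.indicator (measurableSet_le hfm.abs measurable_const)).pow_const
          2).ennreal_ofReal
    _ ≤ ENNReal.ofReal K := by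
        refine liminf_le_of_frequently_le' (Frequently.of_forall key)

end SignedMeasure

/-! ### Passing from test functions to bounded measurable functions -/

theorem exists_cutoff {Ω : Set ℝ} (hΩ : IsOpen Ω) (hb : Bornology.IsBounded Ω) :
    ∃ χ : ℕ → ℝ → ℝ, (∀ n, Continuous (χ n)) ∧ (∀ n x, |χ n x| ≤ 1) ∧
      (∀ n, HasCompactSupport (χ n) ∧ tsupport (χ n) ⊆ Ω) ∧
      ∀ x ∈ Ω, Tendsto (fun n => χ n x) atTop (𝓝 1) := by
  -- `Metric.infDist` to the empty set is 0 by convention, which would make the cutoffs below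
  -- vanish.
  have hne : (Ωᶜ).Nonempty := by
    by_contra h
    rw [not_nonempty_iff_eq_empty, compl_empty_iff] at h
    exact NormedSpace.unbounded_univ ℝ ℝ (h ▸ hb)
  -- Subtracting 1 before clipping keeps the support in {n · dist(x, Ωᶜ) ≥ 1}, a closed subset of Ω.
  refine ⟨fun n x => max 0 (min 1 (n * Metric.infDist x Ωᶜ - 1)), fun n => ?_, fun n x => ?_,
    fun n => ?_, fun x hx => ?_⟩
  · exact continuous_const.max (continuous_const.min
      ((continuous_const.mul (Metric.continuous_infDist_pt _)).sub continuous_const))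
  · rw [abs_of_nonneg (le_max_left _ _)]
    exact max_le zero_le_one (min_le_left _ _)
  · have hsub : tsupport (fun x => max 0 (min 1 (n * Metric.infDist x Ωᶜ - 1))) ⊆ Ω := by
      have hcl : IsClosed {x | 1 ≤ n * Metric.infDist x Ωᶜ} :=
        isClosed_le continuous_const (continuous_const.mul (Metric.continuous_infDist_pt _))
      refine (closure_minimal (fun x hx => ?_) hcl).trans fun x hx => ?_
      · by_contra hlt
        simp only [mem_ofPred_eq, not_le] at hlt
        refine hx (max_eq_left ?_)
        exact (min_le_right _ _).trans (by linarith)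
      · by_contra hn
        have : Metric.infDist x Ωᶜ = 0 := Metric.infDist_zero_of_mem hn
        simp only [mem_ofPred_eq, this, mul_zero] at hx
        linarith
    exact ⟨Metric.isCompact_of_isClosed_isBounded (isClosed_tsupport _) (hb.subset hsub), hsub⟩
  · have hpos : 0 < Metric.infDist x Ωᶜ := by
      rw [← hΩ.isClosed_compl.notMem_iff_infDist_pos hne]
      exact fun h => h hx
    refine tendsto_const_nhds.congr' ?_
    obtain ⟨N, hN⟩ := exists_nat_ge (2 / Metric.infDist x Ωᶜ)
    filter_upwards [eventually_ge_atTop N] with n hn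
    have : 2 ≤ (n : ℝ) * Metric.infDist x Ωᶜ := by
      rw [div_le_iff₀ hpos] at hN
      exact hN.trans (mul_le_mul_of_nonneg_right (by exact_mod_cast hn) hpos.le)
    rw [min_eq_left (by linarith), max_eq_right zero_le_one]

/-- Both sides are stable under uniformly bounded approximation. Cutoffs first remove the support
condition, since μ and ν live on Ω; L¹ approximation then removes continuity. -/
theorem sq_signedIntegral_le_of_test {Ω : Set ℝ} (hΩ : IsOpen Ω) (hb : Bornology.IsBounded Ω)
    {μ : SignedMeasure ℝ} (hμ : μ.restrict Ω = μ) {ν : Measure ℝ} [IsFiniteMeasure ν]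
    (hν : ν Ωᶜ = 0) {K : ℝ}
    (hK : ∀ ψ : ℝ → ℝ, Continuous ψ → HasCompactSupport ψ → tsupport ψ ⊆ Ω →
      (∫ᵛ x, ψ x ∂<•μ) ^ 2 ≤ K * ∫ x, ψ x ^ 2 ∂ν)
    {ψ : ℝ → ℝ} (hψ : Measurable ψ) {M : ℝ} (hM : ∀ x, |ψ x| ≤ M) :
    (∫ᵛ x, ψ x ∂<•μ) ^ 2 ≤ K * ∫ x, ψ x ^ 2 ∂ν := by
  have hM0 : 0 ≤ M := (abs_nonneg _).trans (hM 0)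
  have hμ0 : ∀ᵐ x ∂μ.variation, x ∈ Ω := by
    rw [ae_iff]; exact variation_compl_eq_zero hΩ.measurableSet hμ
  have hν0 : ∀ᵐ x ∂ν, x ∈ Ω := by rw [ae_iff]; exact hν
  obtain ⟨χ, hχc, hχ1, hχs, hχt⟩ := exists_cutoff hΩ hb
  have step : ∀ g : ℝ → ℝ, Continuous g → (∀ x, |g x| ≤ M) →
      (∫ᵛ x, g x ∂<•μ) ^ 2 ≤ K * ∫ x, g x ^ 2 ∂ν := by
    intro g hg hgM
    have hbd : ∀ n x, |χ n x * g x| ≤ M := fun n x => by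
      rw [abs_mul]
      exact (mul_le_mul (hχ1 n x) (hgM x) (abs_nonneg _) zero_le_one).trans_eq (one_mul M)
    have hlim : ∀ x ∈ Ω, Tendsto (fun n => χ n x * g x) atTop (𝓝 (g x)) := fun x hx => by
      simpa using (hχt x hx).mul_const (g x)
    have t1 : Tendsto (fun n => ∫ᵛ x, χ n x * g x ∂<•μ) atTop (𝓝 (∫ᵛ x, g x ∂<•μ)) := by
      refine VectorMeasure.tendsto_integral_filter_of_norm_le_const
        (Eventually.of_forall fun n => ((hχc n).mul hg).aestronglyMeasurable)
        ⟨M, Eventually.of_forall fun n => Eventually.of_forall (hbd n)⟩ ?_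
      filter_upwards [hμ0] with x hx using hlim x hx
    have t2 : Tendsto (fun n => ∫ x, (χ n x * g x) ^ 2 ∂ν) atTop (𝓝 (∫ x, g x ^ 2 ∂ν)) := by
      refine tendsto_integral_filter_of_norm_le_const
        (Eventually.of_forall fun n => (((hχc n).mul hg).pow 2).aestronglyMeasurable)
        ⟨M ^ 2, Eventually.of_forall fun n => Eventually.of_forall fun x => ?_⟩ ?_
      · rw [Real.norm_eq_abs, abs_pow]
        exact pow_le_pow_left₀ (abs_nonneg _) (hbd n x) 2
      · filter_upwards [hν0] with x hx using (hlim x hx).pow 2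
    refine le_of_tendsto_of_tendsto' (t1.pow 2) (t2.const_mul K) fun n => ?_
    refine hK _ ((hχc n).mul hg) ((hχs n).1.mul_right) ?_
    exact (tsupport_mul_subset_left).trans (hχs n).2
  -- Approximating in L¹ of the sum controls both sides with a single sequence.
  set ρ := μ.variation + ν with hρ
  have hψi : Integrable ψ ρ := Integrable.of_bound hψ.aestronglyMeasurable M
    (Eventually.of_forall hM)
  have ex : ∀ n : ℕ, ∃ g : ℝ → ℝ, Continuous g ∧ (∀ x, |g x| ≤ M) ∧
      ∫ x, |ψ x - g x| ∂ρ ≤ 1 / (n + 1 : ℝ) := by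
    intro n
    obtain ⟨g, -, hgi, hgc, hgI⟩ :=
      hψi.exists_hasCompactSupport_integral_sub_le (ε := 1 / (n + 1 : ℝ)) (by positivity)
    -- Clipping to [-M, M] is 1-Lipschitz and leaves ψ unchanged, so it bounds g without enlarging
    -- the L¹ error.
    refine ⟨fun x => max (-M) (min M (g x)), continuous_const.max (continuous_const.min hgc),
      fun x => ?_, le_trans ?_ hgi⟩
    · rw [abs_le]
      exact ⟨le_max_left _ _, max_le (by linarith) (min_le_left _ _)⟩
    · refine integral_mono_of_nonneg (Eventually.of_forall fun x => abs_nonneg _)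
        (hψi.sub hgI).norm (Eventually.of_forall fun x => ?_)
      have h1 := abs_le.1 (hM x)
      have e : ψ x = max (-M) (min M (ψ x)) := by
        rw [min_eq_right h1.2, max_eq_right h1.1]
      simp only [Real.norm_eq_abs]
      conv_lhs => rw [e]
      have h2 := abs_max_sub_max_le_max (-M) (min M (ψ x)) (-M) (min M (g x))
      have h3 := abs_min_sub_min_le_max M (ψ x) M (g x)
      rw [sub_self, abs_zero] at h2 h3
      exact h2.trans (max_le (abs_nonneg _) (h3.trans (max_le (abs_nonneg _) le_rfl)))
  choose g hgc hgM hgI using ex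
  have hgi : ∀ n, Integrable (g n) ρ := fun n =>
    Integrable.of_bound (hgc n).aestronglyMeasurable M (Eventually.of_forall (hgM n))
  have hz : Tendsto (fun n : ℕ => ∫ x, |ψ x - g n x| ∂ρ) atTop (𝓝 0) :=
    squeeze_zero (fun n => integral_nonneg fun x => abs_nonneg _) hgI
      tendsto_one_div_add_atTop_nhds_zero_nat
  have t1 : Tendsto (fun n => ∫ᵛ x, g n x ∂<•μ) atTop (𝓝 (∫ᵛ x, ψ x ∂<•μ)) := by
    rw [tendsto_iff_norm_sub_tendsto_zero]
    refine squeeze_zero (fun n => norm_nonneg _) (fun n => ?_) hz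
    rw [← VectorMeasure.integral_fun_sub (signedIntegrable_of_bound μ (hgc n).measurable (hgM n))
      (signedIntegrable_of_bound μ hψ hM)]
    refine (abs_signedIntegral_le μ _).trans ?_
    simp_rw [abs_sub_comm (g n _)]
    exact integral_mono_measure (Measure.le_add_right le_rfl)
      (Eventually.of_forall fun x => abs_nonneg _) (hψi.sub (hgi n)).abs
  have t2 : Tendsto (fun n => ∫ x, g n x ^ 2 ∂ν) atTop (𝓝 (∫ x, ψ x ^ 2 ∂ν)) := by
    rw [tendsto_iff_norm_sub_tendsto_zero]
    have hz2 := hz.const_mul (2 * M)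
    rw [mul_zero] at hz2
    refine squeeze_zero (fun n => norm_nonneg _) (fun n => ?_) hz2
    have hsq : ∀ f : ℝ → ℝ, Measurable f → (∀ x, |f x| ≤ M) → Integrable (fun x => f x ^ 2) ν :=
      fun f hf hfM => Integrable.of_bound (hf.pow_const 2).aestronglyMeasurable (M ^ 2)
        (Eventually.of_forall fun x => by
          rw [Real.norm_eq_abs, abs_pow]
          exact pow_le_pow_left₀ (abs_nonneg _) (hfM x) 2)
    rw [← integral_sub (hsq _ (hgc n).measurable (hgM n)) (hsq _ hψ hM)]
    refine (norm_integral_le_integral_norm _).trans ?_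
    have hle : ∫ x, |ψ x - g n x| ∂ν ≤ ∫ x, |ψ x - g n x| ∂ρ :=
      integral_mono_measure (Measure.le_add_left le_rfl)
        (Eventually.of_forall fun x => abs_nonneg _) (hψi.sub (hgi n)).abs
    refine le_trans ?_ (mul_le_mul_of_nonneg_left hle (by positivity))
    rw [← integral_const_mul]
    refine integral_mono_of_nonneg (Eventually.of_forall fun x => norm_nonneg _)
      ((((hψi.sub (hgi n)).abs).mono_measure (Measure.le_add_left le_rfl)).const_mul _)
      (Eventually.of_forall fun x => ?_)
    simp only [Real.norm_eq_abs]
    rw [show g n x ^ 2 - ψ x ^ 2 = (g n x + ψ x) * (g n x - ψ x) by ring, abs_mul,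
      abs_sub_comm (g n x)]
    refine mul_le_mul_of_nonneg_right ?_ (abs_nonneg _)
    exact (abs_add_le _ _).trans (by linarith [hgM n x, hM x])
  exact le_of_tendsto_of_tendsto' (t1.pow 2) (t2.const_mul K) fun n => step _ (hgc n) (hgM n)

end

section

/-! ### Test functions and weak derivatives -/

theorem IsTestFunction.eq_zero {Ω : Set ℝ} {φ : ℝ → ℝ} (h : IsTestFunction Ω φ) {x : ℝ}
    (hx : x ∉ Ω) : φ x = 0 :=
  image_eq_zero_of_notMem_tsupport fun hx' => hx (h.2.2 hx')

theorem IsTestFunction.continuous {Ω : Set ℝ} {φ : ℝ → ℝ} (h : IsTestFunction Ω φ) :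
    Continuous φ := h.1.continuous

theorem IsTestFunction.deriv {Ω : Set ℝ} {φ : ℝ → ℝ} (h : IsTestFunction Ω φ) :
    IsTestFunction Ω (deriv φ) :=
  ⟨(contDiff_infty_iff_deriv.1 h.1).2, h.2.1.deriv,
    (closure_minimal support_deriv_subset (isClosed_tsupport φ)).trans h.2.2⟩

theorem IsTestFunction.exists_bound {Ω : Set ℝ} {φ : ℝ → ℝ} (h : IsTestFunction Ω φ) :
    ∃ C, ∀ x, |φ x| ≤ C := h.continuous.bounded_above_of_compact_support h.2.1

theorem IsTestFunction.mono {Ω Ω' : Set ℝ} {φ : ℝ → ℝ} (h : IsTestFunction Ω φ) (hΩ : Ω ⊆ Ω') :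
    IsTestFunction Ω' φ := ⟨h.1, h.2.1, h.2.2.trans hΩ⟩

theorem IsTestFunction.integrableOn_mul {Ω : Set ℝ} {φ v : ℝ → ℝ} (h : IsTestFunction Ω φ)
    (hv : LocallyIntegrableOn v Ω) : IntegrableOn (fun x => v x * φ x) Ω := by
  have h1 : IntegrableOn v (tsupport φ) := hv.integrableOn_compact_subset h.2.2 h.2.1
  have h2 : IntegrableOn (fun x => v x * φ x) (tsupport φ) :=
    h1.mul_continuousOn h.continuous.continuousOn h.2.1
  refine (integrableOn_iff_integrable_of_support_subset ?_).1 h2 |>.integrableOn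
  intro x hx
  exact subset_tsupport _ (right_ne_zero_of_mul hx)

theorem IsTestFunction.setIntegral_mul {Ω : Set ℝ} {φ : ℝ → ℝ} (h : IsTestFunction Ω φ)
    (v : ℝ → ℝ) : ∫ x in Ω, v x * φ x = ∫ x, v x * φ x :=
  setIntegral_eq_integral_of_forall_compl_eq_zero fun x hx => by rw [h.eq_zero hx, mul_zero]

theorem locallyIntegrableOn_congr_ae {Ω : Set ℝ} {v w : ℝ → ℝ}
    (hv : LocallyIntegrableOn v Ω) (h : v =ᵐ[volume.restrict Ω] w) : LocallyIntegrableOn w Ω := by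
  intro x hx
  obtain ⟨s, hs, hi⟩ := hv x hx
  refine ⟨s ∩ Ω, inter_mem hs self_mem_nhdsWithin, ?_⟩
  exact (hi.mono_set inter_subset_left).congr_fun_ae
    (ae_restrict_of_ae_restrict_of_subset inter_subset_right h)

theorem HasWeakDeriv.congr {Ω : Set ℝ} {u v u' v' : ℝ → ℝ}
    (h : HasWeakDeriv Ω u v) (hu : u =ᵐ[volume.restrict Ω] u')
    (hv : v =ᵐ[volume.restrict Ω] v') : HasWeakDeriv Ω u' v' := by
  refine ⟨locallyIntegrableOn_congr_ae h.1 hu, locallyIntegrableOn_congr_ae h.2.1 hv,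
    fun φ hφ => ?_⟩
  have e1 : ∫ x in Ω, u x * deriv φ x = ∫ x in Ω, u' x * deriv φ x :=
    integral_congr_ae (hu.mul (EventuallyEq.refl _ (deriv φ)))
  have e2 : ∫ x in Ω, v x * φ x = ∫ x in Ω, v' x * φ x :=
    integral_congr_ae (hv.mul (EventuallyEq.refl _ φ))
  rw [← e1, ← e2, h.2.2 φ hφ]

theorem HasWeakDeriv.mono {Ω Ω' : Set ℝ} {u v : ℝ → ℝ} (h : HasWeakDeriv Ω u v) (hΩ : Ω' ⊆ Ω) :
    HasWeakDeriv Ω' u v := by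
  refine ⟨h.1.mono_set hΩ, h.2.1.mono_set hΩ, fun φ hφ => ?_⟩
  rw [hφ.deriv.setIntegral_mul, hφ.setIntegral_mul, ← (hφ.mono hΩ).deriv.setIntegral_mul,
    ← (hφ.mono hΩ).setIntegral_mul, h.2.2 φ (hφ.mono hΩ)]

theorem HasWeakDeriv.sub {Ω : Set ℝ} {u v u' v' : ℝ → ℝ} (h : HasWeakDeriv Ω u v)
    (h' : HasWeakDeriv Ω u' v') : HasWeakDeriv Ω (u - u') (v - v') := by
  refine ⟨h.1.sub h'.1, h.2.1.sub h'.2.1, fun φ hφ => ?_⟩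
  simp only [Pi.sub_apply, sub_mul]
  rw [integral_sub (hφ.deriv.integrableOn_mul h.1) (hφ.deriv.integrableOn_mul h'.1),
    integral_sub (hφ.integrableOn_mul h.2.1) (hφ.integrableOn_mul h'.2.1), h.2.2 φ hφ,
    h'.2.2 φ hφ]
  ring

theorem ae_eq_of_forall_test {Ω : Set ℝ} (hΩ : IsOpen Ω) {v w : ℝ → ℝ}
    (hv : LocallyIntegrableOn v Ω) (hw : LocallyIntegrableOn w Ω)
    (h : ∀ φ, IsTestFunction Ω φ → ∫ x in Ω, v x * φ x = ∫ x in Ω, w x * φ x) :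
    v =ᵐ[volume.restrict Ω] w := by
  have := hΩ.ae_eq_zero_of_integral_contDiff_smul_eq_zero (μ := volume) (hv.sub hw)
    fun g hg1 hg2 hg3 => by
      have hg : IsTestFunction Ω g := ⟨hg1, hg2, hg3⟩
      have h1 := hg.setIntegral_mul (v - w)
      simp only [smul_eq_mul, mul_comm (g _)]
      rw [← h1]
      simp only [Pi.sub_apply, sub_mul]
      rw [integral_sub (hg.integrableOn_mul hv) (hg.integrableOn_mul hw), h g hg, sub_self]
  rw [EventuallyEq, ae_restrict_iff' hΩ.measurableSet]
  filter_upwards [this] with x hx hxΩ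
  exact sub_eq_zero.1 (hx hxΩ)

theorem HasWeakDeriv.unique {Ω : Set ℝ} (hΩ : IsOpen Ω) {u v w : ℝ → ℝ}
    (hv : HasWeakDeriv Ω u v) (hw : HasWeakDeriv Ω u w) : v =ᵐ[volume.restrict Ω] w :=
  ae_eq_of_forall_test hΩ hv.2.1 hw.2.1 fun φ hφ => by
    rw [← neg_inj, ← hv.2.2 φ hφ, ← hw.2.2 φ hφ]

theorem HasWeakDeriv.weakDeriv {Ω : Set ℝ} {u v : ℝ → ℝ} (h : HasWeakDeriv Ω u v) :
    HasWeakDeriv Ω u (weakDeriv Ω u) := by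
  have h' : ∃ v, HasWeakDeriv Ω u v := ⟨v, h⟩
  unfold CantorBeam.weakDeriv
  rw [dif_pos h']
  exact h'.choose_spec

theorem HasWeakDeriv.weakDeriv_ae_eq {Ω : Set ℝ} (hΩ : IsOpen Ω) {u v : ℝ → ℝ}
    (h : HasWeakDeriv Ω u v) : CantorBeam.weakDeriv Ω u =ᵐ[volume.restrict Ω] v :=
  h.weakDeriv.unique hΩ h

theorem exists_Icc_of_isCompact_subset_Ioo {a b : ℝ} (hab : a < b) {K : Set ℝ} (hK : IsCompact K)
    (hKs : K ⊆ Ioo a b) : ∃ a' b', a < a' ∧ a' ≤ b' ∧ b' < b ∧ K ⊆ Icc a' b' := by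
  rcases K.eq_empty_or_nonempty with rfl | hne
  · exact ⟨(a + b) / 2, (a + b) / 2, by linarith, le_rfl, by linarith, empty_subset _⟩
  · have h1 := hKs (hK.sInf_mem hne)
    have h2 := hKs (hK.sSup_mem hne)
    exact ⟨sInf K, sSup K, h1.1, csInf_le_csSup hne hK.bddBelow hK.bddAbove, h2.2,
      subset_Icc_csInf_csSup hK.bddBelow hK.bddAbove⟩

/-- The primitive started at the left end of an interval containing the support vanishes to the left
of it, and to the right because the total mass is zero. -/
theorem IsTestFunction.exists_primitive {a b : ℝ} (hab : a < b) {k : ℝ → ℝ}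
    (hk : IsTestFunction (Ioo a b) k) (h0 : ∫ x, k x = 0) :
    ∃ φ, IsTestFunction (Ioo a b) φ ∧ _root_.deriv φ = k := by
  obtain ⟨a', b', ha, hab', hb, hK⟩ := exists_Icc_of_isCompact_subset_Ioo hab hk.2.1 hk.2.2
  have hz : ∀ x, x ∉ Icc a' b' → k x = 0 := fun x hx =>
    image_eq_zero_of_notMem_tsupport fun h => hx (hK h)
  have hd : ∀ x, HasDerivAt (fun x => ∫ t in a'..x, k t) (k x) x := fun x =>
    intervalIntegral.integral_hasDerivAt_right (hk.continuous.intervalIntegrable _ _)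
      (hk.continuous.stronglyMeasurableAtFilter _ _) hk.continuous.continuousAt
  have hde : _root_.deriv (fun x => ∫ t in a'..x, k t) = k := funext fun x => (hd x).deriv
  have hsupp : Function.support (fun x => ∫ t in a'..x, k t) ⊆ Icc a' b' := by
    intro x hx
    by_contra hn
    refine hx ?_
    rw [mem_Icc, not_and_or, not_le, not_le] at hn
    rcases hn with hn | hn
    · refine (intervalIntegral.integral_congr_ae (g := fun _ => (0 : ℝ)) ?_).trans (by simp)
      have : ∀ᵐ t : ℝ, t ≠ a' := by simp [ae_iff]
      filter_upwards [this] with t ht hts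
      rw [uIoc_of_ge hn.le] at hts
      exact hz t fun h => ht (le_antisymm hts.2 h.1)
    · simp only
      rw [intervalIntegral.integral_of_le (by linarith), ← h0]
      rw [← integral_Icc_eq_integral_Ioc]
      refine setIntegral_eq_integral_of_forall_compl_eq_zero fun t ht => hz t fun h => ht ?_
      exact ⟨h.1, h.2.trans hn.le⟩
  have hts : tsupport (fun x => ∫ t in a'..x, k t) ⊆ Icc a' b' :=
    closure_minimal hsupp isClosed_Icc
  refine ⟨_, ⟨contDiff_infty_iff_deriv.2 ⟨fun x => (hd x).differentiableAt, hde.symm ▸ hk.1⟩,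
    isCompact_Icc.of_isClosed_subset (isClosed_tsupport _) hts,
    hts.trans (Icc_subset_Ioo ha hb)⟩, hde⟩

theorem exists_isTestFunction_integral_eq_one {a b : ℝ} (hab : a < b) :
    ∃ ρ, IsTestFunction (Ioo a b) ρ ∧ ∫ x, ρ x = 1 := by
  let f : ContDiffBump ((a + b) / 2 : ℝ) := ⟨(b - a) / 8, (b - a) / 4, by linarith, by linarith⟩
  refine ⟨f.normed volume, ⟨f.contDiff_normed, f.hasCompactSupport_normed, ?_⟩, f.integral_normed⟩
  rw [f.tsupport_normed_eq, Real.closedBall_eq_Icc]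
  refine Icc_subset_Ioo ?_ ?_
  · change a < (a + b) / 2 - (b - a) / 4; linarith
  · change (a + b) / 2 + (b - a) / 4 < b; linarith

/-- The lemma of du Bois-Reymond. -/
theorem HasWeakDeriv.exists_ae_eq_const {a b : ℝ} (hab : a < b) {u : ℝ → ℝ}
    (h : HasWeakDeriv (Ioo a b) u 0) : ∃ c : ℝ, u =ᵐ[volume.restrict (Ioo a b)] fun _ => c := by
  obtain ⟨ρ, hρ, hρ1⟩ := exists_isTestFunction_integral_eq_one hab
  refine ⟨∫ x in Ioo a b, u x * ρ x, ae_eq_of_forall_test isOpen_Ioo h.1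
    (locallyIntegrableOn_const _) fun g hg => ?_⟩
  have hgi : Integrable g := hg.continuous.integrable_of_hasCompactSupport hg.2.1
  have hρi : Integrable ρ := hρ.continuous.integrable_of_hasCompactSupport hρ.2.1
  -- Subtracting the mass of g times the unit bump gives zero mass, so this function is the
  -- derivative of a test function and u annihilates it.
  have hk : IsTestFunction (Ioo a b) (fun x => g x - (∫ y, g y) * ρ x) := by
    have hs : tsupport (fun x => g x - (∫ y, g y) * ρ x) ⊆ tsupport g ∪ tsupport ρ := by
      refine closure_minimal (fun x hx => ?_) ((isClosed_tsupport _).union (isClosed_tsupport _))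
      by_contra hn
      rw [mem_union, not_or] at hn
      refine hx ?_
      simp [image_eq_zero_of_notMem_tsupport hn.1, image_eq_zero_of_notMem_tsupport hn.2]
    exact ⟨hg.1.sub (contDiff_const.mul hρ.1),
      (hg.2.1.isCompact.union hρ.2.1.isCompact).of_isClosed_subset (isClosed_tsupport _) hs,
      hs.trans (union_subset hg.2.2 hρ.2.2)⟩
  obtain ⟨φ, hφ, hφd⟩ := hk.exists_primitive hab (by
    rw [integral_sub hgi (hρi.const_mul _), integral_const_mul, hρ1, mul_one, sub_self])
  have h1 := h.2.2 φ hφ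
  simp only [hφd, Pi.zero_apply, zero_mul, integral_zero, neg_zero] at h1
  have e : ∀ x, u x * (g x - (∫ y, g y) * ρ x) = u x * g x - (∫ y, g y) * (u x * ρ x) :=
    fun x => by ring
  simp only [e] at h1
  rw [integral_sub (hg.integrableOn_mul h.1) ((hρ.integrableOn_mul h.1).const_mul _),
    integral_const_mul, sub_eq_zero] at h1
  rw [h1, hg.setIntegral_mul (fun _ => _), integral_const_mul, mul_comm]

theorem HasWeakDeriv.exists_ae_eq_add_const {a b : ℝ} (hab : a < b) {u w v : ℝ → ℝ}
    (hu : HasWeakDeriv (Ioo a b) u v) (hw : HasWeakDeriv (Ioo a b) w v) :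
    ∃ c : ℝ, u =ᵐ[volume.restrict (Ioo a b)] fun x => c + w x := by
  have h := hu.sub hw
  rw [sub_self] at h
  obtain ⟨c, hc⟩ := h.exists_ae_eq_const hab
  refine ⟨c, hc.mono fun x hx => ?_⟩
  simp only [Pi.sub_apply] at hx
  linarith

end

section

/-! ### Functions whose second derivative is the image of a measure with density -/

open Classical in
/-- The Heaviside function jumping at `t`. -/
noncomputable def step (t x : ℝ) : ℝ := if t ≤ x then 1 else 0

/-- The positive part of `x - t`. -/
noncomputable def ramp (t x : ℝ) : ℝ := max (x - t) 0

theorem measurable_step : Measurable (Function.uncurry step) :=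
  Measurable.ite (measurableSet_le measurable_fst measurable_snd) measurable_const measurable_const

theorem measurable_ramp : Measurable (Function.uncurry ramp) :=
  (measurable_snd.sub measurable_fst).max measurable_const

theorem abs_step_le (t x : ℝ) : |step t x| ≤ 1 := by
  unfold step; split_ifs <;> simp

theorem abs_ramp_le {R t x : ℝ} (ht : |t| ≤ R) (hx : |x| ≤ R) : |ramp t x| ≤ 2 * R := by
  have h1 := abs_le.1 ht
  have h2 := abs_le.1 hx
  unfold ramp
  rw [abs_of_nonneg (le_max_right _ _)]
  exact max_le (by linarith) (by linarith)

theorem abs_ramp_sub_ramp_le (t t' x : ℝ) : |ramp t x - ramp t' x| ≤ |t - t'| := by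
  unfold ramp
  refine (abs_max_sub_max_le_abs _ _ _).trans_eq ?_
  rw [show x - t - (x - t') = -(t - t') by ring, abs_neg]

theorem integral_step_mul (t : ℝ) (f : ℝ → ℝ) : ∫ x, step t x * f x = ∫ x in Ioi t, f x := by
  rw [← integral_Ici_eq_integral_Ioi, ← integral_indicator measurableSet_Ici]
  refine integral_congr_ae (Eventually.of_forall fun x => ?_)
  by_cases h : t ≤ x <;> simp [step, h]

theorem integral_step_mul_deriv {φ : ℝ → ℝ} (hφ : ContDiff ℝ 1 φ) (hc : HasCompactSupport φ)
    (t : ℝ) : ∫ x, step t x * deriv φ x = -φ t := by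
  rw [integral_step_mul, hc.integral_Ioi_deriv_eq hφ]

/-- The derivative of (x - t)φ integrates to zero over (t, ∞), because this function vanishes at t
and has compact support. -/
theorem integral_ramp_mul_deriv {φ : ℝ → ℝ} (hφ : ContDiff ℝ 1 φ) (hc : HasCompactSupport φ)
    (t : ℝ) : ∫ x, ramp t x * deriv φ x = -∫ x, step t x * φ x := by
  have hd : ∀ x, deriv (fun x => (x - t) * φ x) x = φ x + (x - t) * deriv φ x := fun x => by
    have h1 : HasDerivAt (fun x => x - t) 1 x := (hasDerivAt_id x).sub_const t
    have h2 : HasDerivAt (fun x => (x - t) * φ x) _ x :=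
      h1.mul (hφ.differentiable one_ne_zero x).hasDerivAt
    rw [h2.deriv, one_mul]
  have hc' : HasCompactSupport fun x => (x - t) * φ x := hc.mul_left
  have h0 : ∫ x in Ioi t, (φ x + (x - t) * deriv φ x) = 0 := by
    have h1 := hc'.integral_Ioi_deriv_eq ((contDiff_id.sub contDiff_const).mul hφ) t
    simp only [id] at h1
    rw [funext hd] at h1
    simpa using h1
  have i1 : Integrable φ := hφ.continuous.integrable_of_hasCompactSupport hc
  have i2 : Integrable fun x => (x - t) * deriv φ x :=
    ((continuous_id.sub continuous_const).mul
      (hφ.continuous_deriv le_rfl)).integrable_of_hasCompactSupport hc.deriv.mul_left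
  rw [integral_add i1.integrableOn i2.integrableOn] at h0
  have e : ∫ x, ramp t x * deriv φ x = ∫ x in Ioi t, (x - t) * deriv φ x := by
    rw [← integral_indicator measurableSet_Ioi]
    refine integral_congr_ae (Eventually.of_forall fun x => ?_)
    by_cases h : t < x
    · simp [ramp, h, max_eq_left (sub_nonneg.2 h.le)]
    · simp [ramp, h, max_eq_right (sub_nonpos.2 (not_lt.1 h))]
  rw [e, integral_step_mul]
  linarith

/-- The two steps differ exactly on the interval between the jumps. Steps are thus Lipschitz in the
jump point in L¹, though not uniformly. -/
theorem integral_abs_step_sub_step (t t' : ℝ) (Ω : Set ℝ) :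
    ∫⁻ x in Ω, ‖step t x - step t' x‖ₑ ≤ ENNReal.ofReal |t - t'| := by
  wlog h : t ≤ t' generalizing t t'
  · have := this t' t (not_le.1 h).le
    simpa [enorm_sub_rev, abs_sub_comm] using this
  calc ∫⁻ x in Ω, ‖step t x - step t' x‖ₑ ≤ ∫⁻ x, ‖step t x - step t' x‖ₑ :=
        setLIntegral_le_lintegral _ _
    _ ≤ ∫⁻ x, (Ico t t').indicator 1 x := by
        refine lintegral_mono fun x => ?_
        unfold step
        by_cases h1 : t ≤ x <;> by_cases h2 : t' ≤ x
        · simp [h1, h2]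
        · simp [h1, h2, not_le.1 h2]
        · exact absurd (h.trans h2) h1
        · simp [h1, h2]
    _ = ENNReal.ofReal |t - t'| := by
        rw [lintegral_indicator_one measurableSet_Ico, Real.volume_Ico, abs_sub_comm,
          abs_of_nonneg (sub_nonneg.2 h)]

section Potential

variable {S : Type*} [MeasurableSpace S] {m : Measure S} {h : S → ℝ}
  {G : S → ℝ}

theorem integrable_kernel_mul (hh : Integrable h m) (hG : Measurable G) {F : ℝ → ℝ → ℝ}
    (hF : Measurable (Function.uncurry F)) {C x : ℝ} (hC : ∀ᵐ s ∂m, |F (G s) x| ≤ C) :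
    Integrable (fun s => F (G s) x * h s) m :=
  hh.bdd_mul (hF.comp (hG.prodMk measurable_const)).aestronglyMeasurable hC

/-- The function with slope `c` near `-∞` whose derivative is the image under `G` of the measure
`h m`. -/
noncomputable def slope (m : Measure S) (h G : S → ℝ) (c x : ℝ) : ℝ :=
  c + ∫ s, step (G s) x * h s ∂m

/-- The function `c₀ + c₁ x` plus the second primitive of the image under `G` of the measure
`h m`. -/
noncomputable def deflection (m : Measure S) (h G : S → ℝ) (c₀ c₁ x : ℝ) : ℝ :=
  c₀ + c₁ * x + ∫ s, ramp (G s) x * h s ∂m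

theorem abs_slope_le (hh : Integrable h m) (c x : ℝ) :
    |slope m h G c x| ≤ |c| + ∫ s, |h s| ∂m := by
  refine (abs_add_le _ _).trans (add_le_add le_rfl ?_)
  refine (abs_integral_le_integral_abs).trans ?_
  refine integral_mono_of_nonneg (Eventually.of_forall fun _ => abs_nonneg _) hh.abs
    (Eventually.of_forall fun s => ?_)
  simp only [abs_mul]
  exact mul_le_of_le_one_left (abs_nonneg _) (abs_step_le _ _)

theorem ae_abs_ramp_le {R : ℝ} {Ω : Set ℝ} (hGR : ∀ᵐ s ∂m, |G s| ≤ R) (hΩR : ∀ x ∈ Ω, |x| ≤ R) :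
    ∀ᵐ s ∂m, ∀ x ∈ Ω, |ramp (G s) x| ≤ 2 * R :=
  hGR.mono fun _ hs x hx => abs_ramp_le hs (hΩR x hx)

theorem abs_deflection_le {R : ℝ} (hh : Integrable h m) (hGR : ∀ᵐ s ∂m, |G s| ≤ R) (c₀ c₁ : ℝ)
    {x : ℝ} (hx : |x| ≤ R) :
    |deflection m h G c₀ c₁ x| ≤ |c₀| + |c₁| * R + 2 * R * ∫ s, |h s| ∂m := by
  refine (abs_add_le _ _).trans (add_le_add ((abs_add_le _ _).trans (add_le_add le_rfl ?_)) ?_)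
  · rw [abs_mul]
    exact mul_le_mul_of_nonneg_left hx (abs_nonneg _)
  · refine (abs_integral_le_integral_abs).trans ?_
    rw [← integral_const_mul]
    refine integral_mono_of_nonneg (Eventually.of_forall fun _ => abs_nonneg _)
      (hh.abs.const_mul _) (hGR.mono fun s hs => ?_)
    simp only [abs_mul]
    exact mul_le_mul_of_nonneg_right (abs_ramp_le hs hx) (abs_nonneg _)

/-- A ramp is 1-Lipschitz in its base point, so the deflections differ by at most ε ∫|h| at every
point of Ω. -/
theorem eLpNorm_deflection_sub_le {R ε : ℝ} (hh : Integrable h m) (hG : Measurable G) {G' : S → ℝ}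
    (hG' : Measurable G')
    (hGR : ∀ᵐ s ∂m, |G s| ≤ R) (hGR' : ∀ᵐ s ∂m, |G' s| ≤ R) (hε : ∀ᵐ s ∂m, |G' s - G s| ≤ ε)
    {Ω : Set ℝ} (hΩ : MeasurableSet Ω) (hΩR : ∀ x ∈ Ω, |x| ≤ R) (c₀ c₁ : ℝ) :
    eLpNorm (deflection m h G' c₀ c₁ - deflection m h G c₀ c₁) 1 (volume.restrict Ω) ≤
      ENNReal.ofReal (ε * ∫ s, |h s| ∂m) * volume Ω := by
  rw [eLpNorm_one_eq_lintegral_enorm]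
  refine (setLIntegral_mono' (g := fun _ => ENNReal.ofReal (ε * ∫ s, |h s| ∂m)) hΩ
    fun x hx => ?_).trans_eq (by simp)
  rw [Real.enorm_eq_ofReal_abs]
  refine ENNReal.ofReal_le_ofReal ?_
  have i1 := integrable_kernel_mul (x := x) hh hG measurable_ramp
    (hGR.mono fun s hs => abs_ramp_le hs (hΩR x hx))
  have i2 := integrable_kernel_mul (x := x) hh hG' measurable_ramp
    (hGR'.mono fun s hs => abs_ramp_le hs (hΩR x hx))
  have e : (deflection m h G' c₀ c₁ - deflection m h G c₀ c₁) x =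
      ∫ s, (ramp (G' s) x * h s - ramp (G s) x * h s) ∂m := by
    rw [integral_sub i2 i1]
    simp only [Pi.sub_apply, deflection]
    ring
  rw [e, ← integral_const_mul]
  refine (abs_integral_le_integral_abs).trans (integral_mono_of_nonneg
    (Eventually.of_forall fun _ => abs_nonneg _) (hh.abs.const_mul _) (hε.mono fun s hs => ?_))
  simp only
  rw [← sub_mul, abs_mul]
  exact mul_le_mul_of_nonneg_right ((abs_ramp_sub_ramp_le _ _ _).trans hs) (abs_nonneg _)

variable [IsFiniteMeasure m]

theorem integrable_prod_kernel (hh : Integrable h m) (hG : Measurable G) {F : ℝ → ℝ → ℝ}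
    (hF : Measurable (Function.uncurry F)) {Ω : Set ℝ} (hΩ : MeasurableSet Ω)
    (hΩb : Bornology.IsBounded Ω) {C : ℝ}
    (hC : ∀ᵐ s ∂m, ∀ x ∈ Ω, |F (G s) x| ≤ C) :
    Integrable (fun p : ℝ × S => F (G p.2) p.1 * h p.2) ((volume.restrict Ω).prod m) := by
  have : IsFiniteMeasure (volume.restrict Ω) := ⟨by simpa using hΩb.measure_lt_top⟩
  refine (hh.comp_snd (volume.restrict Ω)).bdd_mul (c := C)
    (hF.comp ((hG.comp measurable_snd).prodMk measurable_fst)).aestronglyMeasurable ?_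
  have h1 : ∀ᵐ p ∂((volume.restrict Ω).prod m), ∀ x ∈ Ω, |F (G p.2) x| ≤ C :=
    Measure.quasiMeasurePreserving_snd.ae hC
  have h2 : ∀ᵐ p ∂((volume.restrict Ω).prod m), p.1 ∈ Ω :=
    Measure.quasiMeasurePreserving_fst.ae (ae_restrict_mem hΩ)
  filter_upwards [h1, h2] with p hp1 hp2 using hp1 _ hp2

/-- Fubini's theorem for steps and ramps at once. It reduces integration by parts against a
superposition to a single step or ramp. The bound is asked for almost every s only, since G is
confined to a bounded set only almost everywhere. -/
theorem integral_kernel_mul_swap (hh : Integrable h m) (hG : Measurable G) {F : ℝ → ℝ → ℝ}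
    (hF : Measurable (Function.uncurry F)) {Ω : Set ℝ} (hΩ : MeasurableSet Ω)
    (hΩb : Bornology.IsBounded Ω) {C : ℝ}
    (hC : ∀ᵐ s ∂m, ∀ x ∈ Ω, |F (G s) x| ≤ C) {ψ : ℝ → ℝ} (hψ : Measurable ψ) {M : ℝ}
    (hM : ∀ x, |ψ x| ≤ M) :
    ∫ x in Ω, (∫ s, F (G s) x * h s ∂m) * ψ x = ∫ s, (∫ x in Ω, F (G s) x * ψ x) * h s ∂m := by
  have hi : Integrable (fun p : ℝ × S => F (G p.2) p.1 * h p.2 * ψ p.1)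
      ((volume.restrict Ω).prod m) :=
    (integrable_prod_kernel hh hG hF hΩ hΩb hC).mul_bdd (c := M)
      (hψ.comp measurable_fst).aestronglyMeasurable (Eventually.of_forall fun p => hM p.1)
  simp_rw [← integral_mul_const]
  rw [integral_integral_swap (f := fun x s => F (G s) x * h s * ψ x) hi]
  refine integral_congr_ae (Eventually.of_forall fun s => ?_)
  simp only
  refine integral_congr_ae (Eventually.of_forall fun x => ?_)
  simp only
  ring

theorem integrableOn_slope (hh : Integrable h m) (hG : Measurable G) {Ω : Set ℝ}
    (hΩ : MeasurableSet Ω) (hΩb : Bornology.IsBounded Ω) (c : ℝ) :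
    IntegrableOn (slope m h G c) Ω := by
  have : IsFiniteMeasure (volume.restrict Ω) := ⟨by simpa using hΩb.measure_lt_top⟩
  exact (integrable_const c).add (integrable_prod_kernel hh hG measurable_step hΩ hΩb
    (Eventually.of_forall fun s x _ => abs_step_le _ _)).integral_prod_left

theorem integrableOn_deflection {R : ℝ} (hh : Integrable h m) (hG : Measurable G)
    (hGR : ∀ᵐ s ∂m, |G s| ≤ R) {Ω : Set ℝ}
    (hΩ : MeasurableSet Ω) (hΩR : ∀ x ∈ Ω, |x| ≤ R) (c₀ c₁ : ℝ) :
    IntegrableOn (deflection m h G c₀ c₁) Ω := by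
  have hΩb : Bornology.IsBounded Ω := isBounded_iff_forall_norm_le.2 ⟨R, hΩR⟩
  have : IsFiniteMeasure (volume.restrict Ω) := ⟨by simpa using hΩb.measure_lt_top⟩
  refine ((integrable_const c₀).add (Integrable.const_mul (f := fun x => x) ?_ c₁)).add
    (integrable_prod_kernel hh hG measurable_ramp hΩ hΩb (ae_abs_ramp_le hGR hΩR)).integral_prod_left
  exact Integrable.of_bound measurable_id.aestronglyMeasurable R (ae_restrict_of_forall_mem hΩ hΩR)

/-- The distributional derivative of `slope` is the image of h m under G: after Fubini each step
pairs with φ' to -φ(G s), and the constant c contributes nothing. -/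
theorem setIntegral_slope_mul_deriv (hh : Integrable h m) (hG : Measurable G) {Ω : Set ℝ}
    (hΩ : MeasurableSet Ω) (hΩb : Bornology.IsBounded Ω) (c : ℝ) {φ : ℝ → ℝ}
    (hφ : IsTestFunction Ω φ) :
    ∫ x in Ω, slope m h G c x * deriv φ x = -∫ s, φ (G s) * h s ∂m := by
  have : IsFiniteMeasure (volume.restrict Ω) := ⟨by simpa using hΩb.measure_lt_top⟩
  obtain ⟨C, hC⟩ := hφ.deriv.exists_bound
  have hI := (integrable_prod_kernel hh hG measurable_step hΩ hΩb
    (Eventually.of_forall fun s x _ => abs_step_le _ _)).integral_prod_left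
  have hφ1 : ContDiff ℝ 1 φ := hφ.1.of_le (by exact_mod_cast le_top)
  unfold slope
  simp only [add_mul]
  rw [integral_add (hφ.deriv.integrableOn_mul (locallyIntegrableOn_const c))
    (hI.mul_bdd (c := C) hφ.deriv.continuous.aestronglyMeasurable (Eventually.of_forall hC)),
    integral_kernel_mul_swap hh hG measurable_step hΩ hΩb
      (Eventually.of_forall fun s x _ => abs_step_le _ _) hφ.deriv.continuous.measurable hC,
    hφ.deriv.setIntegral_mul (fun _ => c), integral_const_mul,
    integral_eq_zero_of_hasDerivAt_of_integrable
      (f := φ) (fun x => (hφ1.differentiable one_ne_zero x).hasDerivAt)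
      (hφ.deriv.continuous.integrable_of_hasCompactSupport hφ.deriv.2.1)
      (hφ.continuous.integrable_of_hasCompactSupport hφ.2.1), mul_zero, zero_add, ← integral_neg]
  refine integral_congr_ae (Eventually.of_forall fun s => ?_)
  simp only
  rw [hφ.deriv.setIntegral_mul, integral_step_mul_deriv hφ1 hφ.2.1, neg_mul]

theorem hasWeakDeriv_deflection {R : ℝ} (hh : Integrable h m) (hG : Measurable G)
    (hGR : ∀ᵐ s ∂m, |G s| ≤ R) {Ω : Set ℝ}
    (hΩ : MeasurableSet Ω) (hΩR : ∀ x ∈ Ω, |x| ≤ R) (c₀ c₁ : ℝ) :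
    HasWeakDeriv Ω (deflection m h G c₀ c₁) (slope m h G c₁) := by
  have hΩb : Bornology.IsBounded Ω := isBounded_iff_forall_norm_le.2 ⟨R, hΩR⟩
  have : IsFiniteMeasure (volume.restrict Ω) := ⟨by simpa using hΩb.measure_lt_top⟩
  refine ⟨(integrableOn_deflection hh hG hGR hΩ hΩR c₀ c₁).locallyIntegrableOn,
    (integrableOn_slope hh hG hΩ hΩb c₁).locallyIntegrableOn, fun φ hφ => ?_⟩
  obtain ⟨C, hC⟩ := hφ.deriv.exists_bound
  obtain ⟨C', hC'⟩ := hφ.exists_bound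
  have hI := (integrable_prod_kernel hh hG measurable_ramp hΩ hΩb
    (ae_abs_ramp_le hGR hΩR)).integral_prod_left
  have hI' := (integrable_prod_kernel hh hG measurable_step hΩ hΩb
    (Eventually.of_forall fun s x _ => abs_step_le _ _)).integral_prod_left
  have hφ1 : ContDiff ℝ 1 φ := hφ.1.of_le (by exact_mod_cast le_top)
  have hlin : ∫ x, (c₀ + c₁ * x) * deriv φ x = -∫ x, c₁ * φ x := by
    have hd : ∀ x, HasDerivAt (fun x => (c₀ + c₁ * x) * φ x)
        (c₁ * φ x + (c₀ + c₁ * x) * deriv φ x) x := fun x => by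
      have h1 : HasDerivAt (fun x => c₀ + c₁ * x) c₁ x := by
        simpa using ((hasDerivAt_id x).const_mul c₁).const_add c₀
      exact h1.mul (hφ1.differentiable one_ne_zero x).hasDerivAt
    have hc : Continuous fun x : ℝ => c₀ + c₁ * x := by fun_prop
    have i1 : Integrable fun x => c₁ * φ x :=
      (hφ.continuous.integrable_of_hasCompactSupport hφ.2.1).const_mul c₁
    have i2 : Integrable fun x => (c₀ + c₁ * x) * deriv φ x :=
      (hc.mul hφ.deriv.continuous).integrable_of_hasCompactSupport hφ.deriv.2.1.mul_left
    have := integral_eq_zero_of_hasDerivAt_of_integrable hd (i1.add i2)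
      ((hc.mul hφ.continuous).integrable_of_hasCompactSupport hφ.2.1.mul_left)
    rw [integral_add i1 i2] at this
    linarith
  unfold slope deflection
  simp only [add_mul _ _ (deriv φ _), add_mul _ _ (φ _)]
  simp only [← add_mul c₀ (c₁ * _)]
  rw [integral_add (hφ.deriv.integrableOn_mul ((Continuous.locallyIntegrable
      (by fun_prop : Continuous fun x : ℝ => c₀ + c₁ * x)).locallyIntegrableOn _))
    (hI.mul_bdd (c := C) hφ.deriv.continuous.aestronglyMeasurable (Eventually.of_forall hC)),
    integral_add (hφ.integrableOn_mul (locallyIntegrableOn_const c₁))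
    (hI'.mul_bdd (c := C') hφ.continuous.aestronglyMeasurable (Eventually.of_forall hC')),
    integral_kernel_mul_swap hh hG measurable_ramp hΩ hΩb
      (ae_abs_ramp_le hGR hΩR) hφ.deriv.continuous.measurable hC,
    integral_kernel_mul_swap hh hG measurable_step hΩ hΩb
      (Eventually.of_forall fun s x _ => abs_step_le _ _) hφ.continuous.measurable hC',
    hφ.deriv.setIntegral_mul, hφ.setIntegral_mul, hlin, neg_add, ← integral_neg, ← integral_neg]
  congr 1
  refine integral_congr_ae (Eventually.of_forall fun s => ?_)
  simp only
  rw [hφ.deriv.setIntegral_mul, hφ.setIntegral_mul, integral_ramp_mul_deriv hφ1 hφ.2.1, neg_mul]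

/-- A function whose second derivative is the image under `G` of the measure `h m` is a
`deflection`. -/
theorem exists_ae_eq_deflection {R a b : ℝ} (hab : a < b) (hh : Integrable h m)
    (hG : Measurable G) (hGR : ∀ᵐ s ∂m, |G s| ≤ R) (hΩR : ∀ x ∈ Ioo a b, |x| ≤ R) {u v : ℝ → ℝ}
    (hu : HasWeakDeriv (Ioo a b) u v) {μ : SignedMeasure ℝ}
    (hv : HasWeakDerivMeasure (Ioo a b) v μ)
    (hμ : ∀ φ, IsTestFunction (Ioo a b) φ → ∫ᵛ x, φ x ∂<•μ = ∫ s, φ (G s) * h s ∂m) :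
    ∃ c₀ c₁, v =ᵐ[volume.restrict (Ioo a b)] slope m h G c₁ ∧
      u =ᵐ[volume.restrict (Ioo a b)] deflection m h G c₀ c₁ := by
  have hΩb : Bornology.IsBounded (Ioo a b) := Metric.isBounded_Ioo a b
  have hs := integrableOn_slope hh hG measurableSet_Ioo hΩb 0
  -- Both functions have derivative μ, so du Bois-Reymond leaves only a constant; the same argument
  -- one order lower produces c₀.
  have h0 : HasWeakDeriv (Ioo a b) (v - slope m h G 0) 0 := by
    refine ⟨hv.1.sub hs.locallyIntegrableOn, locallyIntegrableOn_zero, fun φ hφ => ?_⟩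
    simp only [Pi.sub_apply, sub_mul]
    rw [integral_sub (hφ.deriv.integrableOn_mul hv.1)
      (hφ.deriv.integrableOn_mul hs.locallyIntegrableOn), hv.2.2 φ hφ,
      setIntegral_slope_mul_deriv hh hG measurableSet_Ioo hΩb 0 hφ, hμ φ hφ]
    simp
  obtain ⟨c₁, hc₁⟩ := h0.exists_ae_eq_const hab
  have hvs : v =ᵐ[volume.restrict (Ioo a b)] slope m h G c₁ := hc₁.mono fun x hx => by
    simp only [Pi.sub_apply, slope, zero_add] at hx ⊢
    linarith
  have hd := hasWeakDeriv_deflection hh hG hGR measurableSet_Ioo hΩR 0 c₁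
  obtain ⟨c₀, hc₀⟩ := (hu.congr (EventuallyEq.refl _ _) hvs).exists_ae_eq_add_const hab hd
  refine ⟨c₀, c₁, hvs, hc₀.mono fun x hx => ?_⟩
  rw [hx]
  unfold deflection
  ring

/-- By Tonelli the L¹ distance of the slopes is at most the |h|-weighted integral of the L¹
distances of the steps, each at most ε. -/
theorem eLpNorm_slope_sub_le {ε : ℝ} (hh : Integrable h m) (hG : Measurable G) {G' : S → ℝ}
    (hG' : Measurable G') (hε : ∀ᵐ s ∂m, |G' s - G s| ≤ ε) (Ω : Set ℝ) (c : ℝ) :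
    eLpNorm (slope m h G' c - slope m h G c) 1 (volume.restrict Ω) ≤
      ENNReal.ofReal ε * ∫⁻ s, ‖h s‖ₑ ∂m := by
  have hst : ∀ {G : S → ℝ}, Measurable G → ∀ x, Integrable (fun s => step (G s) x * h s) m :=
    fun hG x => integrable_kernel_mul hh hG measurable_step
      (Eventually.of_forall fun s => abs_step_le _ _)
  rw [eLpNorm_one_eq_lintegral_enorm]
  calc ∫⁻ x in Ω, ‖(slope m h G' c - slope m h G c) x‖ₑ
      ≤ ∫⁻ x in Ω, (∫⁻ s, ‖step (G' s) x - step (G s) x‖ₑ * ‖h s‖ₑ ∂m) := by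
        refine lintegral_mono fun x => ?_
        have e : (slope m h G' c - slope m h G c) x =
            ∫ s, (step (G' s) x * h s - step (G s) x * h s) ∂m := by
          rw [integral_sub (hst hG' x) (hst hG x)]
          simp only [Pi.sub_apply, slope]
          ring
        rw [e]
        refine (enorm_integral_le_lintegral_enorm _).trans_eq (lintegral_congr fun s => ?_)
        rw [← sub_mul, enorm_mul]
    _ = ∫⁻ s, (∫⁻ x in Ω, ‖step (G' s) x - step (G s) x‖ₑ * ‖h s‖ₑ) ∂m := by
        refine lintegral_lintegral_swap ?_
        have hm : ∀ {G : S → ℝ}, Measurable G →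
            Measurable fun p : ℝ × S => step (G p.2) p.1 := fun hG =>
          measurable_step.comp ((hG.comp measurable_snd).prodMk measurable_fst)
        exact ((hm hG').sub (hm hG)).enorm.aemeasurable.mul hh.1.enorm.comp_snd
    _ ≤ ∫⁻ s, ENNReal.ofReal ε * ‖h s‖ₑ ∂m := by
        refine lintegral_mono_ae (hε.mono fun s hs => ?_)
        rw [lintegral_mul_const]
        · exact mul_le_mul_left ((integral_abs_step_sub_step _ _ _).trans
            (ENNReal.ofReal_le_ofReal hs)) _
        · exact ((measurable_step.comp measurable_prodMk_left).sub
            (measurable_step.comp measurable_prodMk_left)).enorm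
    _ = ENNReal.ofReal ε * ∫⁻ s, ‖h s‖ₑ ∂m := lintegral_const_mul'' _ hh.1.enorm

end Potential

end

section

/-! ### Sobolev functions and their end values -/

theorem MemSobolev.memW11 {Ω : Set ℝ} (hΩ : IsOpen Ω) {u : ℝ → ℝ} (h : MemSobolev 1 1 Ω u) :
    IntegrableOn u Ω ∧ HasWeakDeriv Ω u (weakDeriv Ω u) ∧ IntegrableOn (weakDeriv Ω u) Ω := by
  obtain ⟨h1, v, hv, hvi⟩ := h
  refine ⟨memLp_one_iff_integrable.1 h1, hv.weakDeriv, ?_⟩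
  exact (memLp_one_iff_integrable.1 hvi).congr (hv.weakDeriv_ae_eq hΩ).symm

theorem MemSobolev.secondDeriv_spec {Ω : Set ℝ} (hΩ : IsOpen Ω) {u : ℝ → ℝ}
    (h : MemSobolev 2 2 Ω u) :
    HasWeakDeriv Ω u (weakDeriv Ω u) ∧
      HasWeakDeriv Ω (weakDeriv Ω u) (weakDeriv Ω (weakDeriv Ω u)) ∧
      MemLp (weakDeriv Ω u) 2 (volume.restrict Ω) ∧
      MemLp (weakDeriv Ω (weakDeriv Ω u)) 2 (volume.restrict Ω) := by
  obtain ⟨-, v, hv, hv2, w, hw, hw2⟩ := h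
  have e := hv.weakDeriv_ae_eq hΩ
  have hw' := hw.congr e.symm (EventuallyEq.refl _ _)
  exact ⟨hv.weakDeriv, hw'.weakDeriv, (memLp_congr_ae e).2 hv2,
    (memLp_congr_ae (hw'.weakDeriv_ae_eq hΩ)).2 hw2⟩

theorem MemSobolev.one_one {Ω : Set ℝ} (hΩb : Bornology.IsBounded Ω) {u : ℝ → ℝ}
    (h : MemSobolev 2 2 Ω u) : MemSobolev 1 1 Ω u := by
  have : IsFiniteMeasure (volume.restrict Ω) := ⟨by simpa using hΩb.measure_lt_top⟩
  obtain ⟨h0, v, hv, hv2, -⟩ := h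
  exact ⟨h0.mono_exponent one_le_two, v, hv, hv2.mono_exponent one_le_two⟩

theorem memSobolev_two_of_hasWeakDeriv {Ω : Set ℝ} {u v w : ℝ → ℝ}
    (hu : MemLp u 2 (volume.restrict Ω)) (hv : MemLp v 2 (volume.restrict Ω))
    (hw : MemLp w 2 (volume.restrict Ω)) (huv : HasWeakDeriv Ω u v) (hvw : HasWeakDeriv Ω v w) :
    MemSobolev 2 2 Ω u := ⟨hu, v, huv, hv, w, hvw, hw⟩

theorem weakDeriv_weakDeriv_ae_eq {Ω : Set ℝ} (hΩ : IsOpen Ω) {u v w : ℝ → ℝ}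
    (huv : HasWeakDeriv Ω u v) (hvw : HasWeakDeriv Ω v w) :
    weakDeriv Ω (weakDeriv Ω u) =ᵐ[volume.restrict Ω] w :=
  (hvw.congr (huv.weakDeriv_ae_eq hΩ).symm (EventuallyEq.refl _ _)).weakDeriv_ae_eq hΩ

variable {δ ℓ : ℝ}

/-- Functions continuous on the closed interval and equal almost everywhere in its interior agree up
to the end points, so the chosen representative does not matter. -/
theorem endValue_eq (hδ : 0 < δ) (hℓ : 0 < ℓ) {u w : ℝ → ℝ} (hw : ContinuousOn w (Icc (-δ) ℓ))
    (h : w =ᵐ[volume.restrict (beam δ ℓ)] u) : endValue δ ℓ u = w ℓ := by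
  have hex : ∃ w : ℝ → ℝ, ContinuousOn w (Icc (-δ) ℓ) ∧ w =ᵐ[volume.restrict (beam δ ℓ)] u :=
    ⟨w, hw, h⟩
  unfold endValue
  rw [dif_pos hex]
  have h1 : hex.choose =ᵐ[volume.restrict (Icc (-δ) ℓ)] w := by
    rw [← restrict_Ioo_eq_restrict_Icc]
    exact hex.choose_spec.2.trans h.symm
  exact Measure.eqOn_Icc_of_ae_eq volume (by linarith) h1 hex.choose_spec.1 hw
    (right_mem_Icc.2 (by linarith))

/-- Dominated convergence: at x₀ only the step jumping at x₀ is discontinuous, and a single jump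
point is Lebesgue null. This supplies the continuous representative of a W^{1,1} function. -/
theorem continuous_slope_volume {Ω : Set ℝ} {v : ℝ → ℝ} (hv : IntegrableOn v Ω) (c : ℝ) :
    Continuous (slope (volume.restrict Ω) v id c) := by
  refine continuous_const.add (continuous_iff_continuousAt.2 fun x₀ => ?_)
  refine continuousAt_of_dominated (bound := fun s => |v s|)
    (Eventually.of_forall fun x => ?_) (Eventually.of_forall fun x =>
      Eventually.of_forall fun s => ?_) hv.abs ?_
  · exact ((measurable_step.comp
      (measurable_id.prodMk measurable_const)).aestronglyMeasurable).mul hv.1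
  · rw [Real.norm_eq_abs, abs_mul]
    exact mul_le_of_le_one_left (abs_nonneg _) (abs_step_le _ _)
  · have : ∀ᵐ s ∂(volume.restrict Ω), s ≠ x₀ := by simp [ae_iff]
    filter_upwards [this] with s hs
    refine ContinuousAt.mul ?_ continuousAt_const
    rcases lt_or_gt_of_ne hs with hs | hs
    · refine (continuousAt_const (y := (1 : ℝ))).congr ?_
      filter_upwards [lt_mem_nhds hs] with x hx
      simp [step, le_of_lt (show s < x from hx)]
    · refine (continuousAt_const (y := (0 : ℝ))).congr ?_
      filter_upwards [gt_mem_nhds hs] with x hx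
      simp [step, not_le.2 (show x < s from hx)]

theorem HasWeakDeriv.exists_ae_eq_slope {a b : ℝ} (hab : a < b) {u v : ℝ → ℝ}
    (h : HasWeakDeriv (Ioo a b) u v) (hv : IntegrableOn v (Ioo a b)) :
    ∃ c, u =ᵐ[volume.restrict (Ioo a b)] slope (volume.restrict (Ioo a b)) v id c := by
  have hΩb : Bornology.IsBounded (Ioo a b) := Metric.isBounded_Ioo a b
  have : IsFiniteMeasure (volume.restrict (Ioo a b)) := ⟨by simp⟩
  have hw : HasWeakDeriv (Ioo a b) (slope (volume.restrict (Ioo a b)) v id 0) v := by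
    refine ⟨(integrableOn_slope hv measurable_id measurableSet_Ioo hΩb 0).locallyIntegrableOn,
      hv.locallyIntegrableOn, fun φ hφ => ?_⟩
    rw [setIntegral_slope_mul_deriv hv measurable_id measurableSet_Ioo hΩb 0 hφ]
    simp only [id, mul_comm]
  obtain ⟨c, hc⟩ := h.exists_ae_eq_add_const hab hw
  refine ⟨c, hc.mono fun x hx => ?_⟩
  rw [hx]
  simp [slope]

theorem abs_slope_sub_slope_sub_le {Ω : Set ℝ} {v₁ v₂ : ℝ → ℝ} (h₁ : IntegrableOn v₁ Ω)
    (h₂ : IntegrableOn v₂ Ω) (c₁ c₂ : ℝ) {x y : ℝ} (hxy : x ≤ y) :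
    |(slope (volume.restrict Ω) v₁ id c₁ y - slope (volume.restrict Ω) v₂ id c₂ y) -
      (slope (volume.restrict Ω) v₁ id c₁ x - slope (volume.restrict Ω) v₂ id c₂ x)| ≤
      ∫ t in Ω, |v₁ t - v₂ t| := by
  have hst : ∀ {v : ℝ → ℝ}, IntegrableOn v Ω → ∀ x,
      Integrable (fun s => step (id s) x * v s) (volume.restrict Ω) := fun hv x =>
    integrable_kernel_mul hv measurable_id measurable_step
      (Eventually.of_forall fun s => abs_step_le _ _)
  have e : (slope (volume.restrict Ω) v₁ id c₁ y - slope (volume.restrict Ω) v₂ id c₂ y) -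
      (slope (volume.restrict Ω) v₁ id c₁ x - slope (volume.restrict Ω) v₂ id c₂ x) =
      ∫ s in Ω, ((step (id s) y * v₁ s - step (id s) y * v₂ s) -
        (step (id s) x * v₁ s - step (id s) x * v₂ s)) := by
    have i₁ := (hst h₁ y).sub (hst h₂ y)
    have i₂ := (hst h₁ x).sub (hst h₂ x)
    have := integral_sub i₁ i₂
    simp only [Pi.sub_apply] at this
    rw [this, integral_sub (hst h₁ y) (hst h₂ y), integral_sub (hst h₁ x) (hst h₂ x)]
    simp only [slope]
    ring
  rw [e]
  refine (abs_integral_le_integral_abs).trans (integral_mono_of_nonneg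
    (Eventually.of_forall fun _ => abs_nonneg _) (h₁.sub h₂).abs (Eventually.of_forall fun s => ?_))
  simp only
  rw [← mul_sub, ← mul_sub, ← sub_mul, abs_mul]
  refine mul_le_of_le_one_left (abs_nonneg _) ?_
  unfold step
  split_ifs with ha hb hb
  · simp
  · simp
  · exact absurd (hb.trans hxy) ha
  · simp

/-- Trace estimate: the difference at ℓ is bounded by the difference at any x plus the total
variation of the difference; integrate in x over the beam. -/
theorem abs_endValue_sub_le (hδ : 0 < δ) (hℓ : 0 < ℓ) {u₁ v₁ u₂ v₂ : ℝ → ℝ}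
    (h₁ : HasWeakDeriv (beam δ ℓ) u₁ v₁) (hv₁ : IntegrableOn v₁ (beam δ ℓ))
    (h₂ : HasWeakDeriv (beam δ ℓ) u₂ v₂) (hv₂ : IntegrableOn v₂ (beam δ ℓ)) :
    (ℓ + δ) * |endValue δ ℓ u₁ - endValue δ ℓ u₂| ≤
      (∫ x in beam δ ℓ, |u₁ x - u₂ x|) + (ℓ + δ) * ∫ x in beam δ ℓ, |v₁ x - v₂ x| := by
  have hab : -δ < ℓ := by linarith
  obtain ⟨c₁, hc₁⟩ := h₁.exists_ae_eq_slope hab hv₁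
  obtain ⟨c₂, hc₂⟩ := h₂.exists_ae_eq_slope hab hv₂
  have k₁ := continuous_slope_volume hv₁ c₁
  have k₂ := continuous_slope_volume hv₂ c₂
  rw [endValue_eq hδ hℓ k₁.continuousOn hc₁.symm, endValue_eq hδ hℓ k₂.continuousOn hc₂.symm]
  set N := ∫ x in beam δ ℓ, |v₁ x - v₂ x|
  set w₁ := slope (volume.restrict (beam δ ℓ)) v₁ id c₁
  set w₂ := slope (volume.restrict (beam δ ℓ)) v₂ id c₂
  have hvol : volume.real (beam δ ℓ) = ℓ + δ := by
    rw [beam, Real.volume_real_Ioo_of_le hab.le]; ring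
  have hfin : IsFiniteMeasure (volume.restrict (beam δ ℓ)) := ⟨by simp [beam]⟩
  have e : ∫ x in beam δ ℓ, |u₁ x - u₂ x| = ∫ x in beam δ ℓ, |w₁ x - w₂ x| := by
    refine integral_congr_ae ?_
    filter_upwards [hc₁, hc₂] with x hx₁ hx₂
    rw [hx₁, hx₂]
    rfl
  have hi : IntegrableOn (fun x => |w₁ x - w₂ x|) (beam δ ℓ) :=
    ((k₁.sub k₂).abs.continuousOn.integrableOn_Icc (μ := volume) (a := -δ)
      (b := ℓ)).mono_set Ioo_subset_Icc_self
  have h0 : ∫ _ in beam δ ℓ, |w₁ ℓ - w₂ ℓ| ≤ ∫ x in beam δ ℓ, (|w₁ x - w₂ x| + N) := by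
    refine setIntegral_mono_on (integrable_const _) (hi.add (integrable_const _))
      measurableSet_Ioo fun x hx => ?_
    have := abs_slope_sub_slope_sub_le hv₁ hv₂ c₁ c₂ hx.2.le
    have h3 := abs_sub_abs_le_abs_sub (w₁ ℓ - w₂ ℓ) (w₁ x - w₂ x)
    linarith
  rw [integral_add hi (integrable_const _), setIntegral_const, setIntegral_const, hvol,
    smul_eq_mul, smul_eq_mul] at h0
  rw [e]
  exact h0

theorem tendsto_endValue (hδ : 0 < δ) (hℓ : 0 < ℓ) {us : ℕ → ℝ → ℝ} {u : ℝ → ℝ}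
    (hus : ∀ n, MemSobolev 1 1 (beam δ ℓ) (us n)) (hu : MemSobolev 1 1 (beam δ ℓ) u)
    (h : TendstoW11 (beam δ ℓ) us u) :
    Tendsto (fun n => endValue δ ℓ (us n)) atTop (𝓝 (endValue δ ℓ u)) := by
  have hu' := hu.memW11 isOpen_Ioo
  have hus' := fun n => (hus n).memW11 isOpen_Ioo
  have hz := (ENNReal.tendsto_toReal ENNReal.zero_ne_top).comp h
  rw [ENNReal.toReal_zero] at hz
  -- The trace estimate has coefficients 1/(ℓ + δ) and 1 on the two norms; their sum dominates both.
  have hz' := hz.mul_const (1 / (ℓ + δ) + 1)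
  rw [zero_mul] at hz'
  rw [tendsto_iff_norm_sub_tendsto_zero]
  refine squeeze_zero (fun _ => norm_nonneg _) (fun n => ?_) hz'
  have i1 : Integrable (us n - u) (volume.restrict (beam δ ℓ)) := (hus' n).1.sub hu'.1
  have i2 : Integrable (weakDeriv (beam δ ℓ) (us n) - weakDeriv (beam δ ℓ) u)
    (volume.restrict (beam δ ℓ)) := (hus' n).2.2.sub hu'.2.2
  have hb := abs_endValue_sub_le hδ hℓ (hus' n).2.1 (hus' n).2.2 hu'.2.1 hu'.2.2
  have e : ∀ {f : ℝ → ℝ}, Integrable f (volume.restrict (beam δ ℓ)) →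
      (eLpNorm f 1 (volume.restrict (beam δ ℓ))).toReal = ∫ x in beam δ ℓ, |f x| := fun hf => by
    rw [eLpNorm_one_eq_lintegral_enorm, ← integral_norm_eq_lintegral_enorm hf.1]
    rfl
  simp only [Function.comp]
  rw [ENNReal.toReal_add (memLp_one_iff_integrable.2 i1).2.ne (memLp_one_iff_integrable.2 i2).2.ne,
    e i1, e i2]
  have hA : 0 ≤ ∫ x in beam δ ℓ, |(us n - u) x| := integral_nonneg fun _ => abs_nonneg _
  have hB : 0 ≤ ∫ x in beam δ ℓ, |(weakDeriv (beam δ ℓ) (us n) - weakDeriv (beam δ ℓ) u) x| :=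
    integral_nonneg fun _ => abs_nonneg _
  simp only [Pi.sub_apply] at hA hB ⊢
  set A := ∫ x in beam δ ℓ, |us n x - u x|
  set B := ∫ x in beam δ ℓ, |weakDeriv (beam δ ℓ) (us n) x - weakDeriv (beam δ ℓ) u x|
  have hpos : 0 < ℓ + δ := by linarith
  have h1 : |endValue δ ℓ (us n) - endValue δ ℓ u| ≤ (A + (ℓ + δ) * B) / (ℓ + δ) := by
    rw [le_div_iff₀ hpos, mul_comm]
    exact hb
  refine h1.trans ?_
  have h2 : (A + (ℓ + δ) * B) / (ℓ + δ) = A * (1 / (ℓ + δ)) + B := by field_simp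
  rw [h2]
  have h3 : 0 ≤ B * (1 / (ℓ + δ)) := by positivity
  nlinarith

theorem ClampedAtWall.weakDeriv_eq_zero (hℓ : 0 < ℓ) {u v : ℝ → ℝ} (h : ClampedAtWall δ u)
    (hv : HasWeakDeriv (beam δ ℓ) u v) : v =ᵐ[volume.restrict (Ioo (-δ) 0)] 0 := by
  have h1 : HasWeakDeriv (Ioo (-δ) 0) u v := hv.mono (Ioo_subset_Ioo_right hℓ.le)
  have h2 : u =ᵐ[volume.restrict (Ioo (-δ) 0)] 0 :=
    ae_restrict_of_ae_restrict_of_subset Ioo_subset_Ioc_self h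
  have h3 : HasWeakDeriv (Ioo (-δ) 0) u 0 :=
    ⟨h1.1, locallyIntegrableOn_zero, fun φ hφ => by
      have e := integral_congr_ae (h2.mul (EventuallyEq.refl _ (deriv φ)))
      simpa using e⟩
  exact h1.unique isOpen_Ioo h3

theorem ClampedAtWall.secondDeriv_eq_zero (hℓ : 0 < ℓ) {u v w : ℝ → ℝ} (h : ClampedAtWall δ u)
    (hv : HasWeakDeriv (beam δ ℓ) u v) (hw : HasWeakDeriv (beam δ ℓ) v w) :
    w =ᵐ[volume.restrict (Ioo (-δ) 0)] 0 := by
  refine ClampedAtWall.weakDeriv_eq_zero hℓ (u := v) ?_ hw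
  have := h.weakDeriv_eq_zero hℓ hv
  rw [restrict_Ioo_eq_restrict_Ioc] at this
  exact this

/-- The L¹ norm of u on the wall is at most the distance to any clamped us n. Infinitely many such n
suffice, which is all that a bound on the liminf provides. -/
theorem ClampedAtWall.of_tendsto {us : ℕ → ℝ → ℝ} {u : ℝ → ℝ} (hℓ : 0 < ℓ)
    (hu : AEStronglyMeasurable u (volume.restrict (beam δ ℓ)))
    (h : TendstoW11 (beam δ ℓ) us u) (hf : ∃ᶠ n in atTop, ClampedAtWall δ (us n)) :
    ClampedAtWall δ u := by
  have hsub : Ioc (-δ) 0 ⊆ beam δ ℓ := fun x hx => ⟨hx.1, hx.2.trans_lt hℓ⟩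
  have h0 : eLpNorm u 1 (volume.restrict (Ioc (-δ) 0)) ≤ 0 := by
    refine ge_of_tendsto_of_frequently h (hf.mono fun n hn => ?_)
    have e : eLpNorm u 1 (volume.restrict (Ioc (-δ) 0)) =
        eLpNorm (us n - u) 1 (volume.restrict (Ioc (-δ) 0)) := by
      rw [← eLpNorm_neg]
      refine eLpNorm_congr_ae ?_
      filter_upwards [hn] with x hx
      simp [hx]
    rw [e]
    exact (eLpNorm_mono_measure _ (Measure.restrict_mono hsub le_rfl)).trans le_self_add
  exact (eLpNorm_eq_zero_iff (hu.mono_measure (Measure.restrict_mono hsub le_rfl)) one_ne_zero).1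
    (le_antisymm h0 bot_le)

end

section

/-! ### The Cantor measure -/

variable {ℓ : ℝ}

theorem isCompact_cantorStep (ℓ : ℝ) (n : ℕ) : IsCompact (cantorStep ℓ n) := by
  induction n with
  | zero => exact isCompact_Icc
  | succ n ih => exact (ih.image (by fun_prop)).union (ih.image (by fun_prop))

theorem cantorStep_subset_Icc (hℓ : 0 < ℓ) (n : ℕ) : cantorStep ℓ n ⊆ Icc 0 ℓ := by
  induction n with
  | zero => exact subset_rfl
  | succ n ih =>
    rintro x (⟨y, hy, rfl⟩ | ⟨y, hy, rfl⟩)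
    · have := ih hy
      exact ⟨by linarith [this.1], by linarith [this.2]⟩
    · have := ih hy
      exact ⟨by linarith [this.1], by linarith [this.2]⟩

theorem cantorStep_succ_subset (hℓ : 0 < ℓ) (n : ℕ) : cantorStep ℓ (n + 1) ⊆ cantorStep ℓ n := by
  induction n with
  | zero => exact cantorStep_subset_Icc hℓ 1
  | succ n ih => exact union_subset_union (image_mono ih) (image_mono ih)

theorem antitone_cantorStep (hℓ : 0 < ℓ) : Antitone (cantorStep ℓ) :=
  antitone_nat_of_succ_le (cantorStep_succ_subset hℓ)

theorem isClosed_cantor (ℓ : ℝ) : IsClosed (cantor ℓ) :=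
  isClosed_iInter fun n => (isCompact_cantorStep ℓ n).isClosed

theorem cantor_subset_Icc (ℓ : ℝ) : cantor ℓ ⊆ Icc 0 ℓ := iInter_subset (cantorStep ℓ) 0

theorem disjoint_thirds (hℓ : 0 < ℓ) {A B : Set ℝ} (hA : A ⊆ Icc 0 ℓ) (hB : B ⊆ Icc 0 ℓ) :
    Disjoint ((fun x => x / 3) '' A) ((fun x => (x + 2 * ℓ) / 3) '' B) := by
  rw [disjoint_left]
  rintro x ⟨y, hy, rfl⟩ ⟨z, hz, h⟩
  have h1 := (hA hy).2
  have h2 := (hB hz).1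
  simp only at h
  linarith

theorem cantor_eq_union (hℓ : 0 < ℓ) :
    cantor ℓ = (fun x => x / 3) '' cantor ℓ ∪ (fun x => (x + 2 * ℓ) / 3) '' cantor ℓ := by
  ext x
  constructor
  · intro hx
    have hx' : ∀ n, x ∈ cantorStep ℓ n := mem_iInter.1 hx
    -- The midpoint lies in the removed middle third, so it separates the two halves of C.
    by_cases h : x ≤ ℓ / 2
    · refine Or.inl ⟨3 * x, mem_iInter.2 fun n => ?_, by ring⟩
      rcases hx' (n + 1) with ⟨y, hy, hyx⟩ | ⟨y, hy, hyx⟩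
      · rwa [← hyx, mul_div_cancel₀ _ three_ne_zero]
      · have := (cantorStep_subset_Icc hℓ n hy).1
        simp only at hyx
        linarith
    · refine Or.inr ⟨3 * x - 2 * ℓ, mem_iInter.2 fun n => ?_, by ring⟩
      rcases hx' (n + 1) with ⟨y, hy, hyx⟩ | ⟨y, hy, hyx⟩
      · have := (cantorStep_subset_Icc hℓ n hy).2
        simp only at hyx
        linarith
      · rw [← hyx, mul_div_cancel₀ _ three_ne_zero, add_sub_cancel_right]
        exact hy
  · intro hx
    refine mem_iInter.2 fun n => cantorStep_succ_subset hℓ n ?_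
    rcases hx with ⟨y, hy, rfl⟩ | ⟨y, hy, rfl⟩
    · exact Or.inl ⟨y, mem_iInter.1 hy n, rfl⟩
    · exact Or.inr ⟨y, mem_iInter.1 hy n, rfl⟩

/-- The average of the images of a measure under the two similarities generating the Cantor
set. -/
noncomputable def cantorAverage (ℓ : ℝ) (ν : Measure ℝ) : Measure ℝ :=
  (2⁻¹ : ℝ≥0∞) • (ν.map (fun x => x / 3) + ν.map (fun x => (x + 2 * ℓ) / 3))

theorem measurable_third_left : Measurable fun x : ℝ => x / 3 := by fun_prop

theorem measurable_third_right (ℓ : ℝ) : Measurable fun x : ℝ => (x + 2 * ℓ) / 3 := by fun_prop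

theorem cantorAverage_smul (c : ℝ≥0∞) (ν : Measure ℝ) :
    cantorAverage ℓ (c • ν) = c • cantorAverage ℓ ν := by
  simp only [cantorAverage, Measure.map_smul, smul_add, smul_comm c]

theorem integral_cantorAverage {ν : Measure ℝ} [IsFiniteMeasure ν] {f : ℝ → ℝ}
    (hf : Continuous f) {M : ℝ} (hM : ∀ x, |f x| ≤ M) :
    ∫ x, f x ∂(cantorAverage ℓ ν) = ∫ x, (f (x / 3) + f ((x + 2 * ℓ) / 3)) / 2 ∂ν := by
  have i : ∀ {g : ℝ → ℝ}, Measurable g → Integrable (fun x => f (g x)) ν := fun hg =>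
    Integrable.of_bound (hf.measurable.comp hg).aestronglyMeasurable M
      (Eventually.of_forall fun x => hM _)
  have j : ∀ {g : ℝ → ℝ}, Measurable g → Integrable f (ν.map g) := fun hg =>
    (integrable_map_measure hf.aestronglyMeasurable hg.aemeasurable).2 (i hg)
  rw [cantorAverage, integral_smul_measure,
    integral_add_measure (j measurable_third_left) (j (measurable_third_right ℓ)),
    integral_map measurable_third_left.aemeasurable hf.aestronglyMeasurable,
    integral_map (measurable_third_right ℓ).aemeasurable hf.aestronglyMeasurable,
    ← integral_add (i measurable_third_left) (i (measurable_third_right ℓ)), ← integral_smul]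
  refine integral_congr_ae (Eventually.of_forall fun x => ?_)
  simp only [ENNReal.toReal_inv, ENNReal.toReal_ofNat, smul_eq_mul]
  ring

/-- By invariance, f may be replaced by its average over the two contractions. This keeps the
oscillation bound ε while tripling the scale d at which it holds. Once d ≥ ℓ, f is within ε of f 0
on [0,ℓ], and the equal masses leave an error ε · mass from each measure. -/
theorem abs_integral_sub_integral_le_of_cantorAverage (hℓ : 0 < ℓ) {μ ν : Measure ℝ}
    [IsFiniteMeasure μ] [IsFiniteMeasure ν] (hμ : cantorAverage ℓ μ = μ)
    (hν : cantorAverage ℓ ν = ν)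
    (hμs : ∀ᵐ x ∂μ, x ∈ Icc 0 ℓ) (hνs : ∀ᵐ x ∂ν, x ∈ Icc 0 ℓ) (hm : μ univ = ν univ) {ε : ℝ} :
    ∀ (n : ℕ) (d : ℝ), ℓ ≤ 3 ^ n * d → ∀ f : ℝ → ℝ, Continuous f → (∃ M, ∀ x, |f x| ≤ M) →
      (∀ x ∈ Icc 0 ℓ, ∀ y ∈ Icc 0 ℓ, |x - y| ≤ d → |f x - f y| ≤ ε) →
      |∫ x, f x ∂μ - ∫ x, f x ∂ν| ≤ 2 * ε * μ.real univ := by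
  intro n
  induction n with
  | zero =>
    rintro d hd f hf ⟨M, hM⟩ h
    rw [pow_zero, one_mul] at hd
    have key : ∀ (ρ : Measure ℝ) [IsFiniteMeasure ρ], (∀ᵐ x ∂ρ, x ∈ Icc 0 ℓ) →
        |∫ x, f x ∂ρ - f 0 * ρ.real univ| ≤ ε * ρ.real univ := by
      intro ρ _ hρ
      have i : Integrable f ρ := Integrable.of_bound hf.aestronglyMeasurable M
        (Eventually.of_forall hM)
      have e : ∫ x, f x ∂ρ - f 0 * ρ.real univ = ∫ x, (f x - f 0) ∂ρ := by
        rw [integral_sub i (integrable_const _), integral_const, smul_eq_mul, mul_comm (f 0)]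
      rw [e, ← Real.norm_eq_abs]
      refine norm_integral_le_of_norm_le_const (hρ.mono fun x hx => ?_)
      refine h x hx 0 ⟨le_rfl, hℓ.le⟩ ?_
      rw [sub_zero, abs_of_nonneg hx.1]
      exact hx.2.trans hd
    have h1 := abs_le.1 (key μ hμs)
    have h2 := abs_le.1 (key ν hνs)
    have e : ν.real univ = μ.real univ := by rw [measureReal_def, measureReal_def, hm]
    rw [e] at h2
    rw [abs_le]
    constructor <;> linarith [h1.1, h1.2, h2.1, h2.2]
  | succ n ih =>
    rintro d hd f hf ⟨M, hM⟩ h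
    have hM0 : ∀ x y, |(f x + f y) / 2| ≤ M := fun x y => by
      have h1 := abs_le.1 (hM x)
      have h2 := abs_le.1 (hM y)
      rw [abs_le]
      constructor <;> linarith [h1.1, h1.2, h2.1, h2.2]
    have e1 : ∫ x, f x ∂μ = ∫ x, (f (x / 3) + f ((x + 2 * ℓ) / 3)) / 2 ∂μ := by
      conv_lhs => rw [← hμ]
      exact integral_cantorAverage hf hM
    have e2 : ∫ x, f x ∂ν = ∫ x, (f (x / 3) + f ((x + 2 * ℓ) / 3)) / 2 ∂ν := by
      conv_lhs => rw [← hν]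
      exact integral_cantorAverage hf hM
    rw [e1, e2]
    refine ih (3 * d) (hd.trans_eq (by ring)) _ (by fun_prop) ⟨M, fun x => hM0 _ _⟩ ?_
    intro x hx y hy hxy
    have hxy' := abs_le.1 hxy
    have a1 := abs_le.1 (h (x / 3) ⟨by linarith [hx.1], by linarith [hx.2]⟩ (y / 3)
      ⟨by linarith [hy.1], by linarith [hy.2]⟩
      (abs_le.2 ⟨by linarith [hxy'.1], by linarith [hxy'.2]⟩))
    have a2 := abs_le.1 (h ((x + 2 * ℓ) / 3) ⟨by linarith [hx.1], by linarith [hx.2]⟩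
      ((y + 2 * ℓ) / 3) ⟨by linarith [hy.1], by linarith [hy.2]⟩
      (abs_le.2 ⟨by linarith [hxy'.1], by linarith [hxy'.2]⟩))
    rw [abs_le]
    constructor <;> linarith [a1.1, a1.2, a2.1, a2.2]

/-- Uniqueness of the self-similar measure of given mass: uniform continuity makes the oscillation
small at some scale d, and finitely many contractions reach that scale. -/
theorem eq_of_cantorAverage_eq (hℓ : 0 < ℓ) {μ ν : Measure ℝ}
    [IsFiniteMeasure μ] [IsFiniteMeasure ν] (hμ : cantorAverage ℓ μ = μ)
    (hν : cantorAverage ℓ ν = ν)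
    (hμs : ∀ᵐ x ∂μ, x ∈ Icc 0 ℓ) (hνs : ∀ᵐ x ∂ν, x ∈ Icc 0 ℓ) (hm : μ univ = ν univ) : μ = ν := by
  refine ext_of_forall_integral_eq_of_IsFiniteMeasure fun f => ?_
  rw [← sub_eq_zero, ← abs_eq_zero]
  refine le_antisymm (le_of_forall_pos_le_add fun ε hε => ?_) (abs_nonneg _)
  have hpos : 0 < 2 * (μ.real univ + 1) := by
    have : 0 ≤ μ.real univ := measureReal_nonneg
    positivity
  have huc := Metric.uniformContinuousOn_iff_le.1
    (isCompact_Icc.uniformContinuousOn_of_continuous (s := Icc 0 ℓ) f.continuous.continuousOn)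
    (ε / (2 * (μ.real univ + 1))) (by positivity)
  obtain ⟨d, hd, hfd⟩ := huc
  obtain ⟨n, hn⟩ := pow_unbounded_of_one_lt (ℓ / d) (by norm_num : (1 : ℝ) < 3)
  rw [div_lt_iff₀ hd] at hn
  have := abs_integral_sub_integral_le_of_cantorAverage hℓ hμ hν hμs hνs hm n d hn.le f
    f.continuous ⟨‖f‖, fun x => f.norm_coe_le_norm x⟩ hfd
  refine this.trans ?_
  rw [zero_add, mul_assoc, div_mul_eq_mul_div, ← mul_div_assoc, div_le_iff₀ hpos]
  have : 0 ≤ μ.real univ := measureReal_nonneg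
  nlinarith

/-! ### Coding of the Cantor steps by the unit interval -/

theorem map_affine_restrict {a : ℝ} (ha : a ≠ 0) (c : ℝ) {B : Set ℝ} :
    (volume.restrict B).map (fun x => a * x + c) =
      ENNReal.ofReal |a⁻¹| • volume.restrict ((fun x => a * x + c) '' B) := by
  have he : MeasurableEmbedding fun x : ℝ => a * x + c :=
    (measurableEmbedding_addRight c).comp (measurableEmbedding_mulLeft₀ ha)
  have hv : (volume : Measure ℝ).map (fun x => a * x + c) = ENNReal.ofReal |a⁻¹| • volume := by
    have : (fun x : ℝ => a * x + c) = (fun x => x + c) ∘ fun x => a * x := rfl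
    rw [this, ← Measure.map_map (by fun_prop) (by fun_prop), Real.map_volume_mul_left ha,
      Measure.map_smul, map_add_right_eq_self]
  rw [← Measure.restrict_smul, ← hv, he.restrict_map, preimage_image_eq _ he.injective]

/-- Each contraction triples the Lebesgue density and averaging halves it, on disjoint images; hence
the factor 3/2 gained at every step. -/
theorem cantorAverage_restrict_volume (hℓ : 0 < ℓ) {A : Set ℝ} (hA : IsCompact A)
    (hAs : A ⊆ Icc 0 ℓ) :
    cantorAverage ℓ (volume.restrict A) = ENNReal.ofReal (3 / 2) •
      volume.restrict ((fun x => x / 3) '' A ∪ (fun x => (x + 2 * ℓ) / 3) '' A) := by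
  have e1 := map_affine_restrict (show (1 / 3 : ℝ) ≠ 0 by norm_num) 0 (B := A)
  have e2 := map_affine_restrict (show (1 / 3 : ℝ) ≠ 0 by norm_num) (2 * ℓ / 3) (B := A)
  have f1 : (fun x : ℝ => 1 / 3 * x + 0) = fun x => x / 3 := by ext x; ring
  have f2 : (fun x : ℝ => 1 / 3 * x + 2 * ℓ / 3) = fun x => (x + 2 * ℓ) / 3 := by ext x; ring
  rw [f1] at e1
  rw [f2] at e2
  rw [cantorAverage, e1, e2, Measure.restrict_union (disjoint_thirds hℓ hAs hAs)
    (hA.image (by fun_prop)).measurableSet, ← smul_add, smul_smul]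
  congr 1
  rw [show (2⁻¹ : ℝ≥0∞) = ENNReal.ofReal 2⁻¹ by
    rw [ENNReal.ofReal_inv_of_pos two_pos, ENNReal.ofReal_ofNat],
    ← ENNReal.ofReal_mul (by norm_num)]
  norm_num

/-- Lebesgue measure on the unit interval. -/
noncomputable abbrev unitMeasure : Measure ℝ := volume.restrict (Ico 0 1)

theorem unitMeasure_eq_average : unitMeasure =
    (2⁻¹ : ℝ≥0∞) • (unitMeasure.map (fun y => y / 2) + unitMeasure.map (fun y => (y + 1) / 2)) := by
  have e1 := map_affine_restrict (show (1 / 2 : ℝ) ≠ 0 by norm_num) 0 (B := Ico (0 : ℝ) 1)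
  have e2 := map_affine_restrict (show (1 / 2 : ℝ) ≠ 0 by norm_num) (1 / 2) (B := Ico (0 : ℝ) 1)
  have f1 : (fun x : ℝ => 1 / 2 * x + 0) = fun x => x / 2 := by ext x; ring
  have f2 : (fun x : ℝ => 1 / 2 * x + 1 / 2) = fun x => (x + 1) / 2 := by ext x; ring
  have g1 : (fun x : ℝ => 1 / 2 * x + 0) '' Ico 0 1 = Ico 0 (1 / 2) := by
    rw [image_affine_Ico (by norm_num)]; norm_num
  have g2 : (fun x : ℝ => 1 / 2 * x + 1 / 2) '' Ico 0 1 = Ico (1 / 2) 1 := by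
    rw [image_affine_Ico (by norm_num)]; norm_num
  rw [g1, f1] at e1
  rw [g2, f2] at e2
  rw [unitMeasure, e1, e2, ← smul_add, ← Measure.restrict_union (by
    rw [disjoint_left]; exact fun x h1 h2 => absurd h1.2 (not_lt.2 h2.1)) measurableSet_Ico,
    Ico_union_Ico_eq_Ico (by norm_num) (by norm_num), smul_smul]
  have : (2⁻¹ : ℝ≥0∞) * ENNReal.ofReal |(1 / 2 : ℝ)⁻¹| = 1 := by
    norm_num
    exact ENNReal.inv_mul_cancel two_ne_zero ENNReal.ofNat_ne_top
  rw [this, one_smul]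

/-- Lebesgue measure splits evenly by the first binary digit, and that digit selects the
contraction. Used with two consecutive codes, and with F = F' for their limit. -/
theorem map_unitMeasure_eq_cantorAverage {F F' : ℝ → ℝ} (hF : Measurable F) (hF' : Measurable F')
    (h0 : ∀ y ∈ Ico (0 : ℝ) 1, F' (y / 2) = F y / 3)
    (h1 : ∀ y ∈ Ico (0 : ℝ) 1, F' ((y + 1) / 2) = (F y + 2 * ℓ) / 3) :
    unitMeasure.map F' = cantorAverage ℓ (unitMeasure.map F) := by
  conv_lhs => rw [unitMeasure_eq_average]
  rw [cantorAverage, Measure.map_smul, Measure.map_add _ _ hF', Measure.map_map hF' (by fun_prop),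
    Measure.map_map hF' (by fun_prop), Measure.map_map measurable_third_left hF,
    Measure.map_map (measurable_third_right ℓ) hF]
  congr 2
  · exact Measure.map_congr (ae_restrict_of_forall_mem measurableSet_Ico h0)
  · exact Measure.map_congr (ae_restrict_of_forall_mem measurableSet_Ico h1)

open Classical in
/-- The map sending the binary digits of `y` to the first `n` ternary digits of a point of the
`n`-th Cantor step, the remaining digits being interpolated linearly. -/
noncomputable def code (ℓ : ℝ) : ℕ → ℝ → ℝ
  | 0 => fun y => ℓ * y
  | n + 1 => fun y => if y < 1 / 2 then code ℓ n (2 * y) / 3 else (code ℓ n (2 * y - 1) + 2 * ℓ) / 3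

theorem measurable_code (ℓ : ℝ) (n : ℕ) : Measurable (code ℓ n) := by
  induction n with
  | zero => exact measurable_const_mul ℓ
  | succ n ih =>
    exact Measurable.ite measurableSet_Iio ((ih.comp (by fun_prop)).div_const 3)
      (((ih.comp (by fun_prop)).add_const _).div_const 3)

theorem code_succ_left (n : ℕ) {y : ℝ} (hy : y ∈ Ico (0 : ℝ) 1) :
    code ℓ (n + 1) (y / 2) = code ℓ n y / 3 := by
  have : y / 2 < 1 / 2 := by linarith [hy.2]
  simp only [code, if_pos this]
  rw [mul_div_cancel₀ _ two_ne_zero]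

theorem code_succ_right (n : ℕ) {y : ℝ} (hy : y ∈ Ico (0 : ℝ) 1) :
    code ℓ (n + 1) ((y + 1) / 2) = (code ℓ n y + 2 * ℓ) / 3 := by
  have : ¬ (y + 1) / 2 < 1 / 2 := by linarith [hy.1]
  simp only [code, if_neg this]
  rw [mul_div_cancel₀ _ two_ne_zero, add_sub_cancel_right]

theorem Ico_zero_one_cases {y : ℝ} (hy : y ∈ Ico (0 : ℝ) 1) :
    (∃ z ∈ Ico (0 : ℝ) 1, y = z / 2) ∨ ∃ z ∈ Ico (0 : ℝ) 1, y = (z + 1) / 2 := by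
  by_cases h : y < 1 / 2
  · exact Or.inl ⟨2 * y, ⟨by linarith [hy.1], by linarith⟩, by ring⟩
  · exact Or.inr ⟨2 * y - 1, ⟨by linarith, by linarith [hy.2]⟩, by ring⟩

theorem code_mem_cantorStep (hℓ : 0 < ℓ) (n : ℕ) :
    ∀ y ∈ Ico (0 : ℝ) 1, code ℓ n y ∈ cantorStep ℓ n := by
  induction n with
  | zero =>
    intro y hy
    exact ⟨mul_nonneg hℓ.le hy.1, mul_le_of_le_one_right hℓ.le hy.2.le⟩
  | succ n ih =>
    intro y hy
    rcases Ico_zero_one_cases hy with ⟨z, hz, rfl⟩ | ⟨z, hz, rfl⟩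
    · exact Or.inl ⟨_, ih z hz, (code_succ_left n hz).symm⟩
    · exact Or.inr ⟨_, ih z hz, (code_succ_right n hz).symm⟩

theorem dist_code_succ_le (hℓ : 0 < ℓ) (n : ℕ) :
    ∀ y ∈ Ico (0 : ℝ) 1, dist (code ℓ n y) (code ℓ (n + 1) y) ≤ ℓ * (1 / 3) ^ n := by
  induction n with
  | zero =>
    intro y hy
    rw [pow_zero, mul_one]
    refine (Real.dist_le_of_mem_Icc (cantorStep_subset_Icc hℓ 0 (code_mem_cantorStep hℓ 0 y hy))
      (cantorStep_subset_Icc hℓ 1 (code_mem_cantorStep hℓ 1 y hy))).trans_eq (sub_zero ℓ)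
  | succ n ih =>
    intro y hy
    rcases Ico_zero_one_cases hy with ⟨z, hz, rfl⟩ | ⟨z, hz, rfl⟩
    · have := ih z hz
      rw [code_succ_left n hz, code_succ_left (n + 1) hz, Real.dist_eq, ← sub_div, abs_div,
        ← Real.dist_eq, abs_of_pos (three_pos : (0 : ℝ) < 3), pow_succ]
      linarith
    · have := ih z hz
      rw [code_succ_right n hz, code_succ_right (n + 1) hz, Real.dist_eq, ← sub_div, abs_div,
        add_sub_add_right_eq_sub, ← Real.dist_eq, abs_of_pos (three_pos : (0 : ℝ) < 3), pow_succ]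
      linarith

/-- The measures `(3/2)^n/ℓ 𝓛⌞C_n` are images of Lebesgue measure on the unit interval. -/
theorem map_code (hℓ : 0 < ℓ) (n : ℕ) : unitMeasure.map (code ℓ n) =
    ENNReal.ofReal ((3 / 2) ^ n / ℓ) • volume.restrict (cantorStep ℓ n) := by
  induction n with
  | zero =>
    have e := map_affine_restrict hℓ.ne' 0 (B := Ico (0 : ℝ) 1)
    rw [image_affine_Ico hℓ] at e
    have e1 : code ℓ 0 = fun x => ℓ * x + 0 := by ext x; simp [code]
    rw [e1, e]
    simp only [mul_zero, add_zero, mul_one, pow_zero, one_div, cantorStep,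
      abs_of_pos (inv_pos.2 hℓ)]
    rw [restrict_Ico_eq_restrict_Icc]
  | succ n ih =>
    rw [map_unitMeasure_eq_cantorAverage (ℓ := ℓ) (measurable_code ℓ n) (measurable_code ℓ (n + 1))
      (fun y hy => code_succ_left n hy) (fun y hy => code_succ_right n hy), ih, cantorAverage_smul,
      cantorAverage_restrict_volume hℓ (isCompact_cantorStep ℓ n) (cantorStep_subset_Icc hℓ n),
      smul_smul, ← ENNReal.ofReal_mul (by positivity), cantorStep]
    congr 2
    ring

theorem exists_tendsto_code (hℓ : 0 < ℓ) : ∃ g : ℝ → ℝ, Measurable g ∧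
    ∀ y ∈ Ico (0 : ℝ) 1, Tendsto (fun n => code ℓ n y) atTop (𝓝 (g y)) ∧
      ∀ n, |code ℓ n y - g y| ≤ 2 * ℓ * (1 / 3) ^ n := by
  have hc : ∀ y ∈ Ico (0 : ℝ) 1, ∃ a, Tendsto (fun n => code ℓ n y) atTop (𝓝 a) := fun y hy =>
    cauchySeq_tendsto_of_complete (cauchySeq_of_le_geometric (1 / 3) ℓ (by norm_num)
      fun n => dist_code_succ_le hℓ n y hy)
  choose! g hg using hc
  -- The values of g off [0,1) are arbitrary choices; setting them to 0 makes the function an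
  -- everywhere limit of measurable ones.
  refine ⟨(Ico 0 1).indicator g, ?_, fun y hy => ?_⟩
  · refine measurable_of_tendsto_metrizable
      (f := fun n => (Ico (0 : ℝ) 1).indicator (code ℓ n))
      (fun n => (measurable_code ℓ n).indicator measurableSet_Ico) (tendsto_pi_nhds.2 fun y => ?_)
    by_cases hy : y ∈ Ico (0 : ℝ) 1
    · simpa only [indicator_of_mem hy] using hg y hy
    · simp only [indicator_of_notMem hy, tendsto_const_nhds]
  · rw [indicator_of_mem hy]
    refine ⟨hg y hy, fun n => ?_⟩
    have := dist_le_of_le_geometric_of_tendsto (1 / 3) ℓ (by norm_num)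
      (fun n => dist_code_succ_le hℓ n y hy) (hg y hy) n
    rw [Real.dist_eq] at this
    refine this.trans ?_
    have h0 : 0 < ℓ * (1 / 3) ^ n := by positivity
    rw [div_le_iff₀ (by norm_num)]
    nlinarith

/-- The limit of the maps `code ℓ n`. -/
noncomputable def codeLim (hℓ : 0 < ℓ) : ℝ → ℝ := (exists_tendsto_code hℓ).choose

theorem measurable_codeLim (hℓ : 0 < ℓ) : Measurable (codeLim hℓ) :=
  (exists_tendsto_code hℓ).choose_spec.1

theorem tendsto_code (hℓ : 0 < ℓ) {y : ℝ} (hy : y ∈ Ico (0 : ℝ) 1) :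
    Tendsto (fun n => code ℓ n y) atTop (𝓝 (codeLim hℓ y)) :=
  ((exists_tendsto_code hℓ).choose_spec.2 y hy).1

theorem abs_code_sub_codeLim_le (hℓ : 0 < ℓ) {y : ℝ} (hy : y ∈ Ico (0 : ℝ) 1) (n : ℕ) :
    |code ℓ n y - codeLim hℓ y| ≤ 2 * ℓ * (1 / 3) ^ n :=
  ((exists_tendsto_code hℓ).choose_spec.2 y hy).2 n

theorem codeLim_mem_cantor (hℓ : 0 < ℓ) {y : ℝ} (hy : y ∈ Ico (0 : ℝ) 1) :
    codeLim hℓ y ∈ cantor ℓ := by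
  refine mem_iInter.2 fun n => (isCompact_cantorStep ℓ n).isClosed.mem_of_tendsto
    (tendsto_code hℓ hy) ?_
  filter_upwards [eventually_ge_atTop n] with k hk
  exact antitone_cantorStep hℓ hk (code_mem_cantorStep hℓ k y hy)

/-- The Cantor probability measure. -/
noncomputable def cantorProb (hℓ : 0 < ℓ) : Measure ℝ := unitMeasure.map (codeLim hℓ)

instance (hℓ : 0 < ℓ) : IsProbabilityMeasure (cantorProb hℓ) := by
  have : IsProbabilityMeasure unitMeasure := ⟨by simp [unitMeasure]⟩
  exact Measure.isProbabilityMeasure_map (measurable_codeLim hℓ).aemeasurable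

theorem ae_mem_cantor (hℓ : 0 < ℓ) : ∀ᵐ x ∂(cantorProb hℓ), x ∈ cantor ℓ := by
  rw [cantorProb, ae_map_iff (p := fun x => x ∈ cantor ℓ) (measurable_codeLim hℓ).aemeasurable
    (isClosed_cantor ℓ).measurableSet]
  exact ae_restrict_of_forall_mem measurableSet_Ico fun y hy => codeLim_mem_cantor hℓ hy

theorem cantorAverage_cantorProb (hℓ : 0 < ℓ) :
    cantorAverage ℓ (cantorProb hℓ) = cantorProb hℓ := by
  refine (map_unitMeasure_eq_cantorAverage (measurable_codeLim hℓ) (measurable_codeLim hℓ)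
    (fun y hy => ?_) (fun y hy => ?_)).symm
  · have h1 := (tendsto_code hℓ (y := y / 2)
      ⟨by linarith [hy.1], by linarith [hy.2]⟩).comp (tendsto_add_atTop_nat 1)
    refine tendsto_nhds_unique h1 (((tendsto_code hℓ hy).div_const 3).congr fun n => ?_)
    exact (code_succ_left n hy).symm
  · have h1 := (tendsto_code hℓ (y := (y + 1) / 2)
      ⟨by linarith [hy.1], by linarith [hy.2]⟩).comp (tendsto_add_atTop_nat 1)
    refine tendsto_nhds_unique h1
      ((((tendsto_code hℓ hy).add_const (2 * ℓ)).div_const 3).congr fun n => ?_)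
    exact (code_succ_right n hy).symm

/-- The gap between the two thirds has length ℓ/3, so a set this small meets at most one of them.
Rescaling that part by 3 costs a factor 1/2 in mass and lowers n by one. -/
theorem cantorProb_le_of_diam (hℓ : 0 < ℓ) (n : ℕ) : ∀ A : Set ℝ, IsClosed A →
    (∀ x ∈ A, ∀ y ∈ A, x - y < ℓ * (1 / 3) ^ n) → cantorProb hℓ A ≤ 2⁻¹ ^ n := by
  induction n with
  | zero => intro A _ _; simpa using prob_le_one
  | succ n ih =>
    intro A hA hd
    have hzero : ∀ B : Set ℝ, (∀ x ∈ B, x ∉ Icc 0 ℓ) → cantorProb hℓ B = 0 := fun B hB =>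
      measure_mono_null (fun x hx hx' => hB x hx (cantor_subset_Icc ℓ hx'))
        (ae_iff.1 (ae_mem_cantor hℓ))
    have hp : (1 / 3 : ℝ) ^ n ≤ 1 := pow_le_one₀ (by norm_num) (by norm_num)
    have e : cantorProb hℓ A = 2⁻¹ * (cantorProb hℓ ((fun x => x / 3) ⁻¹' A) +
        cantorProb hℓ ((fun x => (x + 2 * ℓ) / 3) ⁻¹' A)) := by
      conv_lhs => rw [← cantorAverage_cantorProb hℓ, cantorAverage]
      rw [Measure.smul_apply, Measure.add_apply, Measure.map_apply measurable_third_left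
        hA.measurableSet, Measure.map_apply (measurable_third_right ℓ) hA.measurableSet,
        smul_eq_mul]
    rw [e, pow_succ']
    refine mul_le_mul_right ?_ _
    have b0 : cantorProb hℓ ((fun x => x / 3) ⁻¹' A) ≤ 2⁻¹ ^ n := by
      refine ih _ (hA.preimage (by fun_prop)) fun x hx y hy => ?_
      have := hd _ hx _ hy
      rw [pow_succ] at this
      linarith
    have b1 : cantorProb hℓ ((fun x => (x + 2 * ℓ) / 3) ⁻¹' A) ≤ 2⁻¹ ^ n := by
      refine ih _ (hA.preimage (by fun_prop)) fun x hx y hy => ?_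
      have := hd _ hx _ hy
      rw [pow_succ] at this
      linarith
    by_cases h0 : ∃ x ∈ Icc 0 ℓ, x / 3 ∈ A
    · obtain ⟨x, hx, hxA⟩ := h0
      rw [hzero ((fun x => (x + 2 * ℓ) / 3) ⁻¹' A), add_zero]
      · exact b0
      · intro y hy hy'
        have := hd _ hy _ hxA
        rw [pow_succ] at this
        have h2 : ℓ * ((1 / 3) ^ n * (1 / 3)) ≤ ℓ * (1 / 3) := by
          refine mul_le_mul_of_nonneg_left ?_ hℓ.le
          linarith
        have h3 := hx.2
        have h4 := hy'.1
        linarith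
    · rw [hzero ((fun x => x / 3) ⁻¹' A), zero_add]
      · exact b1
      · intro y hy hy'
        exact h0 ⟨y, hy', hy⟩

theorem cantorProb_singleton (hℓ : 0 < ℓ) (x : ℝ) : cantorProb hℓ {x} = 0 := by
  have h : ∀ n : ℕ, cantorProb hℓ {x} ≤ 2⁻¹ ^ n := fun n =>
    cantorProb_le_of_diam hℓ n _ isClosed_singleton fun a ha b hb => by
      rw [mem_singleton_iff.1 ha, mem_singleton_iff.1 hb, sub_self]
      positivity
  exact le_antisymm (ge_of_tendsto'
    (ENNReal.tendsto_pow_atTop_nhds_zero_of_lt_one (by norm_num)) h) bot_le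

end

section

/-! ### The Hausdorff measure on the Cantor set -/

variable {ℓ : ℝ}

theorem dimS_pos : 0 < dimS := div_pos (Real.log_pos one_lt_two) (Real.log_pos (by norm_num))

theorem three_rpow_dimS : (3 : ℝ) ^ dimS = 2 := by
  rw [dimS, Real.rpow_def_of_pos three_pos, mul_div_cancel₀ _ (Real.log_pos (by norm_num)).ne',
    Real.exp_log two_pos]

theorem third_pow_rpow_dimS (n : ℕ) : ((1 / 3 : ℝ) ^ n) ^ dimS = (1 / 2) ^ n := by
  rw [← Real.rpow_natCast, ← Real.rpow_mul (by norm_num), mul_comm, Real.rpow_mul (by norm_num),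
    Real.rpow_natCast, Real.div_rpow zero_le_one three_pos.le, Real.one_rpow, three_rpow_dimS]

open scoped Pointwise in
theorem map_third_left_hausdorffMeasure :
    (Measure.hausdorffMeasure dimS : Measure ℝ).map (fun x => x / 3) =
      (2 : ℝ≥0∞) • Measure.hausdorffMeasure dimS := by
  ext s hs
  rw [Measure.map_apply measurable_third_left hs, Measure.smul_apply]
  have e : (fun x : ℝ => x / 3) ⁻¹' s = (3 : ℝ) • s := by
    ext x
    rw [Set.mem_smul_set_iff_inv_smul_mem₀ three_ne_zero, mem_preimage, smul_eq_mul, div_eq_inv_mul]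
  rw [e, Measure.hausdorffMeasure_smul₀ dimS_pos.le three_ne_zero]
  have h2 : ‖(3 : ℝ)‖₊ ^ dimS = (2 : NNReal) := by
    ext
    simpa using three_rpow_dimS
  rw [h2]
  rfl

theorem map_third_right_hausdorffMeasure (ℓ : ℝ) :
    (Measure.hausdorffMeasure dimS : Measure ℝ).map (fun x => (x + 2 * ℓ) / 3) =
      (2 : ℝ≥0∞) • Measure.hausdorffMeasure dimS := by
  have e : (fun x : ℝ => (x + 2 * ℓ) / 3) = (fun x => x / 3) ∘ IsometryEquiv.addRight (2 * ℓ) :=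
    rfl
  rw [e, ← Measure.map_map measurable_third_left (IsometryEquiv.continuous _).measurable,
    IsometryEquiv.map_hausdorffMeasure, map_third_left_hausdorffMeasure]

/-- Since 3^s = 2, each contraction carries ℋ^s⌞C to twice ℋ^s on its third of C. Averaging cancels
the 2, and the thirds are disjoint with union C. -/
theorem cantorAverage_cantorMeasure (hℓ : 0 < ℓ) :
    cantorAverage ℓ (cantorMeasure ℓ) = cantorMeasure ℓ := by
  have he1 : MeasurableEmbedding fun x : ℝ => x / 3 := by
    simp_rw [div_eq_mul_inv]
    exact measurableEmbedding_mulRight₀ (by norm_num)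
  have he2 : MeasurableEmbedding fun x : ℝ => (x + 2 * ℓ) / 3 :=
    he1.comp (measurableEmbedding_addRight (2 * ℓ))
  have r1 : (cantorMeasure ℓ).map (fun x => x / 3) =
      (2 : ℝ≥0∞) • (Measure.hausdorffMeasure dimS).restrict ((fun x => x / 3) '' cantor ℓ) := by
    rw [← Measure.restrict_smul, ← map_third_left_hausdorffMeasure, he1.restrict_map,
      preimage_image_eq _ he1.injective, cantorMeasure]
  have r2 : (cantorMeasure ℓ).map (fun x => (x + 2 * ℓ) / 3) =
      (2 : ℝ≥0∞) • (Measure.hausdorffMeasure dimS).restrict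
        ((fun x => (x + 2 * ℓ) / 3) '' cantor ℓ) := by
    rw [← Measure.restrict_smul, ← map_third_right_hausdorffMeasure ℓ, he2.restrict_map,
      preimage_image_eq _ he2.injective, cantorMeasure]
  rw [cantorAverage, r1, r2, ← smul_add, ← Measure.restrict_union
    (disjoint_thirds hℓ (cantor_subset_Icc ℓ) (cantor_subset_Icc ℓ))
    (he2.measurableSet_image.2 (isClosed_cantor ℓ).measurableSet), ← cantor_eq_union hℓ, smul_smul,
    ENNReal.inv_mul_cancel two_ne_zero ENNReal.ofNat_ne_top, one_smul, cantorMeasure]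

/-- The `2^n` intervals forming the `n`-th Cantor step. -/
noncomputable def cantorPiece (ℓ : ℝ) : (n : ℕ) → (Fin n → Bool) → Set ℝ
  | 0, _ => Icc 0 ℓ
  | n + 1, w => if w 0 then (fun x => (x + 2 * ℓ) / 3) '' cantorPiece ℓ n (Fin.tail w)
      else (fun x => x / 3) '' cantorPiece ℓ n (Fin.tail w)

theorem cantorStep_subset_iUnion_cantorPiece (n : ℕ) :
    cantorStep ℓ n ⊆ ⋃ w, cantorPiece ℓ n w := by
  induction n with
  | zero => exact fun x hx => mem_iUnion.2 ⟨default, hx⟩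
  | succ n ih =>
    rintro x (⟨y, hy, rfl⟩ | ⟨y, hy, rfl⟩)
    · obtain ⟨w, hw⟩ := mem_iUnion.1 (ih hy)
      refine mem_iUnion.2 ⟨Fin.cons false w, ?_⟩
      simp only [cantorPiece, Fin.cons_zero, Fin.tail_cons]
      exact ⟨y, hw, rfl⟩
    · obtain ⟨w, hw⟩ := mem_iUnion.1 (ih hy)
      refine mem_iUnion.2 ⟨Fin.cons true w, ?_⟩
      simp only [cantorPiece, Fin.cons_zero, Fin.tail_cons]
      exact ⟨y, hw, rfl⟩

theorem abs_sub_le_of_mem_cantorPiece (n : ℕ) : ∀ w, ∀ x ∈ cantorPiece ℓ n w,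
    ∀ y ∈ cantorPiece ℓ n w, |x - y| ≤ ℓ * (1 / 3) ^ n := by
  induction n with
  | zero =>
    intro w x hx y hy
    rw [pow_zero, mul_one, abs_le]
    constructor <;> linarith [hx.1, hx.2, hy.1, hy.2]
  | succ n ih =>
    intro w x hx y hy
    rw [cantorPiece] at hx hy
    rw [pow_succ]
    split_ifs at hx hy
    · obtain ⟨a, ha, rfl⟩ := hx
      obtain ⟨b, hb, rfl⟩ := hy
      have := abs_le.1 (ih _ a ha b hb)
      simp only
      rw [abs_le]
      constructor <;> linarith [this.1, this.2]
    · obtain ⟨a, ha, rfl⟩ := hx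
      obtain ⟨b, hb, rfl⟩ := hy
      have := abs_le.1 (ih _ a ha b hb)
      simp only
      rw [abs_le]
      constructor <;> linarith [this.1, this.2]

/-- The natural cover by 2^n intervals of length ℓ/3^n has s-sum at most 2^n (ℓ/3^n)^s = ℓ^s for
every n. -/
theorem hausdorffMeasure_cantor_ne_top (hℓ : 0 < ℓ) :
    Measure.hausdorffMeasure dimS (cantor ℓ) ≠ ⊤ := by
  have hd : ∀ n w, Metric.ediam (cantorPiece ℓ n w) ≤ ENNReal.ofReal (ℓ * (1 / 3) ^ n) :=
    fun n w => Metric.ediam_le fun x hx y hy => by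
      rw [edist_dist, Real.dist_eq]
      exact ENNReal.ofReal_le_ofReal (abs_sub_le_of_mem_cantorPiece n w x hx y hy)
  have h := Measure.hausdorffMeasure_le_liminf_sum (X := ℝ) dimS (cantor ℓ) (l := atTop)
    (fun n : ℕ => ENNReal.ofReal (ℓ * (1 / 3) ^ n)) (by
      rw [← ENNReal.ofReal_zero]
      refine ENNReal.tendsto_ofReal ?_
      simpa using (tendsto_pow_atTop_nhds_zero_of_lt_one (r := (1 / 3 : ℝ)) (by norm_num)
        (by norm_num)).const_mul ℓ)
    (cantorPiece ℓ) (Eventually.of_forall hd)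
    (Eventually.of_forall fun n =>
      (iInter_subset (cantorStep ℓ) n).trans (cantorStep_subset_iUnion_cantorPiece n))
  refine ne_top_of_le_ne_top (b := ENNReal.ofReal (ℓ ^ dimS)) ENNReal.ofReal_ne_top (h.trans ?_)
  refine liminf_le_of_frequently_le' (Frequently.of_forall fun n => ?_)
  calc ∑ w, Metric.ediam (cantorPiece ℓ n w) ^ dimS
      ≤ ∑ _w : Fin n → Bool, ENNReal.ofReal (ℓ ^ dimS * (1 / 2) ^ n) := by
        refine Finset.sum_le_sum fun w _ => ?_
        refine (ENNReal.rpow_le_rpow (hd n w) dimS_pos.le).trans_eq ?_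
        rw [ENNReal.ofReal_rpow_of_nonneg (by positivity) dimS_pos.le,
          Real.mul_rpow hℓ.le (by positivity), third_pow_rpow_dimS]
    _ = ENNReal.ofReal (ℓ ^ dimS) := by
        rw [Finset.sum_const, Finset.card_univ, nsmul_eq_mul]
        simp only [Fintype.card_fun, Fintype.card_bool, Fintype.card_fin]
        rw [← ENNReal.ofReal_natCast, ← ENNReal.ofReal_mul (by positivity)]
        congr 1
        push_cast
        rw [mul_left_comm, ← mul_pow]
        norm_num

theorem cantorProb_le_ediam_rpow (hℓ : 0 < ℓ) (s : Set ℝ)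
    (hs : Metric.ediam s ≤ ENNReal.ofReal (ℓ / 9)) :
    cantorProb hℓ s ≤ ENNReal.ofReal (4 / ℓ ^ dimS) * Metric.ediam s ^ dimS := by
  have hfin : Metric.ediam s ≠ ⊤ := ne_top_of_le_ne_top ENNReal.ofReal_ne_top hs
  have hdist : ∀ x ∈ closure s, ∀ y ∈ closure s, x - y ≤ (Metric.ediam s).toReal := by
    intro x hx y hy
    have h1 : edist x y ≤ Metric.ediam s := by
      rw [← Metric.ediam_closure]
      exact Metric.edist_le_ediam_of_mem hx hy
    rw [edist_dist, ENNReal.ofReal_le_iff_le_toReal hfin] at h1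
    exact (le_abs_self _).trans h1
  refine (measure_mono (subset_closure (s := s))).trans ?_
  set d := (Metric.ediam s).toReal with hd
  have hds : Metric.ediam s = ENNReal.ofReal d := (ENNReal.ofReal_toReal hfin).symm
  have hd9 : d ≤ ℓ / 9 := by
    rw [hds, ENNReal.ofReal_le_ofReal_iff (by positivity)] at hs
    exact hs
  rcases (ENNReal.toReal_nonneg : 0 ≤ d).eq_or_lt with h0 | h0
  · rcases (closure s).eq_empty_or_nonempty with he | ⟨x, hx⟩
    · rw [he, measure_empty]; exact bot_le
    · have hsub : closure s ⊆ {x} := fun y hy => by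
        have h1 := hdist x hx y hy
        have h2 := hdist y hy x hx
        exact le_antisymm (by linarith) (by linarith)
      rw [measure_mono_null hsub (cantorProb_singleton hℓ x)]
      exact bot_le
  -- The 3 in 3d/ℓ yields the strict inequality d < ℓ/3^n, while d > ℓ/3^(n+2). The two lost powers
  -- of 3 become 2² = 4, the constant of the statement.
  · obtain ⟨n, hn1, hn2⟩ := exists_nat_pow_near_of_lt_one (x := 3 * d / ℓ) (y := 1 / 3)
      (by positivity) (by rw [div_le_one hℓ]; linarith) (by norm_num) (by norm_num)
    rw [lt_div_iff₀ hℓ] at hn1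
    rw [div_le_iff₀ hℓ] at hn2
    have hp : 0 < (1 / 3 : ℝ) ^ n * ℓ := by positivity
    have h1 : cantorProb hℓ (closure s) ≤ 2⁻¹ ^ n :=
      cantorProb_le_of_diam hℓ n _ isClosed_closure fun x hx y hy => by
        have := hdist x hx y hy
        linarith
    refine h1.trans ?_
    rw [hds, ENNReal.ofReal_rpow_of_nonneg h0.le dimS_pos.le, ← ENNReal.ofReal_mul (by positivity)]
    rw [show (2⁻¹ : ℝ≥0∞) = ENNReal.ofReal 2⁻¹ by
      rw [ENNReal.ofReal_inv_of_pos two_pos, ENNReal.ofReal_ofNat],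
      ← ENNReal.ofReal_pow (by norm_num)]
    refine ENNReal.ofReal_le_ofReal ?_
    have h2 : (ℓ * (1 / 3) ^ (n + 2)) ^ dimS ≤ d ^ dimS := by
      refine Real.rpow_le_rpow (by positivity) ?_ dimS_pos.le
      rw [pow_succ] at hn1
      rw [pow_succ, pow_succ]
      linarith
    rw [Real.mul_rpow hℓ.le (by positivity), third_pow_rpow_dimS, pow_add] at h2
    have hℓs : 0 < ℓ ^ dimS := Real.rpow_pos_of_pos hℓ _
    rw [div_mul_eq_mul_div, le_div_iff₀ hℓs, inv_eq_one_div]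
    linarith

/-- Mass distribution principle: a probability carried by C and bounded by a constant times diam^s
on small sets is at most that constant times ℋ^s. -/
theorem hausdorffMeasure_cantor_ne_zero (hℓ : 0 < ℓ) :
    Measure.hausdorffMeasure dimS (cantor ℓ) ≠ 0 := by
  have hc : (4 : ℝ) / ℓ ^ dimS > 0 := div_pos (by norm_num) (Real.rpow_pos_of_pos hℓ _)
  have hc0 : ENNReal.ofReal (4 / ℓ ^ dimS) ≠ 0 := (ENNReal.ofReal_pos.2 hc).ne'
  have h := Measure.le_hausdorffMeasure dimS ((ENNReal.ofReal (4 / ℓ ^ dimS))⁻¹ • cantorProb hℓ)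
    (ENNReal.ofReal (ℓ / 9)) (ENNReal.ofReal_pos.2 (by positivity)) fun s hs => by
      rw [Measure.smul_apply, smul_eq_mul, mul_comm, ← div_eq_mul_inv]
      exact ENNReal.div_le_of_le_mul' (cantorProb_le_ediam_rpow hℓ s hs)
  intro h0
  have h1 := h (cantor ℓ)
  rw [h0, Measure.smul_apply, (prob_compl_eq_zero_iff (isClosed_cantor ℓ).measurableSet).1
    (ae_iff.1 (ae_mem_cantor hℓ)), smul_eq_mul, mul_one] at h1
  exact ENNReal.inv_ne_zero.2 ENNReal.ofReal_ne_top (le_antisymm h1 bot_le)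

theorem isFiniteMeasure_cantorMeasure (hℓ : 0 < ℓ) : IsFiniteMeasure (cantorMeasure ℓ) :=
  ⟨by simpa [cantorMeasure] using (hausdorffMeasure_cantor_ne_top hℓ).lt_top⟩

theorem cantorMeasure_eq_smul (hℓ : 0 < ℓ) :
    cantorMeasure ℓ = Measure.hausdorffMeasure dimS (cantor ℓ) • cantorProb hℓ := by
  have := isFiniteMeasure_cantorMeasure hℓ
  have hf : IsFiniteMeasure (Measure.hausdorffMeasure dimS (cantor ℓ) • cantorProb hℓ) :=
    Measure.smul_finite _ (hausdorffMeasure_cantor_ne_top hℓ)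
  refine eq_of_cantorAverage_eq hℓ (cantorAverage_cantorMeasure hℓ) ?_ ?_ ?_ ?_
  · rw [cantorAverage_smul, cantorAverage_cantorProb]
  · filter_upwards [ae_restrict_mem (isClosed_cantor ℓ).measurableSet] with x hx
    exact cantor_subset_Icc ℓ hx
  · refine Measure.ae_smul_measure ?_ _
    filter_upwards [ae_mem_cantor hℓ] with x hx using cantor_subset_Icc ℓ hx
  · simp [cantorMeasure]

/-- The only point of C outside the open beam is the tip ℓ, and the measure has no atoms. Test
functions compactly supported in the beam therefore suffice. -/
theorem cantorMeasure_compl_beam (hℓ : 0 < ℓ) {δ : ℝ} (hδ : 0 < δ) :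
    cantorMeasure ℓ (beam δ ℓ)ᶜ = 0 := by
  rw [cantorMeasure_eq_smul hℓ, Measure.smul_apply]
  have : cantorProb hℓ (beam δ ℓ)ᶜ = 0 := by
    refine measure_mono_null (t := (cantor ℓ)ᶜ ∪ {ℓ}) (fun x hx => ?_)
      (measure_union_null (ae_iff.1 (ae_mem_cantor hℓ)) (cantorProb_singleton hℓ ℓ))
    by_contra hn
    rw [mem_union, not_or, mem_compl_iff, not_not] at hn
    have h1 := cantor_subset_Icc ℓ hn.1
    exact hx ⟨by linarith [h1.1], lt_of_le_of_ne h1.2 hn.2⟩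
  rw [this, smul_zero]

theorem tendsto_integral_code (hℓ : 0 < ℓ) {f : ℝ → ℝ} (hf : Continuous f) {M : ℝ}
    (hM : ∀ x, |f x| ≤ M) {h : ℝ → ℝ} (hh : Integrable h unitMeasure) :
    Tendsto (fun n => ∫ y, f (code ℓ n y) * h y ∂unitMeasure) atTop
      (𝓝 (∫ y, f (codeLim hℓ y) * h y ∂unitMeasure)) := by
  refine tendsto_integral_of_dominated_convergence (fun y => M * |h y|)
    (fun n => (hf.measurable.comp (measurable_code ℓ n)).aestronglyMeasurable.mul hh.1)
    (hh.abs.const_mul M) (fun n => Eventually.of_forall fun y => ?_) ?_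
  · rw [Real.norm_eq_abs, abs_mul]
    exact mul_le_mul_of_nonneg_right (hM _) (abs_nonneg _)
  · filter_upwards [ae_restrict_mem measurableSet_Ico] with y hy
    exact ((hf.tendsto _).comp (tendsto_code hℓ hy)).mul_const _

end

section

/-! ### The lower bound -/

/-- Cauchy–Schwarz, from the discriminant of the nonnegative quadratic t ↦ ∫ (t f + g)². -/
theorem sq_integral_mul_le {X : Type*} [MeasurableSpace X] {m : Measure X} {f g : X → ℝ}
    (hf : MemLp f 2 m) (hg : MemLp g 2 m) :
    (∫ x, f x * g x ∂m) ^ 2 ≤ (∫ x, f x ^ 2 ∂m) * ∫ x, g x ^ 2 ∂m := by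
  have hfg : Integrable (fun x => f x * g x) m := hf.integrable_mul hg
  have h : ∀ t : ℝ, 0 ≤ (∫ x, f x ^ 2 ∂m) * (t * t) + (2 * ∫ x, f x * g x ∂m) * t +
      ∫ x, g x ^ 2 ∂m := by
    intro t
    have e : (∫ x, f x ^ 2 ∂m) * (t * t) + (2 * ∫ x, f x * g x ∂m) * t + ∫ x, g x ^ 2 ∂m =
        ∫ x, (t * f x + g x) ^ 2 ∂m := by
      have e1 : ∀ x, (t * f x + g x) ^ 2 = (t * t) * f x ^ 2 + (2 * t) * (f x * g x) + g x ^ 2 :=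
        fun x => by ring
      simp only [e1]
      have i1 : Integrable (fun x => (t * t) * f x ^ 2 + (2 * t) * (f x * g x)) m :=
        (hf.integrable_sq.const_mul _).add (hfg.const_mul _)
      rw [integral_add i1 hg.integrable_sq,
        integral_add (hf.integrable_sq.const_mul _) (hfg.const_mul _), integral_const_mul,
        integral_const_mul]
      ring
    rw [e]
    exact integral_nonneg fun x => sq_nonneg _
  have := discrim_le_zero h
  rw [discrim] at this
  nlinarith

theorem le_ofReal_of_coe_sub_lt {x : ℝ≥0∞} {c a : ℝ} (h : (x : EReal) - (c : EReal) < (a : EReal)) :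
    x ≤ ENNReal.ofReal (a + c) ∧ 0 ≤ a + c := by
  induction x with
  | top => simp at h
  | coe x =>
    have h' : ((x : ℝ) - c : ℝ) < a := by
      rw [show ((x : ℝ≥0∞) : EReal) = ((x : ℝ) : EReal) from rfl, ← EReal.coe_sub, EReal.coe_lt_coe_iff] at h
      exact h
    have h0 : (x : ℝ) ≤ a + c := by linarith
    refine ⟨?_, x.2.trans h0⟩
    rw [← ENNReal.ofReal_coe_nnreal]
    exact ENNReal.ofReal_le_ofReal h0

theorem coe_sub_le_of_le_ofReal {x : ℝ≥0∞} {c B : ℝ} (hB : 0 ≤ B) (h : x ≤ ENNReal.ofReal B) :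
    (x : EReal) - (c : EReal) ≤ ((B - c : ℝ) : EReal) := by
  rw [EReal.coe_sub]
  refine EReal.sub_le_sub ?_ le_rfl
  calc (x : EReal) ≤ (ENNReal.ofReal B : EReal) := EReal.coe_ennreal_le_coe_ennreal_iff.2 h
    _ = (B : EReal) := by rw [EReal.coe_ennreal_ofReal, max_eq_left hB]

theorem secondDerivMeasure_spec {Ω : Set ℝ} {u : ℝ → ℝ} (h : MemW11MeasureSecondDeriv Ω u) :
    HasWeakDerivMeasure Ω (weakDeriv Ω u) (secondDerivMeasure Ω u) := by
  unfold secondDerivMeasure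
  rw [dif_pos h.2]
  exact h.2.choose_spec

variable {δ ℓ b : ℝ}

theorem le_stiffness (n : ℕ) (x : ℝ) : ENNReal.ofReal ((2 / 3) ^ n * b) ≤ stiffness ℓ b n x := by
  unfold stiffness
  split_ifs
  · exact le_rfl
  · exact le_top

theorem measurable_stiffness (n : ℕ) : Measurable (stiffness ℓ b n) :=
  Measurable.ite (isCompact_cantorStep ℓ n).measurableSet measurable_const measurable_const

theorem ae_beam_of_ae {p : ℝ → Prop} (h0 : ∀ᵐ x ∂(volume.restrict (Ioo (-δ) 0)), p x)
    (h1 : ∀ᵐ x ∂(volume.restrict (Ioo 0 ℓ)), p x) : ∀ᵐ x ∂(volume.restrict (beam δ ℓ)), p x := by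
  have hne : ∀ᵐ x : ℝ, x ≠ 0 := by simp [ae_iff]
  rw [ae_restrict_iff' measurableSet_Ioo] at h0 h1
  rw [beam, ae_restrict_iff' measurableSet_Ioo]
  filter_upwards [h0, h1, hne] with x hx0 hx1 hx2 hx
  rcases lt_or_gt_of_ne hx2 with h | h
  · exact hx0 ⟨hx.1, h⟩
  · exact hx1 ⟨h, hx.2⟩

/-- The energy bound confines w to C_n and gives ∫w² ≤ 2B (3/2)^n / b. After Cauchy–Schwarz on C_n,
the power (3/2)^n is exactly the one in the image measure of `code ℓ n`, so the resulting constant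
does not depend on n. -/
theorem sq_integral_le_of_energy_bound (hδ : 0 < δ) (hℓ : 0 < ℓ) (hb : 0 < b) (n : ℕ) {w : ℝ → ℝ}
    (hw : MemLp w 2 (volume.restrict (beam δ ℓ)))
    (hw0 : w =ᵐ[volume.restrict (Ioo (-δ) 0)] 0) {B : ℝ} (hB : 0 ≤ B)
    (hwB : (1 / 2 : ℝ≥0∞) * ∫⁻ x in Ioo 0 ℓ, stiffness ℓ b n x * ENNReal.ofReal (w x ^ 2) ≤
      ENNReal.ofReal B) {ψ : ℝ → ℝ} (hψ : Continuous ψ) {M : ℝ} (hM : ∀ x, |ψ x| ≤ M) :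
    (∫ x in beam δ ℓ, ψ x * w x) ^ 2 ≤
      2 * ℓ / b * B * ∫ y, ψ (code ℓ n y) ^ 2 ∂unitMeasure := by
  have hfin : IsFiniteMeasure (volume.restrict (beam δ ℓ)) := ⟨by simp [beam]⟩
  have hC := (isCompact_cantorStep ℓ n).measurableSet
  set Φ := ∫⁻ x in Ioo 0 ℓ, stiffness ℓ b n x * ENNReal.ofReal (w x ^ 2) with hΦ
  have hΦB : Φ ≤ ENNReal.ofReal (2 * B) := by
    have := mul_le_mul_right hwB 2
    rw [← mul_assoc, one_div, ENNReal.mul_inv_cancel two_ne_zero ENNReal.ofNat_ne_top,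
      one_mul] at this
    refine this.trans_eq ?_
    rw [ENNReal.ofReal_mul two_pos.le, ENNReal.ofReal_ofNat]
  have hwm : AEMeasurable (fun x => ENNReal.ofReal (w x ^ 2)) (volume.restrict (beam δ ℓ)) :=
    (hw.1.aemeasurable.pow_const 2).ennreal_ofReal
  have hsub : Ioo 0 ℓ ⊆ beam δ ℓ := Ioo_subset_Ioo_left (by linarith)
  have hwm' := hwm.mono_measure (Measure.restrict_mono hsub le_rfl)
  have hoff : ∀ᵐ x ∂(volume.restrict (beam δ ℓ)), x ∉ cantorStep ℓ n → w x = 0 := by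
    refine ae_beam_of_ae (hw0.mono fun x hx _ => hx) ?_
    -- A finite integral has an almost everywhere finite integrand; where the stiffness is ⊤ this
    -- forces w = 0.
    have hlt := ae_lt_top' ((measurable_stiffness n).aemeasurable.mul hwm')
      (ne_top_of_le_ne_top ENNReal.ofReal_ne_top hΦB)
    filter_upwards [hlt] with x hx hxn
    by_contra hne
    have hpos : ENNReal.ofReal (w x ^ 2) ≠ 0 := (ENNReal.ofReal_pos.2 (by positivity)).ne'
    have hst : stiffness ℓ b n x = ⊤ := by simp [stiffness, hxn]
    simp only [Pi.mul_apply] at hx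
    rw [hst, ENNReal.top_mul hpos] at hx
    exact lt_irrefl _ hx
  have hc : 0 < (2 / 3 : ℝ) ^ n * b := by positivity
  have hw2 : ENNReal.ofReal ((2 / 3) ^ n * b) * ∫⁻ x in beam δ ℓ, ENNReal.ofReal (w x ^ 2) ≤
      ENNReal.ofReal (2 * B) := by
    refine le_trans ?_ hΦB
    have e : ∫⁻ x in beam δ ℓ, ENNReal.ofReal (w x ^ 2) =
        ∫⁻ x in Ioo 0 ℓ, ENNReal.ofReal (w x ^ 2) := by
      have h1 : ∀ᵐ x ∂(volume.restrict (beam δ ℓ)), x ∉ Ioo 0 ℓ → w x = 0 :=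
        ae_beam_of_ae (hw0.mono fun x hx _ => hx)
          ((ae_restrict_mem measurableSet_Ioo).mono fun x hx hn => absurd hx hn)
      have h2 : (fun x => ENNReal.ofReal (w x ^ 2)) =ᵐ[volume.restrict (beam δ ℓ)]
          (Ioo 0 ℓ).indicator fun x => ENNReal.ofReal (w x ^ 2) := by
        filter_upwards [h1] with x hx
        by_cases hx0 : x ∈ Ioo 0 ℓ
        · rw [indicator_of_mem hx0]
        · rw [indicator_of_notMem hx0, hx hx0]
          simp
      rw [lintegral_congr_ae h2, setLIntegral_indicator measurableSet_Ioo,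
        inter_eq_self_of_subset_left hsub]
    rw [e, ← lintegral_const_mul'' _ hwm']
    exact lintegral_mono fun x => mul_le_mul_left (le_stiffness n x) _
  have hw3 : (2 / 3) ^ n * b * ∫ x in beam δ ℓ, w x ^ 2 ≤ 2 * B := by
    rw [← ofReal_integral_eq_lintegral_ofReal hw.integrable_sq
      (Eventually.of_forall fun x => sq_nonneg _), ← ENNReal.ofReal_mul hc.le] at hw2
    exact (ENNReal.ofReal_le_ofReal_iff (by positivity)).1 hw2
  have hψC : ∀ x, |(cantorStep ℓ n).indicator ψ x| ≤ M := fun x => by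
    by_cases hx : x ∈ cantorStep ℓ n
    · simpa [hx] using hM x
    · simpa [hx] using (abs_nonneg _).trans (hM x)
  have hψ2 : MemLp ((cantorStep ℓ n).indicator ψ) 2 (volume.restrict (beam δ ℓ)) :=
    MemLp.of_bound (hψ.measurable.indicator hC).aestronglyMeasurable M
      (Eventually.of_forall hψC)
  have e1 : ∫ x in beam δ ℓ, ψ x * w x =
      ∫ x in beam δ ℓ, (cantorStep ℓ n).indicator ψ x * w x := by
    refine integral_congr_ae (hoff.mono fun x hx => ?_)
    by_cases hxC : x ∈ cantorStep ℓ n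
    · simp [hxC]
    · simp [hx hxC]
  have e2 : ∫ x in beam δ ℓ, (cantorStep ℓ n).indicator ψ x ^ 2 ≤
      ∫ x in cantorStep ℓ n, ψ x ^ 2 := by
    have : (fun x => (cantorStep ℓ n).indicator ψ x ^ 2) =
        (cantorStep ℓ n).indicator fun x => ψ x ^ 2 := by
      ext x
      by_cases hxC : x ∈ cantorStep ℓ n <;> simp [hxC]
    rw [this, setIntegral_indicator hC]
    refine setIntegral_mono_set ?_ (Eventually.of_forall fun x => sq_nonneg _)
      inter_subset_right.eventuallyLE
    exact (hψ.pow 2).continuousOn.integrableOn_compact (isCompact_cantorStep ℓ n)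
  have e3 : ∫ y, ψ (code ℓ n y) ^ 2 ∂unitMeasure =
      (3 / 2) ^ n / ℓ * ∫ x in cantorStep ℓ n, ψ x ^ 2 := by
    rw [← integral_map (f := fun x => ψ x ^ 2) (measurable_code ℓ n).aemeasurable
      (hψ.pow 2).aestronglyMeasurable, map_code hℓ, integral_smul_measure,
      ENNReal.toReal_ofReal (by positivity), smul_eq_mul]
  have hCS := sq_integral_mul_le hψ2 hw
  rw [e1, e3]
  refine hCS.trans ?_
  have hW : 0 ≤ ∫ x in beam δ ℓ, w x ^ 2 := integral_nonneg fun x => sq_nonneg _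
  have hA : 0 ≤ ∫ x in cantorStep ℓ n, ψ x ^ 2 := integral_nonneg fun x => sq_nonneg _
  have h32 : (2 / 3 : ℝ) ^ n * (3 / 2) ^ n = 1 := by rw [← mul_pow]; norm_num
  have hW' : ∫ x in beam δ ℓ, w x ^ 2 ≤ 2 * B * (3 / 2) ^ n / b := by
    rw [le_div_iff₀ hb]
    have := mul_le_mul_of_nonneg_left hw3 (by positivity : (0 : ℝ) ≤ (3 / 2) ^ n)
    calc (∫ x in beam δ ℓ, w x ^ 2) * b
        = ((2 / 3 : ℝ) ^ n * (3 / 2) ^ n) * ((∫ x in beam δ ℓ, w x ^ 2) * b) := by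
          rw [h32, one_mul]
      _ = (3 / 2) ^ n * ((2 / 3) ^ n * b * ∫ x in beam δ ℓ, w x ^ 2) := by ring
      _ ≤ (3 / 2) ^ n * (2 * B) := this
      _ = 2 * B * (3 / 2) ^ n := by ring
  calc _ ≤ (∫ x in cantorStep ℓ n, ψ x ^ 2) * (2 * B * (3 / 2) ^ n / b) :=
        mul_le_mul e2 hW' hW hA
    _ = 2 * ℓ / b * B * ((3 / 2) ^ n / ℓ * ∫ x in cantorStep ℓ n, ψ x ^ 2) := by
        field_simp

theorem signedIntegral_withDensity_secondDeriv {u w : ℝ → ℝ}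
    (hw : MemLp w 2 (volume.restrict (beam δ ℓ)))
    (h : secondDeriv δ ℓ u =ᵐ[volume.restrict (beam δ ℓ)] w) {ψ : ℝ → ℝ} (hψ : Continuous ψ) {M : ℝ}
    (hM : ∀ x, |ψ x| ≤ M) :
    ∫ᵛ x, ψ x ∂<•((volume.restrict (beam δ ℓ)).withDensityᵥ (secondDeriv δ ℓ u)) =
      ∫ x in beam δ ℓ, ψ x * w x := by
  have hfin : IsFiniteMeasure (volume.restrict (beam δ ℓ)) := ⟨by simp [beam]⟩
  rw [WithDensityᵥEq.congr_ae h,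
    signedIntegral_withDensity_of_bound (hw.integrable one_le_two) hψ.measurable hM]

theorem isBounded_beam : Bornology.IsBounded (beam δ ℓ) := Metric.isBounded_Ioo _ _

theorem integral_cantorMeasure (hℓ : 0 < ℓ) {f : ℝ → ℝ} (hf : Measurable f) :
    ∫ x, f x ∂(cantorMeasure ℓ) = (Measure.hausdorffMeasure dimS (cantor ℓ)).toReal *
      ∫ y, f (codeLim hℓ y) ∂unitMeasure := by
  rw [cantorMeasure_eq_smul hℓ, integral_smul_measure, cantorProb,
    integral_map (measurable_codeLim hℓ).aemeasurable hf.aestronglyMeasurable, smul_eq_mul]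

/-- A real level a exceeded by the liminf only gives energies below a for infinitely many n. This is
enough: the tested inequality, the clamping and the sign of a + P u(ℓ) all pass to the limit along
such n, and duality turns the inequality into membership in 𝒲_∞ together with the energy bound. -/
theorem energyInf_le_of_frequently (hδ : 0 < δ) (hℓ : 0 < ℓ) (hb : 0 < b) {P : ℝ} {u : ℝ → ℝ}
    (hu : MemW11MeasureSecondDeriv (beam δ ℓ) u) {us : ℕ → ℝ → ℝ}
    (hus : ∀ n, MemSobolev 2 2 (beam δ ℓ) (us n)) (hconv : BeamTendsto δ ℓ us u) {a : ℝ}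
    (ha : ∃ᶠ n in atTop, energy δ ℓ b P n (us n) < (a : EReal)) :
    energyInf δ ℓ b P u ≤ (a : EReal) := by
  have hend := tendsto_endValue hδ hℓ (fun n => (hus n).one_one isBounded_beam) hu.1 hconv.1
  set e := endValue δ ℓ u with he
  have hspec : ∀ n, energy δ ℓ b P n (us n) < (a : EReal) → ClampedAtWall δ (us n) ∧
      (1 / 2 : ℝ≥0∞) * ∫⁻ x in Ioo 0 ℓ, stiffness ℓ b n x *
        ENNReal.ofReal (secondDeriv δ ℓ (us n) x ^ 2) ≤
        ENNReal.ofReal (a + P * endValue δ ℓ (us n)) ∧ 0 ≤ a + P * endValue δ ℓ (us n) := by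
    intro n hn
    unfold energy at hn
    split_ifs at hn with h
    · exact ⟨h.2, le_ofReal_of_coe_sub_lt hn⟩
    · exact absurd hn not_top_lt
  have hB : Tendsto (fun n => a + P * endValue δ ℓ (us n)) atTop (𝓝 (a + P * e)) :=
    (hend.const_mul P).const_add a
  have hB0 : 0 ≤ a + P * e := ge_of_tendsto_of_frequently hB (ha.mono fun n hn => (hspec n hn).2.2)
  have hclamp : ClampedAtWall δ u :=
    ClampedAtWall.of_tendsto hℓ (hu.1.memW11 isOpen_Ioo).1.1 hconv.1
      (ha.mono fun n hn => (hspec n hn).1)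
  set μ := secondDerivMeasure (beam δ ℓ) u with hμ
  have hμs := secondDerivMeasure_spec hu
  set H := (Measure.hausdorffMeasure dimS (cantor ℓ)).toReal with hH
  have hHpos : 0 < H := ENNReal.toReal_pos (hausdorffMeasure_cantor_ne_zero hℓ)
    (hausdorffMeasure_cantor_ne_top hℓ)
  have hcf := isFiniteMeasure_cantorMeasure hℓ
  have htest : ∀ ψ : ℝ → ℝ, Continuous ψ → HasCompactSupport ψ → tsupport ψ ⊆ beam δ ℓ →
      (∫ᵛ x, ψ x ∂<•μ) ^ 2 ≤
        2 * ℓ / b * (a + P * e) / H * ∫ x, ψ x ^ 2 ∂(cantorMeasure ℓ) := by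
    intro ψ hψ hψc hψs
    obtain ⟨M, hM⟩ := hψ.bounded_above_of_compact_support hψc
    have hM2 : ∀ x, |ψ x ^ 2| ≤ M ^ 2 := fun x => by
      rw [abs_pow]
      exact pow_le_pow_left₀ (abs_nonneg _) (hM x) 2
    have hfm : IsFiniteMeasure unitMeasure := ⟨by simp [unitMeasure]⟩
    have t1 := hconv.2 ψ hψ hψc hψs
    have hψ2 : Continuous fun x => ψ x ^ 2 := hψ.pow 2
    have t2 := tendsto_integral_code hℓ hψ2 hM2 (integrable_const (μ := unitMeasure) (1 : ℝ))
    simp only [mul_one] at t2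
    have t3 := (hB.const_mul (2 * ℓ / b)).mul t2
    have hle := le_of_tendsto_of_tendsto_of_frequently (t1.pow 2) t3 (ha.mono fun n hn => by
      obtain ⟨k1, k2, k3⟩ := hspec n hn
      obtain ⟨d1, d2, -, d4⟩ := (hus n).secondDeriv_spec isOpen_Ioo
      rw [signedIntegral_withDensity_secondDeriv d4 (EventuallyEq.refl _ _) hψ hM]
      exact sq_integral_le_of_energy_bound hδ hℓ hb n d4 (k1.secondDeriv_eq_zero hℓ d1 d2) k3 k2
        hψ hM)
    refine hle.trans_eq ?_
    rw [integral_cantorMeasure hℓ hψ2.measurable, ← hH]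
    field_simp
  obtain ⟨hden, hL2⟩ := density_of_sq_signedIntegral_le μ (cantorMeasure ℓ)
    (K := 2 * ℓ / b * (a + P * e) / H) fun ψ hψ ⟨M, hM⟩ =>
      sq_signedIntegral_le_of_test isOpen_Ioo isBounded_beam hμs.2.1
        (cantorMeasure_compl_beam hℓ hδ) htest hψ hM
  have hac : VectorMeasure.AbsolutelyContinuous μ (cantorMeasure ℓ).toENNRealVectorMeasure := by
    rw [SignedMeasure.absolutelyContinuous_iff_withDensityᵥ_rnDeriv_eq]
    exact hden
  have hW : MemWInf δ ℓ u := ⟨hu, hac, hclamp⟩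
  unfold energyInf
  rw [if_pos hW]
  have key : ∫⁻ x, ENNReal.ofReal b * Measure.hausdorffMeasure dimS (cantor ℓ)
          / (2 * ENNReal.ofReal ℓ) * ENNReal.ofReal (μ.rnDeriv (cantorMeasure ℓ) x ^ 2)
        ∂(cantorMeasure ℓ) ≤ ENNReal.ofReal (a + P * e) := by
    rw [lintegral_const_mul _ ((SignedMeasure.measurable_rnDeriv _ _).pow_const 2).ennreal_ofReal]
    refine (mul_le_mul_right hL2 _).trans_eq ?_
    rw [← ENNReal.ofReal_toReal (hausdorffMeasure_cantor_ne_top hℓ), ← hH,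
      ← ENNReal.ofReal_mul hb.le, show (2 : ℝ≥0∞) = ENNReal.ofReal 2 by simp,
      ← ENNReal.ofReal_mul two_pos.le, ← ENNReal.ofReal_div_of_pos (by positivity),
      ← ENNReal.ofReal_mul (by positivity)]
    -- The factor bH/(2ℓ) of E_∞ is the reciprocal of the factor 2ℓ/(bH) in K, so exactly a + P u(ℓ)
    -- remains.
    congr 1
    field_simp
  refine (coe_sub_le_of_le_ofReal hB0 key).trans_eq ?_
  rw [add_sub_cancel_right]

theorem energyInf_le_liminf (hδ : 0 < δ) (hℓ : 0 < ℓ) (hb : 0 < b) {P : ℝ} {u : ℝ → ℝ}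
    (hu : MemW11MeasureSecondDeriv (beam δ ℓ) u) {us : ℕ → ℝ → ℝ}
    (hus : ∀ n, MemSobolev 2 2 (beam δ ℓ) (us n)) (hconv : BeamTendsto δ ℓ us u) :
    energyInf δ ℓ b P u ≤ liminf (fun n => energy δ ℓ b P n (us n)) atTop := by
  by_contra! hlt
  obtain ⟨a, ha1, ha2⟩ := EReal.lt_iff_exists_real_btwn.1 hlt
  exact absurd (energyInf_le_of_frequently hδ hℓ hb hu hus hconv
    (frequently_lt_of_liminf_lt (by isBoundedDefault) ha1)) (not_le.2 ha2)

end

section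

/-! ### The recovery sequences -/

variable {δ ℓ b : ℝ} {S : Type*} [MeasurableSpace S] {m : Measure S} {h : S → ℝ}
  {G : S → ℝ}

theorem tendsto_integral_comp_mul (hh : Integrable h m) {Gs : ℕ → S → ℝ}
    (hGs : ∀ n, Measurable (Gs n)) {ε : ℕ → ℝ} (hε : Tendsto ε atTop (𝓝 0))
    (hGε : ∀ n, ∀ᵐ s ∂m, |Gs n s - G s| ≤ ε n) {ψ : ℝ → ℝ} (hψ : Continuous ψ) {M : ℝ}
    (hM : ∀ x, |ψ x| ≤ M) :
    Tendsto (fun n => ∫ s, ψ (Gs n s) * h s ∂m) atTop (𝓝 (∫ s, ψ (G s) * h s ∂m)) := by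
  refine tendsto_integral_of_dominated_convergence (fun s => M * |h s|)
    (fun n => (hψ.measurable.comp (hGs n)).aestronglyMeasurable.mul hh.1)
    (hh.abs.const_mul M) (fun n => Eventually.of_forall fun s => ?_) ?_
  · rw [Real.norm_eq_abs, abs_mul]
    exact mul_le_mul_of_nonneg_right (hM _) (abs_nonneg _)
  · filter_upwards [ae_all_iff.2 hGε] with s hs
    have : Tendsto (fun n => Gs n s) atTop (𝓝 (G s)) := by
      rw [tendsto_iff_dist_tendsto_zero]
      exact squeeze_zero (fun n => dist_nonneg) (fun n => by rw [Real.dist_eq]; exact hs n) hε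
    exact ((hψ.tendsto _).comp this).mul_const _

/-- Common core of both constructions: u is the deflection generated by G, and its approximants use
Gs n with the same h, c₀ and c₁. The Lipschitz dependence of ramps and steps on their base points
gives W^{1,1} convergence; the densities f n of the images put the approximants in W^{2,2}. -/
theorem exists_recovery [IsFiniteMeasure m] (hδ : 0 < δ) (hℓ : 0 < ℓ) {u : ℝ → ℝ}
    (hu : MemW11MeasureSecondDeriv (beam δ ℓ) u) (hh : Integrable h m) (hG : Measurable G)
    {Gs : ℕ → S → ℝ} (hGs : ∀ n, Measurable (Gs n)) {R : ℝ} (hR : ∀ x ∈ beam δ ℓ, |x| ≤ R)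
    (hGR : ∀ᵐ s ∂m, |G s| ≤ R)
    (hGsR : ∀ n, ∀ᵐ s ∂m, |Gs n s| ≤ R) {ε : ℕ → ℝ} (hε : Tendsto ε atTop (𝓝 0))
    (hGε : ∀ n, ∀ᵐ s ∂m, |Gs n s - G s| ≤ ε n)
    (hμ : ∀ ψ : ℝ → ℝ, Continuous ψ → (∃ M, ∀ x, |ψ x| ≤ M) →
      ∫ᵛ x, ψ x ∂<•(secondDerivMeasure (beam δ ℓ) u) = ∫ s, ψ (G s) * h s ∂m)
    {f : ℕ → ℝ → ℝ} (hf : ∀ n, MemLp (f n) 2 (volume.restrict (beam δ ℓ)))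
    (hfG : ∀ n, ∀ ψ : ℝ → ℝ, Continuous ψ → HasCompactSupport ψ → tsupport ψ ⊆ beam δ ℓ →
      ∫ x in beam δ ℓ, ψ x * f n x = ∫ s, ψ (Gs n s) * h s ∂m) :
    ∃ c₀ c₁, u =ᵐ[volume.restrict (beam δ ℓ)] deflection m h G c₀ c₁ ∧
      (∀ n, MemSobolev 2 2 (beam δ ℓ) (deflection m h (Gs n) c₀ c₁)) ∧
      (∀ n, secondDeriv δ ℓ (deflection m h (Gs n) c₀ c₁) =ᵐ[volume.restrict (beam δ ℓ)] f n) ∧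
      BeamTendsto δ ℓ (fun n => deflection m h (Gs n) c₀ c₁) u := by
  have hfin : IsFiniteMeasure (volume.restrict (beam δ ℓ)) := ⟨by simp [beam]⟩
  have hΩ : MeasurableSet (beam δ ℓ) := measurableSet_Ioo
  have hΩo : IsOpen (beam δ ℓ) := isOpen_Ioo
  obtain ⟨c₀, c₁, hc₁, hc₀⟩ := exists_ae_eq_deflection (a := -δ) (b := ℓ) (by linarith) hh hG hGR hR
    (hu.1.memW11 hΩo).2.1 (secondDerivMeasure_spec hu)
    fun φ hφ => hμ φ hφ.continuous hφ.exists_bound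
  have huv := fun n => hasWeakDeriv_deflection hh (hGs n) (hGsR n) hΩ hR c₀ c₁
  have hvi := fun n => integrableOn_slope hh (hGs n) hΩ isBounded_beam c₁
  have hui := fun n => integrableOn_deflection hh (hGs n) (hGsR n) hΩ hR c₀ c₁
  have hvw : ∀ n, HasWeakDeriv (beam δ ℓ) (slope m h (Gs n) c₁) (f n) := fun n =>
    ⟨(hvi n).locallyIntegrableOn,
      IntegrableOn.locallyIntegrableOn ((hf n).integrable one_le_two), fun φ hφ => by
        rw [setIntegral_slope_mul_deriv hh (hGs n) hΩ isBounded_beam c₁ hφ,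
          ← hfG n φ hφ.continuous hφ.2.1 hφ.2.2]
        simp only [mul_comm]⟩
  have hS : ∀ n, MemSobolev 2 2 (beam δ ℓ) (deflection m h (Gs n) c₀ c₁) := fun n =>
    memSobolev_two_of_hasWeakDeriv
      (MemLp.of_bound (hui n).1 _
        (ae_restrict_of_forall_mem hΩ fun x hx => abs_deflection_le hh (hGsR n) c₀ c₁ (hR x hx)))
      (MemLp.of_bound (hvi n).1 _ (Eventually.of_forall fun x => abs_slope_le hh c₁ x))
      (hf n) (huv n) (hvw n)
  have h2 : ∀ n, secondDeriv δ ℓ (deflection m h (Gs n) c₀ c₁) =ᵐ[volume.restrict (beam δ ℓ)] f n :=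
    fun n => weakDeriv_weakDeriv_ae_eq hΩo (huv n) (hvw n)
  refine ⟨c₀, c₁, hc₀, hS, h2, ?_, ?_⟩
  · have hlim : Tendsto (fun n => ENNReal.ofReal (ε n * ∫ s, |h s| ∂m) * volume (beam δ ℓ) +
        ENNReal.ofReal (ε n) * ∫⁻ s, ‖h s‖ₑ ∂m) atTop (𝓝 0) := by
      have t1 : Tendsto (fun n => ENNReal.ofReal (ε n * ∫ s, |h s| ∂m)) atTop (𝓝 0) := by
        have := ENNReal.tendsto_ofReal (hε.mul_const (∫ s, |h s| ∂m))
        simpa using this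
      have t2 : Tendsto (fun n => ENNReal.ofReal (ε n)) atTop (𝓝 0) := by
        simpa using ENNReal.tendsto_ofReal hε
      have t3 := (ENNReal.Tendsto.mul_const (b := volume (beam δ ℓ)) t1
        (Or.inr isBounded_beam.measure_lt_top.ne)).add
        (ENNReal.Tendsto.mul_const (b := ∫⁻ s, ‖h s‖ₑ ∂m) t2 (Or.inr hh.2.ne))
      simpa using t3
    refine tendsto_of_tendsto_of_tendsto_of_le_of_le tendsto_const_nhds hlim
      (fun n => zero_le) fun n => add_le_add ?_ ?_
    · refine (eLpNorm_congr_ae ((EventuallyEq.refl _ (deflection m h (Gs n) c₀ c₁)).sub hc₀)).trans_le ?_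
      exact eLpNorm_deflection_sub_le hh hG (hGs n) hGR (hGsR n) (hGε n) hΩ hR c₀ c₁
    · refine (eLpNorm_congr_ae (((huv n).weakDeriv_ae_eq hΩo).sub hc₁)).trans_le ?_
      exact eLpNorm_slope_sub_le hh hG (hGs n) (hGε n) _ c₁
  · intro ψ hψ hψc hψs
    obtain ⟨M, hM⟩ := hψ.bounded_above_of_compact_support hψc
    rw [hμ ψ hψ ⟨M, hM⟩]
    have e : ∀ n, ∫ᵛ x, ψ x ∂<•((volume.restrict (beam δ ℓ)).withDensityᵥ
        (secondDeriv δ ℓ (deflection m h (Gs n) c₀ c₁))) = ∫ s, ψ (Gs n s) * h s ∂m := fun n => by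
      rw [signedIntegral_withDensity_secondDeriv (hf n) (h2 n) hψ hM, hfG n ψ hψ hψc hψs]
    simp only [e]
    exact tendsto_integral_comp_mul hh hGs hε hGε hψ hM

/-! ### Smoothing an arbitrary second derivative -/

theorem setIntegral_eq_integral_of_tsupport {Ω : Set ℝ} {ψ : ℝ → ℝ} (hψ : tsupport ψ ⊆ Ω)
    (g : ℝ → ℝ) : ∫ x in Ω, g x * ψ x = ∫ x, g x * ψ x := by
  refine setIntegral_eq_integral_of_forall_compl_eq_zero fun x hx => ?_
  rw [image_eq_zero_of_notMem_tsupport fun h => hx (hψ h), mul_zero]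

/-- The mollification of `h m` by the uniform distribution on `[0, η]`. -/
noncomputable def mollify (m : Measure ℝ) (h : ℝ → ℝ) (η x : ℝ) : ℝ :=
  η⁻¹ * (slope m h id 0 x - slope m h (fun t => t + η) 0 x)

theorem memLp_mollify {m : Measure ℝ} [IsFiniteMeasure m] {h : ℝ → ℝ} (hh : Integrable h m) (η : ℝ)
    {Ω : Set ℝ} (hΩ : MeasurableSet Ω) (hΩb : Bornology.IsBounded Ω) :
    MemLp (mollify m h η) 2 (volume.restrict Ω) := by
  have : IsFiniteMeasure (volume.restrict Ω) := ⟨by simpa using hΩb.measure_lt_top⟩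
  have hm : ∀ {G : ℝ → ℝ}, Measurable G → MemLp (slope m h G 0) 2 (volume.restrict Ω) :=
    fun hG => MemLp.of_bound (integrableOn_slope hh hG hΩ hΩb 0).1 _
      (Eventually.of_forall fun x => abs_slope_le hh 0 x)
  exact ((hm measurable_id).sub (hm (measurable_id.add_const η))).const_mul _

/-- On Ω, `mollify` is the density of the image of h m ⊗ 𝓛⌞[0,1) under (t, y) ↦ t + ηy: by Fubini
the difference of the slopes pairs with ψ to the average of ψ over [t, t + η]. -/
theorem setIntegral_mul_mollify {m : Measure ℝ} [IsFiniteMeasure m] {h : ℝ → ℝ}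
    (hh : Integrable h m) {η : ℝ} (hη : 0 < η) {Ω : Set ℝ} (hΩ : MeasurableSet Ω)
    (hΩb : Bornology.IsBounded Ω) {ψ : ℝ → ℝ} (hψ : Continuous ψ) (hψc : HasCompactSupport ψ)
    (hψs : tsupport ψ ⊆ Ω) :
    ∫ x in Ω, ψ x * mollify m h η x =
      ∫ p, ψ (p.1 + η * p.2) * h p.1 ∂(m.prod unitMeasure) := by
  obtain ⟨M, hM⟩ := hψ.bounded_above_of_compact_support hψc
  have hfm : IsFiniteMeasure unitMeasure := ⟨by simp [unitMeasure]⟩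
  have hψi := hψ.integrable_of_hasCompactSupport hψc (μ := volume)
  have hsw : ∀ {G : ℝ → ℝ}, Measurable G → ∫ x in Ω, slope m h G 0 x * ψ x =
      ∫ t, (∫ x in Ioi (G t), ψ x) * h t ∂m := fun {G} hG => by
    have := integral_kernel_mul_swap hh hG measurable_step hΩ hΩb
      (Eventually.of_forall fun s x _ => abs_step_le _ _) hψ.measurable hM
    simp only [setIntegral_eq_integral_of_tsupport hψs, integral_step_mul] at this
    rw [← this]
    rw [← setIntegral_eq_integral_of_tsupport hψs]
    simp only [slope, zero_add]
  have hint : ∀ {G : ℝ → ℝ}, Measurable G → Integrable (fun x => slope m h G 0 x * ψ x)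
      (volume.restrict Ω) := fun hG =>
    (integrableOn_slope hh hG hΩ hΩb 0).mul_bdd hψ.aestronglyMeasurable (Eventually.of_forall hM)
  have hint' : ∀ {G : ℝ → ℝ}, Measurable G → Integrable (fun t => (∫ x in Ioi (G t), ψ x) * h t) m :=
    fun {G} hG => by
      refine hh.bdd_mul (c := ∫ x, |ψ x|) ?_ (Eventually.of_forall fun t => ?_)
      · have : Continuous fun t => ∫ x in Ioi t, ψ x := by
          have e : (fun t => ∫ x in Ioi t, ψ x) =
              fun t => (∫ x in Ioi 0, ψ x) - ∫ x in (0 : ℝ)..t, ψ x := by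
            ext t
            rw [← intervalIntegral.integral_Ioi_sub_Ioi' hψi.integrableOn hψi.integrableOn,
              sub_sub_cancel]
          rw [e]
          exact continuous_const.sub (intervalIntegral.continuous_primitive
            (fun a b => hψi.intervalIntegrable) 0)
        exact (this.measurable.comp hG).aestronglyMeasurable
      · refine abs_integral_le_integral_abs.trans ?_
        exact setIntegral_le_integral hψi.abs (Eventually.of_forall fun x => abs_nonneg _)
  have hbd : Integrable (fun p : ℝ × ℝ => ψ (p.1 + η * p.2) * h p.1) (m.prod unitMeasure) :=
    (hh.comp_fst unitMeasure).bdd_mul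
      (hψ.measurable.comp (by fun_prop)).aestronglyMeasurable (Eventually.of_forall fun p => hM _)
  have e1 : ∀ x, ψ x * mollify m h η x =
      η⁻¹ * (slope m h id 0 x * ψ x - slope m h (fun t => t + η) 0 x * ψ x) := fun x => by
    rw [mollify]; ring
  simp only [e1]
  have hη' : Measurable fun t : ℝ => t + η := measurable_id.add_const η
  rw [integral_const_mul, integral_sub (hint measurable_id) (hint hη'),
    hsw measurable_id, hsw hη', ← integral_sub (hint' measurable_id) (hint' hη'),
    ← integral_const_mul, integral_prod _ hbd]
  refine integral_congr_ae (Eventually.of_forall fun t => ?_)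
  simp only [id]
  rw [integral_mul_const, ← sub_mul, ← mul_assoc]
  congr 1
  rw [intervalIntegral.integral_Ioi_sub_Ioi hψi.integrableOn (by linarith), unitMeasure,
    integral_Ico_eq_integral_Ioc, ← intervalIntegral.integral_of_le zero_le_one,
    intervalIntegral.integral_comp_add_mul _ hη.ne']
  simp

/-- Handles infinite E_∞(u), where any W^{2,2} approximation will do, clamped or not. -/
theorem exists_beamTendsto (hδ : 0 < δ) (hℓ : 0 < ℓ) {u : ℝ → ℝ}
    (hu : MemW11MeasureSecondDeriv (beam δ ℓ) u) :
    ∃ us : ℕ → ℝ → ℝ, (∀ n, MemSobolev 2 2 (beam δ ℓ) (us n)) ∧ BeamTendsto δ ℓ us u := by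
  obtain ⟨h, hhm, hhi, hμh⟩ := exists_eq_variation_withDensity (secondDerivMeasure (beam δ ℓ) u)
  have hΩ : MeasurableSet (beam δ ℓ) := measurableSet_Ioo
  have hv := variation_compl_eq_zero hΩ (secondDerivMeasure_spec hu).2.1
  set m := (secondDerivMeasure (beam δ ℓ) u).variation with hm
  have hη : ∀ n : ℕ, (0 : ℝ) < 1 / (n + 1) := fun n => by positivity
  have hfm : IsProbabilityMeasure unitMeasure := ⟨by simp [unitMeasure]⟩
  have hfst : ∀ᵐ p ∂(m.prod unitMeasure), p.1 ∈ beam δ ℓ :=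
    Measure.quasiMeasurePreserving_fst.ae (p := fun t => t ∈ beam δ ℓ) (measure_eq_zero_iff_ae_notMem.1 hv |>.mono
      fun x hx => not_not.1 hx)
  have hsnd : ∀ᵐ p ∂(m.prod unitMeasure), p.2 ∈ Ico (0 : ℝ) 1 :=
    Measure.quasiMeasurePreserving_snd.ae (p := fun t => t ∈ Ico (0 : ℝ) 1)
      (ae_restrict_mem measurableSet_Ico)
  have hdist : ∀ n : ℕ, ∀ᵐ p ∂(m.prod unitMeasure),
      |p.1 + 1 / ((n : ℝ) + 1) * p.2 - p.1| ≤ 1 / (n + 1) := fun n => by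
    filter_upwards [hsnd] with p hp
    rw [add_sub_cancel_left, abs_of_nonneg (mul_nonneg (hη n).le hp.1)]
    exact mul_le_of_le_one_right (hη n).le hp.2.le
  have hR : ∀ x ∈ beam δ ℓ, |x| ≤ δ + ℓ := fun x hx =>
    abs_le.2 ⟨by linarith [hx.1], by linarith [hx.2]⟩
  obtain ⟨c₀, c₁, -, h1, -, h2⟩ := exists_recovery (m := m.prod unitMeasure) (h := fun p => h p.1)
    -- Shifted mass may leave the beam by at most 1, hence the enlarged radius; tests supported in
    -- the beam do not see the part that leaves.
    (G := Prod.fst) (Gs := fun n p => p.1 + 1 / ((n : ℝ) + 1) * p.2) (R := δ + ℓ + 1)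
    (ε := fun n : ℕ => 1 / ((n : ℝ) + 1)) (f := fun n => mollify m h (1 / ((n : ℝ) + 1))) hδ hℓ hu
    (hhi.comp_fst _) measurable_fst (fun n => by fun_prop)
    (fun x hx => (hR x hx).trans (by linarith))
    (hfst.mono fun p hp => (hR _ hp).trans (by linarith))
    (fun n => by
      filter_upwards [hfst, hdist n] with p hp hd
      have h1 : 1 / ((n : ℝ) + 1) ≤ 1 := by
        rw [div_le_one (by positivity)]; linarith [n.cast_nonneg (α := ℝ)]
      have h2 := abs_sub_abs_le_abs_sub (p.1 + 1 / ((n : ℝ) + 1) * p.2) p.1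
      linarith [hR _ hp])
    tendsto_one_div_add_atTop_nhds_zero_nat hdist
    (fun ψ hψ ⟨M, hM⟩ => by
      rw [integral_fun_fst (fun t => ψ t * h t)]
      conv_lhs => rw [hμh]
      rw [signedIntegral_withDensity_of_bound hhi hψ.measurable hM]
      simp)
    (fun n => memLp_mollify hhi _ hΩ isBounded_beam)
    (fun n ψ hψ hψc hψs => setIntegral_mul_mollify hhi (hη n) hΩ isBounded_beam hψ hψc hψs)
  exact ⟨_, h1, h2⟩

end

section

/-! ### Recovery sequences of finite energy -/

variable {δ ℓ b : ℝ}

theorem integral_map_code (hℓ : 0 < ℓ) (n : ℕ) (f : ℝ → ℝ) :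
    ∫ x, f x ∂(unitMeasure.map (code ℓ n)) = (3 / 2) ^ n / ℓ * ∫ x in cantorStep ℓ n, f x := by
  rw [map_code hℓ, integral_smul_measure, ENNReal.toReal_ofReal (by positivity), smul_eq_mul]

theorem lintegral_map_code (hℓ : 0 < ℓ) (n : ℕ) (f : ℝ → ℝ≥0∞) :
    ∫⁻ x, f x ∂(unitMeasure.map (code ℓ n)) =
      ENNReal.ofReal ((3 / 2) ^ n / ℓ) * ∫⁻ x in cantorStep ℓ n, f x := by
  rw [map_code hℓ, lintegral_smul_measure, smul_eq_mul]

/-- The image under `code ℓ n` of a square integrable density has a density on the `n`-th Cantor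
step with controlled energy. -/
theorem exists_density_cantorStep (hℓ : 0 < ℓ) (hb : 0 < b) {h : ℝ → ℝ}
    (hh : MemLp h 2 unitMeasure) (n : ℕ) :
    ∃ f : ℝ → ℝ, MemLp f 2 (volume.restrict (beam δ ℓ)) ∧
      (∀ ψ : ℝ → ℝ, Continuous ψ → HasCompactSupport ψ → tsupport ψ ⊆ beam δ ℓ →
        ∫ x in beam δ ℓ, ψ x * f x = ∫ y, ψ (code ℓ n y) * h y ∂unitMeasure) ∧
      (1 / 2 : ℝ≥0∞) * ∫⁻ x in Ioo 0 ℓ, stiffness ℓ b n x * ENNReal.ofReal (f x ^ 2) ≤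
        ENNReal.ofReal (b / (2 * ℓ) * ∫ y, h y ^ 2 ∂unitMeasure) := by
  have hfm : IsFiniteMeasure unitMeasure := ⟨by simp [unitMeasure]⟩
  have hC := (isCompact_cantorStep ℓ n).measurableSet
  set K := ∫ y, h y ^ 2 ∂unitMeasure with hK
  have hK0 : 0 ≤ K := integral_nonneg fun y => sq_nonneg _
  have hhi := hh.integrable one_le_two
  set ν := unitMeasure.map (code ℓ n) with hν
  set σ : SignedMeasure ℝ := (unitMeasure.withDensityᵥ h).map (code ℓ n) with hσ
  have hσψ : ∀ ψ : ℝ → ℝ, Measurable ψ → ∀ M, (∀ x, |ψ x| ≤ M) →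
      ∫ᵛ x, ψ x ∂<•σ = ∫ y, ψ (code ℓ n y) * h y ∂unitMeasure := fun ψ hψ M hM =>
    signedIntegral_map hhi (measurable_code ℓ n) hψ hM
  -- Cauchy–Schwarz on the unit interval bounds the image measure by the L²(ν) norm of ψ, so by
  -- duality its density has L²(ν) norm at most that of h.
  obtain ⟨hden, hL2⟩ := density_of_sq_signedIntegral_le σ ν (K := K) fun ψ hψ ⟨M, hM⟩ => by
    have hψ2 : MemLp (fun y => ψ (code ℓ n y)) 2 unitMeasure :=
      MemLp.of_bound (hψ.comp (measurable_code ℓ n)).aestronglyMeasurable M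
        (Eventually.of_forall fun y => hM _)
    rw [hσψ ψ hψ M hM, hν, integral_map (f := fun x => ψ x ^ 2) (measurable_code ℓ n).aemeasurable
      (hψ.pow_const 2).aestronglyMeasurable, mul_comm K]
    exact sq_integral_mul_le hψ2 hh
  set g := σ.rnDeriv ν with hg
  have hgm : Measurable g := SignedMeasure.measurable_rnDeriv _ _
  have hgi : Integrable g ν := SignedMeasure.integrable_rnDeriv _ _
  -- Density of ν with respect to Lebesgue measure on C_n. The image of h thus has Lebesgue density
  -- c g there, and one factor c of its square cancels the stiffness up to b/ℓ.
  set c : ℝ := (3 / 2) ^ n / ℓ with hc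
  have hc0 : 0 < c := by positivity
  have hsq : ∀ x, ENNReal.ofReal ((cantorStep ℓ n).indicator (fun x => c * g x) x ^ 2) =
      (cantorStep ℓ n).indicator (fun x => ENNReal.ofReal (c ^ 2) * ENNReal.ofReal (g x ^ 2)) x := by
    intro x
    by_cases hx : x ∈ cantorStep ℓ n
    · simp only [indicator_of_mem hx]
      rw [mul_pow, ENNReal.ofReal_mul (sq_nonneg _)]
    · simp [indicator_of_notMem hx]
  have hgL : ENNReal.ofReal c * ∫⁻ x in cantorStep ℓ n, ENNReal.ofReal (g x ^ 2) ≤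
      ENNReal.ofReal K := by
    rw [← lintegral_map_code hℓ]
    exact hL2
  have hgm2 : Measurable fun x => ENNReal.ofReal (g x ^ 2) := (hgm.pow_const 2).ennreal_ofReal
  have hfm : Measurable ((cantorStep ℓ n).indicator fun x => c * g x) :=
    (hgm.const_mul c).indicator hC
  refine ⟨(cantorStep ℓ n).indicator fun x => c * g x, ?_, ?_, ?_⟩
  · rw [memLp_two_iff_integrable_sq hfm.aestronglyMeasurable]
    refine ⟨(hfm.pow_const 2).aestronglyMeasurable, ?_⟩
    rw [hasFiniteIntegral_iff_ofReal (Eventually.of_forall fun x => sq_nonneg _)]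
    calc ∫⁻ x in beam δ ℓ, ENNReal.ofReal ((cantorStep ℓ n).indicator (fun x => c * g x) x ^ 2)
        ≤ ∫⁻ x, ENNReal.ofReal ((cantorStep ℓ n).indicator (fun x => c * g x) x ^ 2) :=
          setLIntegral_le_lintegral _ _
      _ = ENNReal.ofReal c *
          (ENNReal.ofReal c * ∫⁻ x in cantorStep ℓ n, ENNReal.ofReal (g x ^ 2)) := by
          simp only [hsq]
          rw [lintegral_indicator hC, lintegral_const_mul _ hgm2, sq, ENNReal.ofReal_mul hc0.le,
            mul_assoc]
      _ ≤ ENNReal.ofReal c * ENNReal.ofReal K := mul_le_mul_right hgL _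
      _ < ⊤ := ENNReal.mul_lt_top ENNReal.ofReal_lt_top ENNReal.ofReal_lt_top
  · intro ψ hψ hψc hψs
    obtain ⟨M, hM⟩ := hψ.bounded_above_of_compact_support hψc
    rw [← hσψ ψ hψ.measurable M hM, ← hden, signedIntegral_withDensity_of_bound hgi hψ.measurable hM,
      hν, integral_map_code hℓ, ← hc, ← integral_const_mul, ← integral_indicator hC]
    simp only [mul_comm (ψ _)]
    rw [setIntegral_eq_integral_of_tsupport hψs]
    refine integral_congr_ae (Eventually.of_forall fun x => ?_)
    by_cases hx : x ∈ cantorStep ℓ n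
    · simp only [indicator_of_mem hx]
      ring
    · simp only [indicator_of_notMem hx, zero_mul]
  · have hst : ∀ x, stiffness ℓ b n x *
        ENNReal.ofReal ((cantorStep ℓ n).indicator (fun x => c * g x) x ^ 2) =
        (cantorStep ℓ n).indicator (fun x => ENNReal.ofReal ((2 / 3) ^ n * b * c ^ 2) *
          ENNReal.ofReal (g x ^ 2)) x := by
      intro x
      rw [hsq]
      by_cases hx : x ∈ cantorStep ℓ n
      · simp only [indicator_of_mem hx, stiffness, if_pos hx]
        rw [ENNReal.ofReal_mul (by positivity : 0 ≤ (2 / 3) ^ n * b), mul_assoc]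
      · simp only [indicator_of_notMem hx, mul_zero]
    simp only [hst]
    have h32 : (2 / 3 : ℝ) ^ n * (3 / 2) ^ n = 1 := by rw [← mul_pow]; norm_num
    have hcb : (2 / 3) ^ n * b * c ^ 2 = b / ℓ * c := by
      rw [hc]
      calc (2 / 3) ^ n * b * ((3 / 2) ^ n / ℓ) ^ 2
          = ((2 / 3) ^ n * (3 / 2) ^ n) * (b / ℓ * ((3 / 2) ^ n / ℓ)) := by ring
        _ = _ := by rw [h32, one_mul]
    calc (1 / 2 : ℝ≥0∞) * ∫⁻ x in Ioo 0 ℓ, (cantorStep ℓ n).indicator (fun x =>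
          ENNReal.ofReal ((2 / 3) ^ n * b * c ^ 2) * ENNReal.ofReal (g x ^ 2)) x
        ≤ (1 / 2 : ℝ≥0∞) * ∫⁻ x, (cantorStep ℓ n).indicator (fun x =>
          ENNReal.ofReal ((2 / 3) ^ n * b * c ^ 2) * ENNReal.ofReal (g x ^ 2)) x :=
          mul_le_mul_right (setLIntegral_le_lintegral _ _) _
      _ = ENNReal.ofReal (b / (2 * ℓ)) *
          (ENNReal.ofReal c * ∫⁻ x in cantorStep ℓ n, ENNReal.ofReal (g x ^ 2)) := by
          rw [lintegral_indicator hC, lintegral_const_mul _ hgm2, hcb,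
            ENNReal.ofReal_mul (by positivity), ← mul_assoc, ← mul_assoc, ← mul_assoc]
          congr 2
          rw [show (1 / 2 : ℝ≥0∞) = ENNReal.ofReal (1 / 2) by
            rw [ENNReal.ofReal_div_of_pos two_pos]; simp, ← ENNReal.ofReal_mul (by positivity)]
          congr 1
          field_simp
      _ ≤ ENNReal.ofReal (b / (2 * ℓ)) * ENNReal.ofReal K := mul_le_mul_right hgL _
      _ = _ := (ENNReal.ofReal_mul (by positivity)).symm

/-- Ramps based at nonnegative points vanish left of 0. On the wall only c₀ + c₁ x is left, and it
does not depend on G, so clamping of u transfers to its approximants. -/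
theorem deflection_eq_of_nonpos {S : Type*} [MeasurableSpace S] {m : Measure S} {h G : S → ℝ}
    (hG : ∀ᵐ s ∂m, 0 ≤ G s) (c₀ c₁ : ℝ) {x : ℝ} (hx : x ≤ 0) :
    deflection m h G c₀ c₁ x = c₀ + c₁ * x := by
  rw [deflection, integral_eq_zero_of_ae, add_zero]
  filter_upwards [hG] with s hs
  simp [ramp, max_eq_right (show x - G s ≤ 0 by linarith)]

theorem exists_recovery_of_ne_top (hδ : 0 < δ) (hℓ : 0 < ℓ) (hb : 0 < b) {P : ℝ} {u : ℝ → ℝ}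
    (hW : MemWInf δ ℓ u) (hE : energyInf δ ℓ b P u ≠ ⊤) :
    ∃ us : ℕ → ℝ → ℝ, (∀ n, MemSobolev 2 2 (beam δ ℓ) (us n)) ∧ BeamTendsto δ ℓ us u ∧
      limsup (fun n => energy δ ℓ b P n (us n)) atTop ≤ energyInf δ ℓ b P u := by
  obtain ⟨hu, hac, hclamp⟩ := id hW
  have hcf := isFiniteMeasure_cantorMeasure hℓ
  have hfm : IsFiniteMeasure unitMeasure := ⟨by simp [unitMeasure]⟩
  set μ := secondDerivMeasure (beam δ ℓ) u with hμ
  set ρ := μ.rnDeriv (cantorMeasure ℓ) with hρ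
  have hρm : Measurable ρ := SignedMeasure.measurable_rnDeriv _ _
  have hρi : Integrable ρ (cantorMeasure ℓ) := SignedMeasure.integrable_rnDeriv _ _
  have hden : (cantorMeasure ℓ).withDensityᵥ ρ = μ :=
    (SignedMeasure.absolutelyContinuous_iff_withDensityᵥ_rnDeriv_eq _ _).1 hac
  set H := (Measure.hausdorffMeasure dimS (cantor ℓ)).toReal with hH
  have hHpos : 0 < H := ENNReal.toReal_pos (hausdorffMeasure_cantor_ne_zero hℓ)
    (hausdorffMeasure_cantor_ne_top hℓ)
  have hEeq : energyInf δ ℓ b P u = ((ENNReal.ofReal (b * H / (2 * ℓ)) *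
      ∫⁻ x, ENNReal.ofReal (ρ x ^ 2) ∂(cantorMeasure ℓ) : ℝ≥0∞) : EReal) -
        ((P * endValue δ ℓ u : ℝ) : EReal) := by
    unfold energyInf
    rw [if_pos hW, lintegral_const_mul _ (hρm.pow_const 2).ennreal_ofReal,
      ← ENNReal.ofReal_toReal (hausdorffMeasure_cantor_ne_top hℓ), ← hH,
      ← ENNReal.ofReal_mul hb.le, show (2 : ℝ≥0∞) = ENNReal.ofReal 2 by simp,
      ← ENNReal.ofReal_mul two_pos.le, ← ENNReal.ofReal_div_of_pos (by positivity)]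
  have hfin : ∫⁻ x, ENNReal.ofReal (ρ x ^ 2) ∂(cantorMeasure ℓ) ≠ ⊤ := by
    intro htop
    apply hE
    rw [hEeq, htop, ENNReal.mul_top (ENNReal.ofReal_pos.2 (by positivity)).ne']
    exact EReal.top_sub_coe _
  have hρ2 : Integrable (fun x => ρ x ^ 2) (cantorMeasure ℓ) :=
    ⟨(hρm.pow_const 2).aestronglyMeasurable, by
      rw [hasFiniteIntegral_iff_ofReal (Eventually.of_forall fun x => sq_nonneg _)]
      exact hfin.lt_top⟩
  have hcl := measurable_codeLim hℓ
  have hcomp : ∀ {f : ℝ → ℝ}, Integrable f (cantorMeasure ℓ) →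
      Integrable (fun y => f (codeLim hℓ y)) unitMeasure := fun {f} hf => by
    rw [cantorMeasure_eq_smul hℓ, integrable_smul_measure (hausdorffMeasure_cantor_ne_zero hℓ)
      (hausdorffMeasure_cantor_ne_top hℓ), cantorProb] at hf
    exact hf.comp_measurable hcl
  -- Since ℋ^s⌞C is H times the image of Lebesgue measure under `codeLim`, u'' is the image of h
  -- 𝓛⌞[0,1), and ∫h² = H ∫ρ² dℋ^s⌞C.
  set h : ℝ → ℝ := fun y => H * ρ (codeLim hℓ y) with hh
  have hhm : Measurable h := (hρm.comp hcl).const_mul H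
  have hh2 : MemLp h 2 unitMeasure := by
    rw [memLp_two_iff_integrable_sq hhm.aestronglyMeasurable]
    simp only [hh, mul_pow]
    exact (hcomp hρ2).const_mul _
  have hK : ∫ y, h y ^ 2 ∂unitMeasure = H * ∫ x, ρ x ^ 2 ∂(cantorMeasure ℓ) := by
    rw [integral_cantorMeasure hℓ (hρm.pow_const 2), ← hH]
    simp only [hh, mul_pow]
    rw [integral_const_mul, sq, mul_assoc]
  choose f hf2 hfψ hfE using fun n => exists_density_cantorStep hℓ hb hh2 n
  have hIcc : ∀ x ∈ Icc 0 ℓ, |x| ≤ δ + ℓ := fun x hx =>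
    abs_le.2 ⟨by linarith [hx.1], by linarith [hx.2]⟩
  have hcodeIcc : ∀ n, ∀ᵐ y ∂unitMeasure, code ℓ n y ∈ Icc 0 ℓ := fun n =>
    ae_restrict_of_forall_mem measurableSet_Ico fun y hy =>
      cantorStep_subset_Icc hℓ n (code_mem_cantorStep hℓ n y hy)
  have hlimIcc : ∀ᵐ y ∂unitMeasure, codeLim hℓ y ∈ Icc 0 ℓ :=
    ae_restrict_of_forall_mem measurableSet_Ico fun y hy =>
      cantor_subset_Icc ℓ (codeLim_mem_cantor hℓ hy)
  obtain ⟨c₀, c₁, hc, h1, h2, h3⟩ := exists_recovery (h := h) (Gs := code ℓ) (R := δ + ℓ)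
    (ε := fun n => 2 * ℓ * (1 / 3) ^ n) hδ hℓ hu (hh2.integrable one_le_two) hcl
    (measurable_code ℓ) (fun x hx => abs_le.2 ⟨by linarith [hx.1], by linarith [hx.2]⟩)
    (hlimIcc.mono fun y hy => hIcc _ hy) (fun n => (hcodeIcc n).mono fun y hy => hIcc _ hy)
    (by simpa using (tendsto_pow_atTop_nhds_zero_of_lt_one (r := (1 / 3 : ℝ)) (by norm_num)
      (by norm_num)).const_mul (2 * ℓ))
    (fun n => ae_restrict_of_forall_mem measurableSet_Ico fun y hy =>
      abs_code_sub_codeLim_le hℓ hy n)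
    (fun ψ hψ ⟨M, hM⟩ => by
      rw [← hμ, ← hden, signedIntegral_withDensity_of_bound hρi hψ.measurable hM,
        integral_cantorMeasure hℓ (f := fun x => ψ x * ρ x) (hψ.measurable.mul hρm), ← hH, ← integral_const_mul]
      refine integral_congr_ae (Eventually.of_forall fun y => ?_)
      simp only [hh]
      ring) hf2 hfψ
  refine ⟨_, h1, h3, ?_⟩
  have hsub : Ioc (-δ) 0 ⊆ beam δ ℓ := fun x hx => ⟨hx.1, hx.2.trans_lt hℓ⟩
  have hcl0 : ∀ n, ClampedAtWall δ (deflection unitMeasure h (code ℓ n) c₀ c₁) := by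
    intro n
    have hc' := ae_restrict_of_ae_restrict_of_subset hsub hc
    filter_upwards [hclamp, hc', ae_restrict_mem measurableSet_Ioc] with x hx1 hx2 hx3
    rw [deflection_eq_of_nonpos ((hcodeIcc n).mono fun y hy => hy.1) c₀ c₁ hx3.2,
      ← deflection_eq_of_nonpos (hlimIcc.mono fun y hy => hy.1) c₀ c₁ hx3.2, ← hx2, hx1]
  -- J equals the elastic part of E_∞(u) and bounds that of every approximant, so only the load term
  -- varies with n, and it converges.
  set J := b / (2 * ℓ) * ∫ y, h y ^ 2 ∂unitMeasure with hJ
  have hJ0 : 0 ≤ J := mul_nonneg (by positivity) (integral_nonneg fun y => sq_nonneg _)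
  have hle : ∀ n, energy δ ℓ b P n (deflection unitMeasure h (code ℓ n) c₀ c₁) ≤
      ((J - P * endValue δ ℓ (deflection unitMeasure h (code ℓ n) c₀ c₁) : ℝ) : EReal) := by
    intro n
    unfold energy
    rw [if_pos ⟨h1 n, hcl0 n⟩]
    refine coe_sub_le_of_le_ofReal hJ0 (le_trans (le_of_eq ?_) (hfE n))
    congr 1
    refine lintegral_congr_ae ?_
    filter_upwards [ae_restrict_of_ae_restrict_of_subset
      (Ioo_subset_Ioo_left (by linarith) : Ioo 0 ℓ ⊆ beam δ ℓ) (h2 n)] with x hx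
    rw [hx]
  have hend := tendsto_endValue hδ hℓ (fun n => (h1 n).one_one isBounded_beam) hu.1 h3.1
  have hlim : Tendsto (fun n => ((J - P * endValue δ ℓ
      (deflection unitMeasure h (code ℓ n) c₀ c₁) : ℝ) : EReal)) atTop
      (𝓝 ((J - P * endValue δ ℓ u : ℝ) : EReal)) :=
    (continuous_coe_real_ereal.tendsto _).comp ((hend.const_mul P).const_sub J)
  refine (limsup_le_limsup (Eventually.of_forall hle) (by isBoundedDefault)
    (by isBoundedDefault)).trans ?_
  rw [hlim.limsup_eq, hEeq, EReal.coe_sub,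
    ← ofReal_integral_eq_lintegral_ofReal hρ2 (Eventually.of_forall fun x => sq_nonneg _),
    ← ENNReal.ofReal_mul (by positivity)]
  refine EReal.sub_le_sub ?_ le_rfl
  rw [EReal.coe_ennreal_ofReal, hJ, hK, ← mul_assoc, div_mul_eq_mul_div]
  exact EReal.coe_le_coe_iff.2 (le_max_left _ _)

theorem exists_recovery_sequence (hδ : 0 < δ) (hℓ : 0 < ℓ) (hb : 0 < b) {P : ℝ} {u : ℝ → ℝ}
    (hu : MemW11MeasureSecondDeriv (beam δ ℓ) u) :
    ∃ us : ℕ → ℝ → ℝ, (∀ n, MemSobolev 2 2 (beam δ ℓ) (us n)) ∧ BeamTendsto δ ℓ us u ∧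
      limsup (fun n => energy δ ℓ b P n (us n)) atTop ≤ energyInf δ ℓ b P u := by
  by_cases hE : energyInf δ ℓ b P u = ⊤
  · obtain ⟨us, h1, h2⟩ := exists_beamTendsto hδ hℓ hu
    exact ⟨us, h1, h2, hE ▸ le_top⟩
  · refine exists_recovery_of_ne_top hδ hℓ hb ?_ hE
    by_contra hW
    exact hE (if_neg hW)

end

end CantorBeam

theorem mainTheorem1 (δ ℓ b P : ℝ) (hδ : 0 < δ) (hℓ : 0 < ℓ) (hb : 0 < b) (hP : 0 < P) :
    (∀ u : ℝ → ℝ, CantorBeam.MemW11MeasureSecondDeriv (CantorBeam.beam δ ℓ) u →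
      ∀ us : ℕ → ℝ → ℝ,
        (∀ n, CantorBeam.MemSobolev 2 2 (CantorBeam.beam δ ℓ) (us n)) →
        CantorBeam.BeamTendsto δ ℓ us u →
        CantorBeam.energyInf δ ℓ b P u ≤
          Filter.liminf (fun n => CantorBeam.energy δ ℓ b P n (us n)) Filter.atTop) ∧
    (∀ u : ℝ → ℝ, CantorBeam.MemW11MeasureSecondDeriv (CantorBeam.beam δ ℓ) u →
      ∃ us : ℕ → ℝ → ℝ,
        (∀ n, CantorBeam.MemSobolev 2 2 (CantorBeam.beam δ ℓ) (us n)) ∧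
        CantorBeam.BeamTendsto δ ℓ us u ∧
        Filter.limsup (fun n => CantorBeam.energy δ ℓ b P n (us n)) Filter.atTop ≤
          CantorBeam.energyInf δ ℓ b P u) := by
  refine ⟨fun u hu us hus hconv => ?_, fun u hu => ?_⟩
  · exact CantorBeam.energyInf_le_liminf hδ hℓ hb hu hus hconv
  · exact CantorBeam.exists_recovery_sequence hδ hℓ hb hu
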